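/- Let $(H,G,\mu)$ be a crossed module: a homomorphism of groups $\mu\colon H\to G$ with an action of $G$ on $H$ by automorphisms such that $\mu({}^gh)=g\mu(h)g^{-1}$ and ${}^{\mu(h)}h'=hh'h^{-1}$. It determines an internal category in groups with objects $G$ and arrows $H\rtimes G$, where $(h,g)$ is an arrow $g\to\mu(h)g$; let $\mathcal N_*(H,G,\mu)$ be the nerve of this internal category, a simplicial group. For a simplicial group $G_*$ acting on a simplicial abelian group $A_*$, let $B(G_*,A_*)$ be the bicomplex with entries $B_m(G_n)\otimes_{G_n}A_n$, where $B_m(\Gamma)=\mathbb Z(\Gamma)^{\otimes (m+1)}$ is the standard resolution of a group $\Gamma$, with differential $$\partial(g_0\otimes\cdots\otimes g_m)=(-1)^m g_0\otimes\cdots\otimes g_{m-1}+\sum_{i=0}^{m-1}(-1)^i g_0\otimes\cdots\otimes g_ig_{i+1}\otimes\cdots\otimes g_m$$ and right action $(g_0\otimes g_1\otimes\cdots\otimes g_m)g=g^{-1}g_0\otimes g_1\otimes\cdots\otimes g_m$, and where the other differential is the alternating sum of the face maps $b\otimes a\mapsto d_i(b)\otimes\partial_i(a)$. If $(H,G,\mu)$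 acts on an abelian crossed module $(C,A,\nu)$, then $\mathcal N_*(H,G,\mu)$ acts on $\mathcal N_*(C,A,\nu)$, and $$H_n((H,G,\mu),(C,A,\nu))=H_n\bigl(\operatorname{Tot}B(\mathcal N_*(H,G,\mu),\mathcal N_*(C,A,\nu))\bigr).$$ Write $H_n(H,G,\mu)$ for $H_n((H,G,\mu),(0,\mathbb Z,0))$ with the trivial action of $(H,G,\mu)$ on $(0,\mathbb Z,0)$. The classifying space $\mathcal B(H,G,\mu)$ is the geometric realisation of the diagonal of the bisimplicial set $\mathcal N_{pq}(H,G,\mu)$ obtained by taking, for each $p$, the nerve (in the direction $q$) of the group $\mathcal N_p(H,G,\mu)$ viewed as a category with one object. The $n$th Baues--Ellis homology of $(H,G,\mu)$ with integral coefficients is the singular homology $H_n(\mathcal B(H,G,\mu);\mathbb Z)$ of the classifying space. Then for every crossed module $(H,G,\mu)$ and every $n\ge 0$ there is an isomorphism of abelian groups $$H_n(H,G,\mu)\cong H_n(\mathcal B(H,G,\mu);\mathbb Z).$$ -/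

import Mathlib

open CategoryTheory

universe u v

/-! ### Crossed modules and their nerves -/

/-- A crossed module `μ : H → G`, where the group `G` acts on the group `H` (by automorphisms). -/
structure CrossedModule (H G : Type u) [Group H] [Group G] [MulDistribMulAction G H] where
  μ : H →* G
  precrossed : ∀ (g : G) (h : H), μ (g • h) = g * μ h * g⁻¹
  peiffer : ∀ h h' : H, μ h • h' = h * h' * h⁻¹

namespace CrossedModule

section Nerve

variable {H G : Type u} [Group H] [Group G] [MulDistribMulAction G H]

/-- The internal category in groups of a crossed module has objects `G` and arrows
`(h, g) : g ⟶ μ h * g`, for `(h, g) ∈ H ⋊ G`; it is a groupoid. An `n`-simplex of its nerve is a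
string of `n` composable arrows. It is recorded here through its vertices `vert i` and all of its
edges: `(edge i j, vert j)` is the arrow from `vert j` to `vert i` (for `i ≤ j` a composite of
arrows of the string, for `j ≤ i` its inverse). For `ι = {0, …, n}` the coordinates
`(h₁, …, hₙ, g) = (edge 0 1, edge 1 2, …, edge (n-1) n, vert n)` identify this with
`H ⋊ (⋯ (H ⋊ G) ⋯)`. -/
@[ext]
structure Simplex (X : CrossedModule H G) (ι : Type) where
  vert : ι → G
  edge : ι → ι → H
  edge_mul : ∀ i j k, edge i j * edge j k = edge i k
  vert_eq : ∀ i j, vert i = X.μ (edge i j) * vert j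

variable (X : CrossedModule H G)

/-- The group structure on simplices: vertices multiply in `G`, and edges `(edge i j, vert j)`
multiply in the semidirect product `H ⋊ G`. -/
instance (ι : Type) : Group (X.Simplex ι) where
  mul x y :=
    { vert := fun i => x.vert i * y.vert i
      edge := fun i j => x.edge i j * x.vert j • y.edge i j
      edge_mul := fun i j k => by
        rw [x.vert_eq j k, mul_smul, X.peiffer, ← x.edge_mul i j k, ← y.edge_mul i j k, smul_mul']
        group
      vert_eq := fun i j => by
        rw [map_mul, X.precrossed, x.vert_eq i j, y.vert_eq i j]
        group }
  one :=
    { vert := fun _ => 1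
      edge := fun _ _ => 1
      edge_mul := fun _ _ _ => mul_one 1
      vert_eq := fun _ _ => by simp }
  inv x :=
    { vert := fun i => (x.vert i)⁻¹
      edge := fun i j => (x.vert j)⁻¹ • (x.edge i j)⁻¹
      edge_mul := fun i j k => by
        rw [x.vert_eq j k, mul_inv_rev, mul_smul, ← map_inv X.μ (x.edge j k), X.peiffer,
          ← smul_mul', ← x.edge_mul i j k]
        congr 1
        group
      vert_eq := fun i j => by
        rw [X.precrossed, x.vert_eq i j, map_inv]
        group }
  mul_assoc x y z := by
    apply Simplex.ext
    · funext i
      exact mul_assoc (x.vert i) (y.vert i) (z.vert i)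
    · funext i j
      change (x.edge i j * x.vert j • y.edge i j) * (x.vert j * y.vert j) • z.edge i j =
        x.edge i j * x.vert j • (y.edge i j * y.vert j • z.edge i j)
      rw [smul_mul', mul_smul, mul_assoc]
  one_mul x := by
    apply Simplex.ext
    · funext i
      exact one_mul (x.vert i)
    · funext i j
      change 1 * (1 : G) • x.edge i j = x.edge i j
      rw [one_smul, one_mul]
  mul_one x := by
    apply Simplex.ext
    · funext i
      exact mul_one (x.vert i)
    · funext i j
      change x.edge i j * x.vert j • (1 : H) = x.edge i j
      rw [smul_one, mul_one]
  inv_mul_cancel x := by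
    apply Simplex.ext
    · funext i
      exact inv_mul_cancel (x.vert i)
    · funext i j
      change (x.vert j)⁻¹ • (x.edge i j)⁻¹ * (x.vert j)⁻¹ • x.edge i j = 1
      rw [← smul_mul', inv_mul_cancel, smul_one]

/-- Restriction of simplices along a map of vertices. -/
def Simplex.restrict {ι κ : Type} (f : κ → ι) : X.Simplex ι →* X.Simplex κ where
  toFun x :=
    { vert := fun i => x.vert (f i)
      edge := fun i j => x.edge (f i) (f j)
      edge_mul := fun i j k => x.edge_mul (f i) (f j) (f k)
      vert_eq := fun i j => x.vert_eq (f i) (f j) }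
  map_one' := rfl
  map_mul' _ _ := rfl

/-- The nerve of a crossed module, a simplicial group. -/
def nerve : SimplicialObject GrpCat.{u} where
  obj n := GrpCat.of (X.Simplex (Fin (n.unop.len + 1)))
  map f := GrpCat.ofHom (Simplex.restrict X f.unop.toOrderHom)

end Nerve

/-! ### Abelian crossed modules and their nerves

An abelian crossed module `(C, A, ν)` is a homomorphism `ν : C → A` of abelian groups (the action
of `A` on `C` being trivial). It is written additively. -/

section Coefficients

variable {C A : Type v} [AddCommGroup C] [AddCommGroup A]

/-- The simplices of the nerve of an abelian crossed module: pairs consisting of vertices and edges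
as in `CrossedModule.Simplex`; as the action is trivial, the group structure is pointwise. -/
def abSimplex (ν : C →+ A) (ι : Type) : AddSubgroup ((ι → A) × (ι → ι → C)) where
  carrier := {x | (∀ i j k, x.2 i j + x.2 j k = x.2 i k) ∧ ∀ i j, x.1 i = ν (x.2 i j) + x.1 j}
  add_mem' {x y} hx hy := by
    refine ⟨fun i j k => ?_, fun i j => ?_⟩
    · change (x.2 i j + y.2 i j) + (x.2 j k + y.2 j k) = x.2 i k + y.2 i k
      rw [← hx.1 i j k, ← hy.1 i j k]
      abel
    · change x.1 i + y.1 i = ν (x.2 i j + y.2 i j) + (x.1 j + y.1 j)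
      rw [hx.2 i j, hy.2 i j, map_add]
      abel
  zero_mem' := ⟨fun _ _ _ => add_zero 0, fun _ _ => by simp⟩
  neg_mem' {x} hx := by
    refine ⟨fun i j k => ?_, fun i j => ?_⟩
    · change -x.2 i j + -x.2 j k = -x.2 i k
      rw [← hx.1 i j k]
      abel
    · change -x.1 i = ν (-x.2 i j) + -x.1 j
      rw [hx.2 i j, map_neg]
      abel

/-- Restriction of simplices along a map of vertices. -/
def abSimplex.restrict (ν : C →+ A) {ι κ : Type} (f : κ → ι) : abSimplex ν ι →+ abSimplex ν κ where
  toFun x :=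
    ⟨(fun i => x.1.1 (f i), fun i j => x.1.2 (f i) (f j)),
      fun i j k => x.2.1 (f i) (f j) (f k), fun i j => x.2.2 (f i) (f j)⟩
  map_zero' := rfl
  map_add' _ _ := rfl

/-- The nerve of an abelian crossed module, a simplicial abelian group. -/
def abNerve (ν : C →+ A) : SimplicialObject AddCommGrpCat.{v} where
  obj n := AddCommGrpCat.of (abSimplex ν (Fin (n.unop.len + 1)))
  map f := AddCommGrpCat.ofHom (abSimplex.restrict ν f.unop.toOrderHom)

/-! ### Actions of crossed modules on abelian crossed modules -/

variable {H G : Type u} [Group H] [Group G] [MulDistribMulAction G H]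

/-- An action of the crossed module `X = (H, G, μ)` on the abelian crossed module `(C, A, ν)`. -/
structure Action (X : CrossedModule H G) (ν : C →+ A) where
  /-- the action of `G` on `C` -/
  top : G →* AddMonoid.End C
  /-- the action of `G` on `A` -/
  base : G →* AddMonoid.End A
  /-- the map `H × A → C` -/
  ξ : H → A → C
  ν_top : ∀ g c, ν (top g c) = base g (ν c)
  ν_ξ : ∀ h a, ν (ξ h a) = base (X.μ h) a - a
  ξ_ν : ∀ h c, ξ h (ν c) = top (X.μ h) c - c
  top_ξ : ∀ g h a, top g (ξ h a) = ξ (g • h) (base g a)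
  ξ_mul : ∀ h h' a, ξ (h * h') a = top (X.μ h) (ξ h' a) + ξ h a
  ξ_add : ∀ h a a', ξ h (a + a') = ξ h a + ξ h a'

/-- The trivial action. -/
def Action.trivial (X : CrossedModule H G) (ν : C →+ A) : X.Action ν where
  top := 1
  base := 1
  ξ := fun _ _ => 0
  ν_top _ _ := rfl
  ν_ξ _ _ := by simp
  ξ_ν _ _ := by simp
  top_ξ _ _ _ := by simp
  ξ_mul _ _ _ := by simp
  ξ_add _ _ _ := by simp

end Coefficients

end CrossedModule

/-- A (pointwise) action of a simplicial group on a simplicial abelian group. -/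
structure SimplicialAction (Γ : SimplicialObject GrpCat.{u})
    (M : SimplicialObject AddCommGrpCat.{v}) where
  act : ∀ n, Γ.obj n →* AddMonoid.End (M.obj n)
  map_act : ∀ {n m} (f : n ⟶ m) (g : Γ.obj n) (a : M.obj n),
    M.map f (act n g a) = act m (Γ.map f g) (M.map f a)

namespace CrossedModule

section InducedAction

variable {C A : Type v} [AddCommGroup C] [AddCommGroup A]
variable {H G : Type u} [Group H] [Group G] [MulDistribMulAction G H]
variable {X : CrossedModule H G} {ν : C →+ A}

/-- The action on simplices induced by an action of crossed modules. On vertices it is the action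
of `G` on `A`. On edges it is the action of `H ⋊ G` on `C ⋊ A` given by conjugation in the
semidirect product of crossed modules,
`(h, g) • (c, a) = (μ h • g • c + ξ h (g • a), g • a)`. -/
def Action.actSimplex (α : X.Action ν) (ι : Type) :
    X.Simplex ι →* AddMonoid.End (abSimplex ν ι) where
  toFun x :=
    { toFun := fun y =>
        ⟨(fun i => α.base (x.vert i) (y.1.1 i),
          fun i j => α.top (X.μ (x.edge i j)) (α.top (x.vert j) (y.1.2 i j)) +
            α.ξ (x.edge i j) (α.base (x.vert j) (y.1.1 j))), by
          constructor
          · intro i j k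
            dsimp only
            have e1 : α.base (x.vert j) (y.1.1 j) =
                ν (α.top (x.vert j) (y.1.2 j k)) +
                  (ν (α.ξ (x.edge j k) (α.base (x.vert k) (y.1.1 k))) +
                    α.base (x.vert k) (y.1.1 k)) := by
              rw [y.2.2 j k, map_add, α.ν_top, α.ν_ξ, sub_add_cancel, x.vert_eq j k, map_mul]
              rfl
            have e2 : ∀ c, α.top (X.μ (x.edge j k)) (α.top (x.vert k) c) =
                α.top (x.vert j) c := fun c => by
              rw [x.vert_eq j k, map_mul]; rfl
            have e3 : ∀ c, α.top (X.μ (x.edge i k)) (α.top (x.vert k) c) =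
                α.top (X.μ (x.edge i j)) (α.top (x.vert j) c) := fun c => by
              rw [← e2, ← x.edge_mul i j k, map_mul, map_mul]; rfl
            rw [e1, α.ξ_add, α.ξ_add, α.ξ_ν, α.ξ_ν, e2, e3, ← x.edge_mul i j k, α.ξ_mul,
              ← y.2.1 i j k, map_add, map_add]
            abel
          · intro i j
            dsimp only
            rw [map_add, α.ν_top, α.ν_top, α.ν_ξ, y.2.2 i j, x.vert_eq i j, map_mul, map_add]
            change α.base _ (α.base _ _) + α.base _ (α.base _ _) = _
            abel⟩
      map_zero' := by
        apply Subtype.ext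
        apply Prod.ext
        · funext i
          exact map_zero _
        · funext i j
          change α.top _ (α.top _ 0) + α.ξ (x.edge i j) (α.base _ 0) = 0
          have := α.ξ_add (x.edge i j) 0 0
          rw [add_zero, left_eq_add] at this
          rw [map_zero, map_zero, map_zero, this, add_zero]
      map_add' := fun y z => by
        apply Subtype.ext
        apply Prod.ext
        · funext i
          exact map_add _ _ _
        · funext i j
          change α.top _ (α.top _ (y.1.2 i j + z.1.2 i j)) +
            α.ξ _ (α.base _ (y.1.1 j + z.1.1 j)) = (_ + _) + (_ + _)
          rw [map_add, map_add, map_add, α.ξ_add]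
          abel }
  map_one' := by
    refine AddMonoidHom.ext fun y => ?_
    apply Subtype.ext
    apply Prod.ext
    · funext i
      change α.base 1 (y.1.1 i) = y.1.1 i
      rw [map_one]; rfl
    · funext i j
      change α.top (X.μ 1) (α.top 1 (y.1.2 i j)) + α.ξ 1 (α.base 1 (y.1.1 j)) = y.1.2 i j
      have h1 : ∀ c, α.top 1 c = c := fun c => by rw [map_one]; rfl
      have h2 := α.ξ_mul 1 1 (α.base 1 (y.1.1 j))
      rw [map_one X.μ, h1, mul_one, left_eq_add] at h2
      rw [map_one X.μ, h1, h1, h2, add_zero]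
  map_mul' x x' := by
    refine AddMonoidHom.ext fun y => ?_
    apply Subtype.ext
    apply Prod.ext
    · funext i
      change α.base (x.vert i * x'.vert i) (y.1.1 i) = α.base _ (α.base _ _)
      rw [map_mul]; rfl
    · funext i j
      change α.top (X.μ (x.edge i j * x.vert j • x'.edge i j))
          (α.top (x.vert j * x'.vert j) (y.1.2 i j)) +
          α.ξ (x.edge i j * x.vert j • x'.edge i j) (α.base (x.vert j * x'.vert j) (y.1.1 j)) =
        α.top (X.μ (x.edge i j)) (α.top (x.vert j)
          (α.top (X.μ (x'.edge i j)) (α.top (x'.vert j) (y.1.2 i j)) +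
            α.ξ (x'.edge i j) (α.base (x'.vert j) (y.1.1 j)))) +
          α.ξ (x.edge i j) (α.base (x.vert j) (α.base (x'.vert j) (y.1.1 j)))
      have hm : ∀ g g' c, α.top (g * g') c = α.top g (α.top g' c) := fun g g' c => by
        rw [map_mul]; rfl
      have hb : ∀ g g' a, α.base (g * g') a = α.base g (α.base g' a) := fun g g' a => by
        rw [map_mul]; rfl
      rw [α.ξ_mul, hb, ← α.top_ξ, map_add, map_add, ← add_assoc]
      congr 2
      simp only [← hm, map_mul X.μ, X.precrossed]
      congr 2
      group

/-- The action of nerves induced by an action of crossed modules. -/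
def Action.toSimplicialAction (α : X.Action ν) : SimplicialAction X.nerve (abNerve ν) where
  act n := α.actSimplex (Fin (n.unop.len + 1))
  map_act _ _ _ := rfl

end InducedAction

end CrossedModule

/-! ### The standard resolution and the bicomplex -/

section Bar

open TensorProduct

/-- The underlying abelian group `ℤ[G] ⊗ ⋯ ⊗ ℤ[G]` (`m + 1` factors) of the standard resolution,
free on the tuples `g₀ ⊗ ⋯ ⊗ g_m`. -/
abbrev Bar (G : Type u) (m : ℕ) : Type u := (Fin (m + 1) → G) →₀ ℤ

/-- The differential
`g₀ ⊗ ⋯ ⊗ g_m ↦ ∑_{i < m} (-1)^i g₀ ⊗ ⋯ ⊗ g_i g_{i+1} ⊗ ⋯ ⊗ g_m + (-1)^m g₀ ⊗ ⋯ ⊗ g_{m-1}`.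
Note that `Fin.contractNth (Fin.last _)` forgets the last entry. -/
noncomputable def barD (G : Type u) [Group G] (m : ℕ) : Bar G (m + 1) →ₗ[ℤ] Bar G m :=
  ∑ i : Fin (m + 2), (-1 : ℤ) ^ (i : ℕ) • Finsupp.lmapDomain ℤ ℤ (Fin.contractNth i (· * ·))

/-- The right action `(g₀ ⊗ g₁ ⊗ ⋯ ⊗ g_m) g = g⁻¹g₀ ⊗ g₁ ⊗ ⋯ ⊗ g_m`. -/
noncomputable def barR {G : Type u} [Group G] (m : ℕ) (g : G) : Bar G m →ₗ[ℤ] Bar G m :=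
  Finsupp.lmapDomain ℤ ℤ (fun x => Function.update x 0 (g⁻¹ * x 0))

/-- The map induced by a homomorphism of groups. -/
noncomputable def barMap {G G' : Type u} [Group G] [Group G'] (φ : G →* G') (m : ℕ) :
    Bar G m →ₗ[ℤ] Bar G' m :=
  Finsupp.lmapDomain ℤ ℤ (fun x i => φ (x i))

variable {G : Type u} [Group G] {A : Type v} [AddCommGroup A]

/-- The subgroup generated by the relations `b g ⊗ a = b ⊗ g a`. -/
noncomputable def barRel (ρ : G →* AddMonoid.End A) (m : ℕ) : AddSubgroup (Bar G m ⊗[ℤ] A) :=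
  AddSubgroup.closure {t | ∃ (b : Bar G m) (g : G) (a : A), t = barR m g b ⊗ₜ a - b ⊗ₜ ρ g a}

/-- The tensor product `B_m(G) ⊗_G A`. -/
abbrev BarTensor (ρ : G →* AddMonoid.End A) (m : ℕ) : Type (max u v) :=
  (Bar G m ⊗[ℤ] A) ⧸ barRel ρ m

theorem contractNth_contractNth {m : ℕ} (g : Fin (m + 3) → G) {i j : Fin (m + 2)} (h : i ≤ j) :
    Fin.contractNth i (· * ·) (Fin.contractNth j.succ (· * ·) g) =
      Fin.contractNth j (· * ·) (Fin.contractNth i.castSucc (· * ·) g) := by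
  have inj : Function.Injective (Fin.partialProd (M := G) (n := m + 1)) := fun x y e => by
    funext k
    rw [← Fin.partialProd_right_inv x k, ← Fin.partialProd_right_inv y k, e]
  apply inj
  simp only [Fin.partialProd_contractNth]
  funext k
  simp only [Function.comp]
  congr 1
  have h' : i.val ≤ j.val := h
  apply Fin.ext
  simp only [Fin.succAbove, Fin.lt_def]
  split_ifs <;> simp_all <;> omega

theorem barD_comp_barD (m : ℕ) : barD G m ∘ₗ barD G (m + 1) = 0 := by
  apply Finsupp.lhom_ext'
  intro g
  apply LinearMap.ext_ring
  simp only [barD, LinearMap.comp_apply, Finsupp.lsingle_apply, LinearMap.sum_apply,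
    LinearMap.smul_apply, Finsupp.lmapDomain_apply, Finsupp.mapDomain_single, map_sum, map_smul,
    Finset.smul_sum, smul_smul, LinearMap.zero_apply]
  rw [← Finset.sum_product', Finset.univ_product_univ]
  let P := Fin (m + 3) × Fin (m + 2)
  let S : Finset P := {ij : P | (ij.1 : ℕ) ≤ (ij.2 : ℕ)}
  rw [← Finset.sum_add_sum_compl S, ← eq_neg_iff_add_eq_zero, ← Finset.sum_neg_distrib]
  let φ : ∀ ij : P, ij ∈ S → P := fun ij hij =>
    (ij.2.succ, Fin.castLT ij.1 (lt_of_le_of_lt (Finset.mem_filter.mp hij).right (Fin.is_lt ij.2)))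
  apply Finset.sum_bij φ
  · intro ij hij
    simp_rw [S, φ, Finset.compl_filter, Finset.mem_filter_univ, Fin.val_succ,
      Fin.val_castLT] at hij ⊢
    lia
  · rintro ⟨i, j⟩ hij ⟨i', j'⟩ hij' h
    have h1 : (j : ℕ) + 1 = j' + 1 := congr_arg (fun p : P => (p.1 : ℕ)) h
    have h2 : (i : ℕ) = i' := congr_arg (fun p : P => (p.2 : ℕ)) h
    rw [Prod.mk_inj, Fin.ext_iff, Fin.ext_iff]
    omega
  · rintro ⟨i', j'⟩ hij'
    simp_rw [S, Finset.compl_filter, Finset.mem_filter_univ, not_le] at hij'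
    refine ⟨(Fin.castSucc j', i'.pred <| ?_), ?_, ?_⟩
    · rintro rfl
      simp only [Fin.val_zero, not_lt_zero] at hij'
    · simpa [S] using! Nat.le_sub_one_of_lt hij'
    · simp only [φ, Fin.castLT_castSucc, Fin.succ_pred]
  · rintro ⟨i, j⟩ hij
    have hij' : (i : ℕ) ≤ (j : ℕ) := (Finset.mem_filter.mp hij).right
    have hi : (i : ℕ) < m + 2 := by omega
    have key := contractNth_contractNth g (i := Fin.castLT i hi) (j := j) hij'
    rw [Fin.castSucc_castLT] at key
    simp only [φ, key, Fin.val_succ, Fin.val_castLT, pow_succ]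
    rw [← neg_smul]
    congr 1
    ring

theorem barD_barR (m : ℕ) (g : G) (b : Bar G (m + 1)) :
    barD G m (barR (m + 1) g b) = barR m g (barD G m b) := by
  suffices barD G m ∘ₗ barR (m + 1) g = barR m g ∘ₗ barD G m from LinearMap.congr_fun this b
  apply Finsupp.lhom_ext'
  intro x
  apply LinearMap.ext_ring
  simp only [barD, barR, LinearMap.comp_apply, Finsupp.lsingle_apply, LinearMap.sum_apply,
    LinearMap.smul_apply, Finsupp.lmapDomain_apply, Finsupp.mapDomain_single, map_sum, map_smul]
  refine Finset.sum_congr rfl fun i _ => ?_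
  congr 2
  funext k
  rcases eq_or_ne k 0 with rfl | hk
  · by_cases h : (0 : ℕ) < i
    · simp only [Fin.contractNth, Fin.val_zero, if_pos h, Fin.castSucc_zero, Function.update_self]
      exact congrArg _ (if_pos h).symm
    · obtain rfl : i = 0 := Fin.ext (by simpa using h)
      have h1 : (Fin.succ 0 : Fin (m + 2)) ≠ 0 := Fin.succ_ne_zero _
      change Function.update x 0 (g⁻¹ * x 0) 0 * Function.update x 0 (g⁻¹ * x 0) (Fin.succ 0) =
        Function.update (Fin.contractNth 0 (· * ·) x) 0 (g⁻¹ * (x 0 * x (Fin.succ 0))) 0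
      rw [Function.update_self, Function.update_self, Function.update_of_ne h1, mul_assoc]
  · have h1 : k.castSucc ≠ 0 := fun e => by
      have := congrArg Fin.val e
      exact hk (Fin.ext this)
    simp only [Fin.contractNth, Function.update_of_ne hk, Function.update_of_ne h1,
      Function.update_of_ne (Fin.succ_ne_zero k)]

/-- The differential of `B_*(G) ⊗_G A`. -/
noncomputable def barTensorD (ρ : G →* AddMonoid.End A) (m : ℕ) :
    BarTensor ρ (m + 1) →+ BarTensor ρ m :=
  QuotientAddGroup.map _ _ (LinearMap.rTensor A (barD G m)).toAddMonoidHom (by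
    rw [barRel, AddSubgroup.closure_le]
    rintro _ ⟨b, g, a, rfl⟩
    refine AddSubgroup.subset_closure ⟨barD G m b, g, a, ?_⟩
    rw [LinearMap.toAddMonoidHom_coe, map_sub, LinearMap.rTensor_tmul,
      LinearMap.rTensor_tmul, barD_barR])

/-- The chain complex `B_*(G) ⊗_G A`. -/
noncomputable def barComplex (ρ : G →* AddMonoid.End A) : ChainComplex AddCommGrpCat.{max u v} ℕ :=
  ChainComplex.of (fun m => AddCommGrpCat.of (BarTensor ρ m))
    (fun m => AddCommGrpCat.ofHom (barTensorD ρ m)) (fun m => by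
      refine AddCommGrpCat.hom_ext (AddMonoidHom.ext fun x => ?_)
      induction x using QuotientAddGroup.induction_on with | H x =>
      change QuotientAddGroup.mk (LinearMap.rTensor A (barD G m)
        (LinearMap.rTensor A (barD G (m + 1)) x)) = QuotientAddGroup.mk 0
      rw [← LinearMap.comp_apply, ← LinearMap.rTensor_comp, barD_comp_barD,
        LinearMap.rTensor_zero, LinearMap.zero_apply])

variable {G' : Type u} [Group G'] {A' : Type v} [AddCommGroup A']

theorem barMap_barR (φ : G →* G') (m : ℕ) (g : G) (b : Bar G m) :
    barMap φ m (barR m g b) = barR m (φ g) (barMap φ m b) := by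
  suffices barMap φ m ∘ₗ barR m g = barR m (φ g) ∘ₗ barMap φ m from LinearMap.congr_fun this b
  apply Finsupp.lhom_ext'
  intro x
  apply LinearMap.ext_ring
  simp only [barMap, barR, LinearMap.comp_apply, Finsupp.lsingle_apply,
    Finsupp.lmapDomain_apply, Finsupp.mapDomain_single]
  congr 1
  funext k
  rcases eq_or_ne k 0 with rfl | hk
  · simp
  · simp only [Function.update_of_ne hk]

/-- The map `B_m(G) ⊗_G A → B_m(G') ⊗_{G'} A'`, `b ⊗ a ↦ φ(b) ⊗ f(a)`. -/
noncomputable def barTensorMap {ρ : G →* AddMonoid.End A} {ρ' : G' →* AddMonoid.End A'}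
    (φ : G →* G') (f : A →+ A') (hf : ∀ g a, f (ρ g a) = ρ' (φ g) (f a)) (m : ℕ) :
    BarTensor ρ m →+ BarTensor ρ' m :=
  QuotientAddGroup.map _ _ (TensorProduct.map (barMap φ m) f.toIntLinearMap).toAddMonoidHom (by
    rw [barRel, AddSubgroup.closure_le]
    rintro _ ⟨b, g, a, rfl⟩
    refine AddSubgroup.subset_closure ⟨barMap φ m b, φ g, f a, ?_⟩
    rw [LinearMap.toAddMonoidHom_coe, map_sub, TensorProduct.map_tmul,
      TensorProduct.map_tmul, barMap_barR, AddMonoidHom.coe_toIntLinearMap, hf])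

theorem barD_barMap (φ : G →* G') (m : ℕ) :
    barD G' m ∘ₗ barMap φ (m + 1) = barMap φ m ∘ₗ barD G m := by
  apply Finsupp.lhom_ext'
  intro x
  apply LinearMap.ext_ring
  simp only [barD, barMap, LinearMap.comp_apply, Finsupp.lsingle_apply, LinearMap.sum_apply,
    LinearMap.smul_apply, Finsupp.lmapDomain_apply, Finsupp.mapDomain_single, map_sum, map_smul]
  refine Finset.sum_congr rfl fun i _ => ?_
  congr 2
  funext k
  simp only [Fin.contractNth]
  split_ifs <;> simp

/-- The chain map `B_*(G) ⊗_G A → B_*(G') ⊗_{G'} A'`. -/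
noncomputable def barComplexMap {ρ : G →* AddMonoid.End A} {ρ' : G' →* AddMonoid.End A'}
    (φ : G →* G') (f : A →+ A') (hf : ∀ g a, f (ρ g a) = ρ' (φ g) (f a)) :
    barComplex ρ ⟶ barComplex ρ' where
  f m := AddCommGrpCat.ofHom (barTensorMap φ f hf m)
  comm' := by
    rintro _ m rfl
    dsimp only [barComplex]
    rw [ChainComplex.of_d, ChainComplex.of_d]
    refine AddCommGrpCat.hom_ext (AddMonoidHom.ext fun x => ?_)
    induction x using QuotientAddGroup.induction_on with | H x =>
    change QuotientAddGroup.mk (LinearMap.rTensor A' (barD G' m)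
        (TensorProduct.map (barMap φ (m + 1)) f.toIntLinearMap x)) =
      QuotientAddGroup.mk (TensorProduct.map (barMap φ m) f.toIntLinearMap
        (LinearMap.rTensor A (barD G m) x))
    congr 1
    induction x using TensorProduct.induction_on with
    | zero => simp
    | add x y hx hy => simp only [map_add, hx, hy]
    | tmul b a =>
      simp only [TensorProduct.map_tmul, LinearMap.rTensor_tmul]
      congr 1
      exact LinearMap.congr_fun (barD_barMap φ m) b

end Bar

section Homology

variable {Γ : SimplicialObject GrpCat.{u}} {M : SimplicialObject AddCommGrpCat.{v}}

/-- The simplicial chain complex `n ↦ B_*(G_n) ⊗_{G_n} A_n`. -/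
noncomputable def SimplicialAction.simplicialComplex (α : SimplicialAction Γ M) :
    SimplicialObject (ChainComplex AddCommGrpCat.{max u v} ℕ) where
  obj n := barComplex (α.act n)
  map f := barComplexMap (Γ.map f).hom (M.map f).hom (α.map_act f)
  map_id n := by
    ext m x
    induction x using QuotientAddGroup.induction_on with | H x =>
    change QuotientAddGroup.mk (TensorProduct.map (barMap (Γ.map (𝟙 n)).hom m)
      (M.map (𝟙 n)).hom.toIntLinearMap x) = QuotientAddGroup.mk x
    congr 1
    induction x using TensorProduct.induction_on with
    | zero => simp
    | add x y hx hy => rw [map_add, hx, hy]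
    | tmul b a =>
      rw [TensorProduct.map_tmul, Γ.map_id, M.map_id]
      congr 1
      exact Finsupp.mapDomain_id
  map_comp {n k l} f g := by
    ext m x
    induction x using QuotientAddGroup.induction_on with | H x =>
    change QuotientAddGroup.mk (TensorProduct.map (barMap (Γ.map (f ≫ g)).hom m)
      (M.map (f ≫ g)).hom.toIntLinearMap x) =
      QuotientAddGroup.mk (TensorProduct.map (barMap (Γ.map g).hom m)
        (M.map g).hom.toIntLinearMap (TensorProduct.map (barMap (Γ.map f).hom m)
          (M.map f).hom.toIntLinearMap x))
    congr 1
    induction x using TensorProduct.induction_on with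
    | zero => simp
    | add x y hx hy => rw [map_add, hx, hy, map_add, map_add]
    | tmul b a =>
      rw [TensorProduct.map_tmul, TensorProduct.map_tmul, TensorProduct.map_tmul, Γ.map_comp,
        M.map_comp]
      congr 1
      exact Finsupp.mapDomain_comp (v := b) (f := fun x i => (Γ.map f).hom (x i))
        (g := fun x i => (Γ.map g).hom (x i))

/-- The bicomplex `B(G_*, A_*)`: the horizontal differential is the alternating sum of the face
maps `b ⊗ a ↦ d_i(b) ⊗ ∂_i(a)`. -/
noncomputable def SimplicialAction.bicomplex (α : SimplicialAction Γ M) :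
    HomologicalComplex₂ AddCommGrpCat.{max u v} (ComplexShape.down ℕ) (ComplexShape.down ℕ) :=
  (AlgebraicTopology.alternatingFaceMapComplex _).obj α.simplicialComplex

/-- The homology `H_n(G_*, A_*)` of the total complex of `B(G_*, A_*)`. -/
noncomputable def SimplicialAction.homology (α : SimplicialAction Γ M) (n : ℕ) :
    AddCommGrpCat.{max u v} :=
  (α.bicomplex.total (ComplexShape.down ℕ)).homology n

end Homology

namespace CrossedModule

variable {H G : Type u} [Group H] [Group G] [MulDistribMulAction G H] (X : CrossedModule H G)

/-- The homology `H_n((H, G, μ), (C, A, ν))` of a crossed module with coefficients in an abelian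
crossed module on which it acts. -/
noncomputable def homology {C A : Type v} [AddCommGroup C] [AddCommGroup A] {ν : C →+ A}
    (α : X.Action ν) (n : ℕ) : AddCommGrpCat.{max u v} :=
  α.toSimplicialAction.homology n

/-- The homology with integral coefficients: coefficients in `(0, ℤ, 0)` with the trivial action. -/
noncomputable def integralHomology (n : ℕ) : AddCommGrpCat.{u} :=
  X.homology (Action.trivial X (0 : PUnit.{1} →+ ℤ)) n

/-! ### The classifying space and Baues–Ellis homology -/

/-- The bisimplicial set `(p, q) ↦ N_q(N_p(H, G, μ))`: the nerve of the group (viewed as a category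
with one object) in each dimension of the nerve of the crossed module. -/
def binerve : SimplicialObject SSet.{u} :=
  X.nerve ⋙ forget₂ GrpCat MonCat ⋙ MonCat.toCat ⋙ nerveFunctor

/-- The diagonal of the bisimplicial set `binerve`. -/
def diagNerve : SSet.{u} :=
  Functor.diag _ ⋙ Functor.uncurry.obj X.binerve

/-- The classifying space of a crossed module. -/
noncomputable def classifyingSpace : TopCat.{u} :=
  SSet.toTop.obj X.diagNerve

/-- The Baues–Ellis homology of a crossed module with integral coefficients: the singular homology
of its classifying space. -/
noncomputable def bauesEllisHomology (n : ℕ) : AddCommGrpCat.{u} :=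
  ((AlgebraicTopology.singularHomologyFunctor AddCommGrpCat.{u} n).obj
    (AddCommGrpCat.of (ULift.{u} ℤ))).obj X.classifyingSpace

end CrossedModule

/-! Three comparisons are composed.

Bar symbols and nerves. A symbol g₀ ⊗ ⋯ ⊗ g_m is determined by its partial products g₀, g₀g₁, …,
which are read as vertices. Every term of the differential deletes one vertex, and the action of a
group element translates all vertices at once. Hence, with trivial integral coefficients, B_m(Γ) ⊗_Γ
ℤ is free on the m-simplices of the nerve of Γ (`BarTensor.barComplexIso`). The identification is
natural in Γ, so the bicomplex defining `integralHomology` is the bicomplex of the free bisimplicial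
abelian group on `binerve`.

Total complex and diagonal (Dold–Puppe, Eilenberg–Zilber). Both are exact functors from bisimplicial
abelian groups to chain complexes, and both have the same H₀. Every bisimplicial abelian group is a
quotient of a free one on a coproduct of representables, and on these both functors have no homology
in positive degrees, because prepending a vertex is a contraction. Dimension shifting then gives
isomorphic homology in all degrees (`BisimplicialAb.nonempty_homology_diagComplex_iso_totComplex`).
No shuffle or Alexander–Whitney map is used, and only the existence of isomorphisms is obtained,
which suffices.

Chains and singular chains. For every simplicial set the unit from chains to singular chains of the
realization is a quasi-isomorphism (`SSet.chainsEquivSingular`). The proof is an induction on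
skeleta. For a disjoint union of n-simplices the statement reduces by homotopy to a discrete set of
points. Attaching cells is a pushout: simplicial relative chains are compared directly, singular
ones by excision (`SingularChain.excision`, proved by barycentric subdivision) after thickening the
attached boundary by a collar (`TopCat.Collar.quasiIso_of_isPushout`). The five lemma passes from
one skeleton to the next. A compact subset of the realization lies in the realization of some
skeleton, which gives the general case. -/

section

open Limits Simplicial Opposite

/-! ### Quasi-isomorphisms of complexes of abelian groups in terms of elements -/

namespace ChainComplex

variable {K L : ChainComplex AddCommGrpCat.{u} ℕ}

/-- The elements killed by the differential. -/
def IsCycle (K : ChainComplex AddCommGrpCat.{u} ℕ) (n : ℕ) (x : K.X n) : Prop :=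
  ∀ j, (K.d n j).hom x = 0

theorem d_d_apply (K : ChainComplex AddCommGrpCat.{u} ℕ) (i j k : ℕ) (x : K.X i) :
    (K.d j k).hom ((K.d i j).hom x) = 0 := by
  rw [← AddCommGrpCat.comp_apply, K.d_comp_d]
  rfl

theorem f_d_apply (f : K ⟶ L) (i j : ℕ) (x : K.X i) :
    (f.f j).hom ((K.d i j).hom x) = (L.d i j).hom ((f.f i).hom x) := by
  rw [← AddCommGrpCat.comp_apply, ← f.comm, AddCommGrpCat.comp_apply]

theorem isCycle_succ {n : ℕ} {x : K.X (n + 1)} (h : (K.d (n + 1) n).hom x = 0) :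
    IsCycle K (n + 1) x := fun j => by
  by_cases hj : j = n
  · subst hj; exact h
  · rw [K.shape _ _ (by simp; omega)]; rfl

theorem isCycle_zero (x : K.X 0) : IsCycle K 0 x := fun j => by
  rw [K.shape _ _ (by simp)]; rfl

theorem IsCycle.map (f : K ⟶ L) {n : ℕ} {x : K.X n} (h : IsCycle K n x) :
    IsCycle L n ((f.f n).hom x) := fun j => by
  rw [← f_d_apply, h, map_zero]

theorem iCycles_injective (K : ChainComplex AddCommGrpCat.{u} ℕ) (n : ℕ) :
    Function.Injective (K.iCycles n).hom :=
  (AddCommGrpCat.mono_iff_injective (K.iCycles n)).1 inferInstance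

theorem homologyπ_surjective (K : ChainComplex AddCommGrpCat.{u} ℕ) (n : ℕ) :
    Function.Surjective (K.homologyπ n).hom :=
  (AddCommGrpCat.epi_iff_surjective (K.homologyπ n)).1 inferInstance

theorem isCycle_iCycles (K : ChainComplex AddCommGrpCat.{u} ℕ) (n : ℕ) (z : K.cycles n) :
    IsCycle K n ((K.iCycles n).hom z) := fun j => by
  rw [← AddCommGrpCat.comp_apply, K.iCycles_d]
  rfl

theorem exists_cycles {n : ℕ} {x : K.X n} (h : IsCycle K n x) :
    ∃ z : K.cycles n, (K.iCycles n).hom z = x := by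
  have := (ShortComplex.mk (K.iCycles n) (K.d n _) (K.iCycles_d n _)).exact_of_f_is_kernel
    (K.cyclesIsKernel n _ rfl)
  rw [ShortComplex.ab_exact_iff] at this
  exact this x (h _)

theorem homologyπ_eq_zero_iff {n : ℕ} (z : K.cycles n) :
    (K.homologyπ n).hom z = 0 ↔ ∃ w : K.X (n + 1), (K.d (n + 1) n).hom w = (K.iCycles n).hom z := by
  have h : (ShortComplex.mk _ _ (K.toCycles_comp_homologyπ (n + 1) n)).Exact :=
    ShortComplex.exact_of_g_is_cokernel _ (K.homologyIsCokernel (n + 1) n (by simp))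
  rw [ShortComplex.ab_exact_iff] at h
  constructor
  · intro hz
    obtain ⟨w, hw⟩ := h z hz
    refine ⟨w, ?_⟩
    rw [← hw]
    change _ = (K.iCycles n).hom ((K.toCycles (n + 1) n).hom w)
    rw [← AddCommGrpCat.comp_apply, K.toCycles_i]
  · rintro ⟨w, hw⟩
    have : (K.toCycles (n + 1) n).hom w = z := by
      apply K.iCycles_injective
      rw [← hw, ← AddCommGrpCat.comp_apply, K.toCycles_i]
    rw [← this, ← AddCommGrpCat.comp_apply, K.toCycles_comp_homologyπ]
    rfl

theorem homologyMap_homologyπ (f : K ⟶ L) (n : ℕ) (z : K.cycles n) :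
    (HomologicalComplex.homologyMap f n).hom ((K.homologyπ n).hom z) =
      (L.homologyπ n).hom ((HomologicalComplex.cyclesMap f n).hom z) := by
  rw [← AddCommGrpCat.comp_apply, HomologicalComplex.homologyπ_naturality,
    AddCommGrpCat.comp_apply]

theorem iCycles_cyclesMap (f : K ⟶ L) (n : ℕ) (z : K.cycles n) :
    (L.iCycles n).hom ((HomologicalComplex.cyclesMap f n).hom z) =
      (f.f n).hom ((K.iCycles n).hom z) := by
  rw [← AddCommGrpCat.comp_apply, HomologicalComplex.cyclesMap_i, AddCommGrpCat.comp_apply]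

theorem surjective_homologyMap_iff (f : K ⟶ L) (n : ℕ) :
    Function.Surjective (HomologicalComplex.homologyMap f n).hom ↔
      ∀ y, IsCycle L n y → ∃ x, IsCycle K n x ∧ ∃ w, y = (f.f n).hom x + (L.d (n + 1) n).hom w := by
  constructor
  · intro h y hy
    obtain ⟨z, rfl⟩ := exists_cycles hy
    obtain ⟨a, ha⟩ := h ((L.homologyπ n).hom z)
    obtain ⟨c, rfl⟩ := K.homologyπ_surjective n a
    rw [homologyMap_homologyπ, eq_comm, ← sub_eq_zero, ← map_sub, homologyπ_eq_zero_iff] at ha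
    obtain ⟨w, hw⟩ := ha
    refine ⟨_, K.isCycle_iCycles n c, w, ?_⟩
    rw [hw, map_sub, iCycles_cyclesMap]
    abel
  · intro h a
    obtain ⟨c, rfl⟩ := L.homologyπ_surjective n a
    obtain ⟨x, hx, w, hw⟩ := h _ (L.isCycle_iCycles n c)
    obtain ⟨z, rfl⟩ := exists_cycles hx
    refine ⟨(K.homologyπ n).hom z, ?_⟩
    rw [homologyMap_homologyπ, eq_comm, ← sub_eq_zero, ← map_sub, homologyπ_eq_zero_iff]
    refine ⟨w, ?_⟩
    rw [map_sub, hw, iCycles_cyclesMap]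
    abel

theorem injective_homologyMap_iff (f : K ⟶ L) (n : ℕ) :
    Function.Injective (HomologicalComplex.homologyMap f n).hom ↔
      ∀ x, IsCycle K n x → (∃ w, (f.f n).hom x = (L.d (n + 1) n).hom w) →
        ∃ w, x = (K.d (n + 1) n).hom w := by
  rw [injective_iff_map_eq_zero]
  constructor
  · rintro h x hx ⟨w, hw⟩
    obtain ⟨z, rfl⟩ := exists_cycles hx
    have := h ((K.homologyπ n).hom z) (by
      rw [homologyMap_homologyπ, homologyπ_eq_zero_iff]
      exact ⟨w, by rw [← hw, iCycles_cyclesMap]⟩)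
    obtain ⟨w, hw⟩ := (homologyπ_eq_zero_iff z).1 this
    exact ⟨w, hw.symm⟩
  · intro h a ha
    obtain ⟨c, rfl⟩ := K.homologyπ_surjective n a
    rw [homologyMap_homologyπ, homologyπ_eq_zero_iff] at ha
    obtain ⟨w, hw⟩ := ha
    obtain ⟨w, hw⟩ := h _ (K.isCycle_iCycles n c) ⟨w, by rw [hw, iCycles_cyclesMap]⟩
    exact (homologyπ_eq_zero_iff c).2 ⟨w, hw.symm⟩

/-- Replaces homology by lifting of cycles and of bounding chains. Relative complexes, excision and
exhaustion are handled in this form, where explicit chains are at hand. -/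
theorem quasiIso_iff_elements (f : K ⟶ L) :
    QuasiIso f ↔ ∀ n,
      (∀ y, IsCycle L n y → ∃ x, IsCycle K n x ∧ ∃ w, y = (f.f n).hom x + (L.d (n + 1) n).hom w) ∧
      (∀ x, IsCycle K n x → (∃ w, (f.f n).hom x = (L.d (n + 1) n).hom w) →
        ∃ w, x = (K.d (n + 1) n).hom w) := by
  rw [quasiIso_iff]
  refine forall_congr' fun n => ?_
  rw [quasiIsoAt_iff_isIso_homologyMap, ← surjective_homologyMap_iff, ← injective_homologyMap_iff,
    ConcreteCategory.isIso_iff_bijective, Function.Bijective, and_comm]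

theorem isZero_homology_of_elements {n : ℕ}
    (h : ∀ x, IsCycle K n x → ∃ w, x = (K.d (n + 1) n).hom w) : IsZero (K.homology n) := by
  rw [AddCommGrpCat.isZero_iff_subsingleton]
  have : ∀ a : K.homology n, a = 0 := fun a => by
    obtain ⟨c, rfl⟩ := K.homologyπ_surjective n a
    obtain ⟨w, hw⟩ := h _ (K.isCycle_iCycles n c)
    exact (homologyπ_eq_zero_iff c).2 ⟨w, hw.symm⟩
  exact ⟨fun a b => by rw [this a, this b]⟩

/-! ### Relative complexes -/

theorem cokernelπ_surjective (i : K ⟶ L) (n : ℕ) :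
    Function.Surjective ((cokernel.π i).f n).hom :=
  (AddCommGrpCat.epi_iff_surjective ((cokernel.π i).f n)).1 inferInstance

theorem cokernelπ_eq_zero_iff (i : K ⟶ L) {n : ℕ} (x : L.X n) :
    ((cokernel.π i).f n).hom x = 0 ↔ ∃ k, (i.f n).hom k = x := by
  have h : (ShortComplex.mk i (cokernel.π i) (cokernel.condition i)).Exact :=
    ShortComplex.exact_of_g_is_cokernel _ (cokernelIsCokernel i)
  have h' := h.map (HomologicalComplex.eval _ _ n)
  rw [ShortComplex.ab_exact_iff] at h'
  refine ⟨fun hx => h' x hx, ?_⟩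
  rintro ⟨k, rfl⟩
  rw [← AddCommGrpCat.comp_apply, ← HomologicalComplex.comp_f, cokernel.condition]
  rfl

theorem cokernelπ_eq_iff (i : K ⟶ L) {n : ℕ} (x y : L.X n) :
    ((cokernel.π i).f n).hom x = ((cokernel.π i).f n).hom y ↔ ∃ k, x = y + (i.f n).hom k := by
  rw [← sub_eq_zero, ← map_sub, cokernelπ_eq_zero_iff]
  exact exists_congr fun k => by rw [eq_comm, sub_eq_iff_eq_add']

variable {K' L' : ChainComplex AddCommGrpCat.{u} ℕ}

theorem cokernelMap_π {i : K ⟶ L} {i' : K' ⟶ L'} {p : K ⟶ K'} {q : L ⟶ L'} (w : i ≫ q = p ≫ i')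
    {n : ℕ} (x : L.X n) : ((cokernel.map i i' p q w).f n).hom (((cokernel.π i).f n).hom x) =
      ((cokernel.π i').f n).hom ((q.f n).hom x) := by
  rw [← AddCommGrpCat.comp_apply, ← HomologicalComplex.comp_f, cokernel.π_desc,
    HomologicalComplex.comp_f, AddCommGrpCat.comp_apply]

/-- A relative cycle is represented by a chain whose boundary lies in the subcomplex, and relative
equalities hold up to a chain `k` of the subcomplex. After this reformulation the quotient complexes
can be forgotten. -/
theorem quasiIso_cokernelMap_iff {i : K ⟶ L} {i' : K' ⟶ L'} {p : K ⟶ K'} {q : L ⟶ L'}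
    (w : i ≫ q = p ≫ i') : QuasiIso (cokernel.map i i' p q w) ↔ ∀ n,
      (∀ y, (∀ j, ∃ k, (L'.d n j).hom y = (i'.f j).hom k) →
        ∃ x, (∀ j, ∃ k, (L.d n j).hom x = (i.f j).hom k) ∧
          ∃ v k, y = (q.f n).hom x + (L'.d (n + 1) n).hom v + (i'.f n).hom k) ∧
      (∀ x, (∀ j, ∃ k, (L.d n j).hom x = (i.f j).hom k) →
        (∃ v k, (q.f n).hom x = (L'.d (n + 1) n).hom v + (i'.f n).hom k) →
          ∃ v k, x = (L.d (n + 1) n).hom v + (i.f n).hom k) := by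
  have cyc : ∀ {K L : ChainComplex AddCommGrpCat.{u} ℕ} (i : K ⟶ L) {n : ℕ} (x : L.X n),
      IsCycle (cokernel i) n (((cokernel.π i).f n).hom x) ↔
        ∀ j, ∃ k, (L.d n j).hom x = (i.f j).hom k := fun i n x => by
    refine forall_congr' fun j => ?_
    rw [← f_d_apply, cokernelπ_eq_zero_iff]
    simp only [eq_comm]
  rw [quasiIso_iff_elements]
  refine forall_congr' fun n => and_congr ?_ ?_
  · constructor
    · intro h y hy
      obtain ⟨x, hx, v, hv⟩ := h _ ((cyc i' y).2 hy)
      obtain ⟨x, rfl⟩ := cokernelπ_surjective i n x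
      obtain ⟨v, rfl⟩ := cokernelπ_surjective i' (n + 1) v
      rw [cokernelMap_π, ← f_d_apply, ← map_add, cokernelπ_eq_iff] at hv
      exact ⟨x, (cyc i x).1 hx, v, hv⟩
    · intro h y hy
      obtain ⟨y, rfl⟩ := cokernelπ_surjective i' n y
      obtain ⟨x, hx, v, k, hv⟩ := h y ((cyc i' y).1 hy)
      refine ⟨((cokernel.π i).f n).hom x, (cyc i x).2 hx, ((cokernel.π i').f _).hom v, ?_⟩
      rw [cokernelMap_π, ← f_d_apply, ← map_add, cokernelπ_eq_iff]
      exact ⟨k, hv⟩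
  · constructor
    · rintro h x hx ⟨v, k, hv⟩
      obtain ⟨v', hv'⟩ := h _ ((cyc i x).2 hx) ⟨((cokernel.π i').f _).hom v, by
        rw [cokernelMap_π, ← f_d_apply, cokernelπ_eq_iff]
        exact ⟨k, hv⟩⟩
      obtain ⟨v', rfl⟩ := cokernelπ_surjective i (n + 1) v'
      rw [← f_d_apply, cokernelπ_eq_iff] at hv'
      exact ⟨v', hv'⟩
    · rintro h x hx ⟨v, hv⟩
      obtain ⟨x, rfl⟩ := cokernelπ_surjective i n x
      obtain ⟨v, rfl⟩ := cokernelπ_surjective i' (n + 1) v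
      rw [cokernelMap_π, ← f_d_apply, cokernelπ_eq_iff] at hv
      obtain ⟨v', k, hv'⟩ := h x ((cyc i x).1 hx) ⟨v, hv⟩
      refine ⟨((cokernel.π i).f _).hom v', ?_⟩
      rw [← f_d_apply, cokernelπ_eq_iff]
      exact ⟨k, hv'⟩

theorem f_injective (i : K ⟶ L) [Mono i] (n : ℕ) : Function.Injective (i.f n).hom :=
  (AddCommGrpCat.mono_iff_injective (i.f n)).1 inferInstance

/-- The five lemma in the long exact homology sequences, for the third term. -/
theorem quasiIso_cokernelMap {i : K ⟶ L} {i' : K' ⟶ L'} [Mono i] [Mono i'] {p : K ⟶ K'}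
    {q : L ⟶ L'} (w : i ≫ q = p ≫ i') (hp : QuasiIso p) (hq : QuasiIso q) :
    QuasiIso (cokernel.map i i' p q w) := by
  let S₁ := ShortComplex.mk i (cokernel.π i) (cokernel.condition i)
  let S₂ := ShortComplex.mk i' (cokernel.π i') (cokernel.condition i')
  let φ : S₁ ⟶ S₂ := ⟨p, q, cokernel.map i i' p q w, w.symm, by simp [S₁, S₂]⟩
  have h₁ : S₁.ShortExact :=
    .mk' (ShortComplex.exact_of_g_is_cokernel _ (cokernelIsCokernel i)) inferInstance inferInstance
  have h₂ : S₂.ShortExact :=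
    .mk' (ShortComplex.exact_of_g_is_cokernel _ (cokernelIsCokernel i')) inferInstance inferInstance
  exact HomologicalComplex.HomologySequence.quasiIso_τ₃ φ h₁ h₂ hp hq

/-- The five lemma for the middle term, chased with chains: lift relatively, then correct the lift
by a chain of the subcomplex. -/
theorem quasiIso_of_quasiIso_cokernelMap {i : K ⟶ L} {i' : K' ⟶ L'} [Mono i] [Mono i']
    {p : K ⟶ K'} {q : L ⟶ L'} (w : i ≫ q = p ≫ i') (hp : QuasiIso p)
    (h : QuasiIso (cokernel.map i i' p q w)) : QuasiIso q := by
  rw [quasiIso_cokernelMap_iff] at h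
  rw [quasiIso_iff_elements] at hp ⊢
  have wn : ∀ {n : ℕ} (x : K.X n), (q.f n).hom ((i.f n).hom x) = (i'.f n).hom ((p.f n).hom x) := by
    intro n x
    have := congrArg (fun g => (g.f n).hom x) w
    exact this
  intro n
  constructor
  · intro y hy
    obtain ⟨x, hx, v, k', rfl⟩ := (h n).1 y fun j => ⟨0, by rw [map_zero]; exact hy j⟩
    -- The boundary of the relative lift `x` is a cycle `k` of the subcomplex. As `y` is a cycle, `p
    -- k` is the boundary of `-k'`, so `k` is the boundary of some `κ`, and subtracting `κ` makes
    -- `x` a cycle. In degree 0 nothing needs correcting.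
    obtain ⟨κ, hκ⟩ : ∃ κ : K.X n, IsCycle L n (x - (i.f n).hom κ) := by
      rcases n with _ | n
      · exact ⟨0, isCycle_zero _⟩
      · obtain ⟨k, hk⟩ := hx n
        have hkc : IsCycle K n k := fun j => by
          apply f_injective i
          rw [f_d_apply, ← hk, d_d_apply, map_zero]
        have hpk : (p.f n).hom k = (K'.d (n + 1) n).hom (-k') := by
          apply f_injective i'
          have := hy n
          rw [map_add, map_add, d_d_apply, ← f_d_apply, hk, ← f_d_apply, wn, add_zero,
            ← eq_neg_iff_add_eq_zero] at this
          rw [this, map_neg, map_neg]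
        obtain ⟨κ, hκ⟩ := (hp n).2 k hkc ⟨_, hpk⟩
        refine ⟨κ, isCycle_succ ?_⟩
        rw [map_sub, hk, hκ, f_d_apply, sub_self]
    have hm : IsCycle K' n (k' + (p.f n).hom κ) := fun j => by
      apply f_injective i'
      have h1 := hy j
      have h2 := (hκ.map q) j
      rw [map_add, map_add, d_d_apply, add_zero] at h1
      rw [map_sub, map_sub, wn, sub_eq_zero] at h2
      rw [f_d_apply, map_add, map_add, map_zero, ← h2, add_comm, h1]
    obtain ⟨m, hm, ν, hν⟩ := (hp n).1 _ hm
    refine ⟨x - (i.f n).hom κ + (i.f n).hom m, fun j => ?_, v + (i'.f _).hom ν, ?_⟩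
    · rw [map_add, hκ j, ← f_d_apply, hm j, map_zero, add_zero]
    · rw [map_add, map_sub, map_add, wn, wn, ← f_d_apply, ← sub_eq_iff_eq_add'.2 hν, map_sub,
        map_add]
      abel
  · rintro x hx ⟨v, hv⟩
    obtain ⟨v₁, k, rfl⟩ := (h n).2 x (fun j => ⟨0, by rw [map_zero]; exact hx j⟩)
      ⟨v, 0, by rw [hv, map_zero, add_zero]⟩
    have hk : IsCycle K n k := fun j => by
      apply f_injective i
      rw [f_d_apply, map_zero, ← hx j, map_add, d_d_apply, zero_add]
    have hd : (L'.d (n + 1) n).hom (v - (q.f _).hom v₁) = (i'.f n).hom ((p.f n).hom k) := by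
      rw [map_sub, ← hv, map_add, ← f_d_apply, wn]
      abel
    -- `v - q v₁` is a relative cycle one degree higher. Its relative lift `x₁` has boundary `k₃`,
    -- and `p (k - k₃)` is the boundary of `k₂`. Hence `k - k₃` is the boundary of some `κ`, and `x`
    -- is the boundary of `v₁ + x₁ + i κ`.
    obtain ⟨x₁, hx₁, v₂, k₂, hv₂⟩ := (h (n + 1)).1 (v - (q.f _).hom v₁) (fun j => by
      by_cases hj : j = n
      · subst hj; exact ⟨_, hd⟩
      · exact ⟨0, by rw [L'.shape _ _ (by simp; omega), map_zero]; rfl⟩)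
    obtain ⟨k₃, hk₃⟩ := hx₁ n
    obtain ⟨κ, hκ⟩ := (hp n).2 (k - k₃) (fun j => by
        apply f_injective i
        rw [f_d_apply, map_sub, map_sub, ← f_d_apply, hk j, ← hk₃, d_d_apply]
        simp) ⟨k₂, by
        apply f_injective i'
        rw [map_sub, map_sub, ← hd, hv₂, map_add, map_add, d_d_apply, ← f_d_apply, ← f_d_apply,
          hk₃, wn]
        abel⟩
    refine ⟨v₁ + x₁ + (i.f _).hom κ, ?_⟩
    rw [map_add, map_add, hk₃, ← f_d_apply, ← hκ, map_sub]
    abel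

end ChainComplex

end

section

open Limits Simplicial Opposite

/-! ### The chain complex of a simplicial set -/

/-- The free abelian group on a type. -/
noncomputable def freeAb : Type u ⥤ AddCommGrpCat.{u} where
  obj S := AddCommGrpCat.of (S →₀ ℤ)
  map f := AddCommGrpCat.ofHom (Finsupp.mapDomain.addMonoidHom f)
  map_id S := by
    ext x
    simp
  map_comp f g := by
    ext x
    simp

theorem freeAb_map_single {S T : Type u} (f : S ⟶ T) (s : S) (k : ℤ) :
    (freeAb.map f).hom (Finsupp.single s k) = Finsupp.single (f s) k :=
  Finsupp.mapDomain_single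

/-- The free abelian group as a coproduct of copies of `ℤ`. -/
noncomputable def sigmaIsoFinsupp (S : Type u) :
    (∐ fun _ : S => AddCommGrpCat.of (ULift.{u} ℤ)) ≅ AddCommGrpCat.of (S →₀ ℤ) where
  hom := Limits.Sigma.desc fun s =>
    AddCommGrpCat.ofHom ((Finsupp.singleAddHom s).comp AddEquiv.ulift.toAddMonoidHom)
  inv := AddCommGrpCat.ofHom (Finsupp.liftAddHom fun s =>
    (Limits.Sigma.ι (fun _ : S => AddCommGrpCat.of (ULift.{u} ℤ)) s).hom.comp
      AddEquiv.ulift.symm.toAddMonoidHom)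
  hom_inv_id := by
    refine Limits.Sigma.hom_ext _ _ fun s => ?_
    rw [Limits.Sigma.ι_desc_assoc]
    refine AddCommGrpCat.hom_ext (AddMonoidHom.ext fun k => ?_)
    exact (Finsupp.liftAddHom_apply_single _ _ _)
  inv_hom_id := by
    refine AddCommGrpCat.hom_ext (Finsupp.addHom_ext fun s k => ?_)
    refine (congrArg _ (Finsupp.liftAddHom_apply_single _ _ _)).trans ?_
    change (Limits.Sigma.ι (fun _ : S => AddCommGrpCat.of (ULift.{u} ℤ)) s ≫
      Limits.Sigma.desc _).hom (ULift.up k) = _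
    rw [Limits.Sigma.ι_desc]
    rfl

theorem sigmaIsoFinsupp_naturality {S T : Type u} (f : S ⟶ T) :
    Limits.Sigma.map' f (fun _ => 𝟙 (AddCommGrpCat.of (ULift.{u} ℤ))) ≫ (sigmaIsoFinsupp T).hom =
      (sigmaIsoFinsupp S).hom ≫ AddCommGrpCat.ofHom (Finsupp.mapDomain.addMonoidHom f) := by
  refine Limits.Sigma.hom_ext _ _ fun s => ?_
  dsimp only [sigmaIsoFinsupp]
  rw [Limits.Sigma.ι_comp_map'_assoc, Limits.Sigma.ι_desc, Limits.Sigma.ι_desc_assoc,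
    Category.id_comp]
  refine AddCommGrpCat.hom_ext (AddMonoidHom.ext fun k => ?_)
  exact Finsupp.mapDomain_single.symm

/-- The free abelian group functor as the functor of copowers of `ℤ`. -/
noncomputable def sigmaConstIsoFreeAb :
    sigmaConst.obj (AddCommGrpCat.of (ULift.{u} ℤ)) ≅ freeAb.{u} :=
  NatIso.ofComponents sigmaIsoFinsupp sigmaIsoFinsupp_naturality

theorem hom_sum_apply {A B : AddCommGrpCat.{u}} {ι : Type*} (s : Finset ι) (f : ι → (A ⟶ B))
    (a : A) : (∑ i ∈ s, f i).hom a = ∑ i ∈ s, (f i).hom a := by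
  have := map_sum AddCommGrpCat.homAddEquiv f s
  exact (DFunLike.congr_fun this a).trans (AddMonoidHom.finsetSum_apply _ _ _)

theorem alternatingFaceMapComplex_d_apply (X : SimplicialObject AddCommGrpCat.{u}) (n : ℕ)
    (x : X _⦋n + 1⦌) :
    (((AlgebraicTopology.alternatingFaceMapComplex _).obj X).d (n + 1) n).hom x =
      ∑ i : Fin (n + 2), (-1 : ℤ) ^ (i : ℕ) • (X.δ i).hom x := by
  rw [AlgebraicTopology.alternatingFaceMapComplex_obj_d,
    AlgebraicTopology.AlternatingFaceMapComplex.objD, hom_sum_apply]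
  rfl

/-- The chain complex of a simplicial set. -/
noncomputable def chains : SSet.{u} ⥤ ChainComplex AddCommGrpCat.{u} ℕ :=
  (SimplicialObject.whiskering _ _).obj freeAb ⋙ AlgebraicTopology.alternatingFaceMapComplex _

/-- Chains with coefficients in `ℤ`, defined by copowers, are the free chains. -/
noncomputable def chainComplexFunctorIsoChains :
    (SSet.chainComplexFunctor AddCommGrpCat.{u}).obj (AddCommGrpCat.of (ULift.{u} ℤ)) ≅ chains :=
  Functor.isoWhiskerRight ((SimplicialObject.whiskering _ _).mapIso sigmaConstIsoFreeAb)
    (AlgebraicTopology.alternatingFaceMapComplex _)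

/-- The chain given by a simplex. -/
noncomputable def simplexChain {X : SSet.{u}} {n : ℕ} (x : X _⦋n⦌) : (chains.obj X).X n :=
  Finsupp.single x 1

theorem chains_induction {X : SSet.{u}} {n : ℕ} {P : (chains.obj X).X n → Prop} (zero : P 0)
    (add : ∀ a b, P a → P b → P (a + b)) (neg : ∀ a, P a → P (-a))
    (simplex : ∀ x : X _⦋n⦌, P (simplexChain x)) (c : (chains.obj X).X n) : P c := by
  refine Finsupp.induction_linear (motive := P) c zero add fun x k => ?_
  have h : (Finsupp.single x k : X _⦋n⦌ →₀ ℤ) = k • Finsupp.single x 1 := by simp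
  rw [h]
  induction k using Int.induction_on with
  | zero => rw [zero_smul]; exact zero
  | succ i ih =>
    have := add _ _ (ih (by simp)) (simplex x)
    convert this using 1
    rw [add_smul, one_smul]
    rfl
  | pred i ih =>
    have := add _ _ (ih (by simp)) (neg _ (simplex x))
    convert this using 1
    rw [sub_smul, one_smul, sub_eq_add_neg]
    rfl

theorem chains_hom_ext {X : SSet.{u}} {n : ℕ} {A : Type v} [AddCommGroup A]
    {f g : (chains.obj X).X n →+ A}
    (h : ∀ x : X _⦋n⦌, f (simplexChain x) = g (simplexChain x)) : f = g :=
  AddMonoidHom.ext fun c => chains_induction (P := fun c => f c = g c) (by simp)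
    (fun a b ha hb => by rw [map_add, map_add, ha, hb]) (fun a ha => by rw [map_neg, map_neg, ha])
    h c

theorem chains_d_simplexChain {X : SSet.{u}} {n : ℕ} (x : X _⦋n + 1⦌) :
    ((chains.obj X).d (n + 1) n).hom (simplexChain x) =
      ∑ i : Fin (n + 2), (-1 : ℤ) ^ (i : ℕ) • simplexChain (X.δ i x) := by
  refine (alternatingFaceMapComplex_d_apply _ n _).trans (Finset.sum_congr rfl fun i _ => ?_)
  exact congrArg _ (freeAb_map_single _ _ _)

theorem chains_map_simplexChain {X Y : SSet.{u}} (f : X ⟶ Y) {n : ℕ} (x : X _⦋n⦌) :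
    ((chains.map f).f n).hom (simplexChain x) = simplexChain (f.app _ x) :=
  freeAb_map_single _ _ _

theorem chains_map_injective {X Y : SSet.{u}} (f : X ⟶ Y) {n : ℕ}
    (hf : Function.Injective (f.app (op ⦋n⦌))) : Function.Injective ((chains.map f).f n).hom :=
  Finsupp.mapDomain_injective hf

theorem mono_chains_map {X Y : SSet.{u}} (f : X ⟶ Y)
    (hf : ∀ n : ℕ, Function.Injective (f.app (op ⦋n⦌))) : Mono (chains.map f) := by
  have : ∀ n, Mono ((chains.map f).f n) := fun n =>
    (AddCommGrpCat.mono_iff_injective _).2 (chains_map_injective f (hf n))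
  exact HomologicalComplex.mono_of_mono_f _ this

/-- The singular chain complex of a topological space. -/
noncomputable abbrev singChains : TopCat.{u} ⥤ ChainComplex AddCommGrpCat.{u} ℕ :=
  TopCat.toSSet ⋙ chains

/-- The homotopy equivalence is formed on the chains built from copowers of `ℤ` and carried over to
free chains by `chainComplexFunctorIsoChains`. -/
theorem quasiIso_singChains_of_homotopy {X Y : TopCat.{u}} (f : X ⟶ Y) (g : Y ⟶ X)
    (h₁ : TopCat.Homotopy (f ≫ g) (𝟙 X)) (h₂ : TopCat.Homotopy (g ≫ f) (𝟙 Y)) :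
    QuasiIso (singChains.map f) := by
  let R := AddCommGrpCat.of (ULift.{u} ℤ)
  let F := (AlgebraicTopology.singularChainComplexFunctor AddCommGrpCat.{u}).obj R
  let e : HomotopyEquiv (F.obj X) (F.obj Y) :=
    { hom := F.map f
      inv := F.map g
      homotopyHomInvId :=
        (Homotopy.ofEq (F.map_comp f g).symm).trans
          ((h₁.singularChainComplexFunctorObjMap R).trans (Homotopy.ofEq (F.map_id X)))
      homotopyInvHomId :=
        (Homotopy.ofEq (F.map_comp g f).symm).trans
          ((h₂.singularChainComplexFunctorObjMap R).trans (Homotopy.ofEq (F.map_id Y))) }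
  have hF : QuasiIso (F.map f) := e.quasiIso_hom
  let α : F ≅ singChains := Functor.isoWhiskerLeft _ chainComplexFunctorIsoChains
  have h : singChains.map f = α.inv.app X ≫ F.map f ≫ α.hom.app Y := by
    rw [α.hom.naturality, Iso.inv_hom_id_app_assoc]
  rw [h]
  infer_instance

end

section

/-! ### Barycentric subdivision of chains of tuples -/

/-- The additive map on the free abelian group extending a map on the generators. -/
noncomputable def freeLift {α : Type*} {M : Type*} [AddCommGroup M] (f : α → M) : (α →₀ ℤ) →+ M :=
  Finsupp.liftAddHom fun a => zmultiplesHom M (f a)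

@[simp]
theorem freeLift_single {α : Type*} {M : Type*} [AddCommGroup M] (f : α → M) (a : α) :
    freeLift f (Finsupp.single a 1) = f a := by
  simp [freeLift]

theorem free_hom_ext {α : Type*} {M : Type*} [AddCommGroup M] {f g : (α →₀ ℤ) →+ M}
    (h : ∀ a, f (Finsupp.single a 1) = g (Finsupp.single a 1)) : f = g :=
  Finsupp.addHom_ext' fun a => AddMonoidHom.ext_int (h a)

/-- The augmented complex of ordered tuples of a set: the chains on `k`-tuples. -/
abbrev TupleChain (E : Type*) (k : ℕ) : Type _ := (Fin k → E) →₀ ℤ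

namespace TupleChain

variable {E E' : Type*}

/-- The boundary. -/
noncomputable def bd (k : ℕ) : TupleChain E (k + 1) →+ TupleChain E k :=
  freeLift fun w => ∑ i : Fin (k + 1), (-1 : ℤ) ^ (i : ℕ) • Finsupp.single (w ∘ i.succAbove) 1

/-- The cone with a given apex. -/
noncomputable def cone (e : E) (k : ℕ) : TupleChain E k →+ TupleChain E (k + 1) :=
  freeLift fun w => Finsupp.single (Fin.cons e w) 1

/-- The map induced by a map of sets. -/
noncomputable def map (f : E → E') (k : ℕ) : TupleChain E k →+ TupleChain E' k :=
  freeLift fun w => Finsupp.single (f ∘ w) 1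

theorem bd_single {k : ℕ} (w : Fin (k + 1) → E) : bd k (Finsupp.single w 1) =
    ∑ i : Fin (k + 1), (-1 : ℤ) ^ (i : ℕ) • Finsupp.single (w ∘ i.succAbove) 1 :=
  freeLift_single _ _

theorem cone_single (e : E) {k : ℕ} (w : Fin k → E) :
    cone e k (Finsupp.single w 1) = Finsupp.single (Fin.cons e w) 1 :=
  freeLift_single _ _

theorem map_single (f : E → E') {k : ℕ} (w : Fin k → E) :
    map f k (Finsupp.single w 1) = Finsupp.single (f ∘ w) 1 :=
  freeLift_single _ _

theorem bd_cone_zero (e : E) (x : TupleChain E 0) : bd 0 (cone e 0 x) = x := by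
  suffices (bd 0).comp (cone e 0) = AddMonoidHom.id _ from DFunLike.congr_fun this x
  refine free_hom_ext fun w => ?_
  rw [AddMonoidHom.comp_apply, cone_single, bd_single, AddMonoidHom.id_apply]
  rw [Fin.sum_univ_one, Fin.val_zero, pow_zero, one_smul]
  congr 1

/-- Deleting the apex returns the tuple, and deleting any other entry gives the cone over a face
with the opposite sign. The identities for subdivision below all rest on this formula. -/
theorem bd_cone_succ (e : E) {k : ℕ} (x : TupleChain E (k + 1)) :
    bd (k + 1) (cone e (k + 1) x) = x - cone e k (bd k x) := by
  suffices (bd (k + 1)).comp (cone e (k + 1)) = AddMonoidHom.id _ - (cone e k).comp (bd k) from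
    DFunLike.congr_fun this x
  refine free_hom_ext fun w => ?_
  rw [AddMonoidHom.comp_apply, cone_single, bd_single, AddMonoidHom.sub_apply,
    AddMonoidHom.id_apply, AddMonoidHom.comp_apply, bd_single, Fin.sum_univ_succ, sub_eq_add_neg,
    map_sum, ← Finset.sum_neg_distrib]
  congr 1
  · rw [Fin.val_zero, pow_zero, one_smul]
    rfl
  · refine Finset.sum_congr rfl fun i _ => ?_
    rw [map_zsmul, cone_single, Fin.val_succ, pow_succ, mul_neg_one, neg_smul]
    congr 3
    funext j
    refine Fin.cases ?_ (fun j => ?_) j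
    · rfl
    · simp

/-- Every tuple is the cone over its tail with its first entry as apex, so the cone formula gives
the claim by induction. -/
theorem bd_bd (k : ℕ) (x : TupleChain E (k + 2)) : bd k (bd (k + 1) x) = 0 := by
  suffices (bd (E := E) k).comp (bd (k + 1)) = 0 from DFunLike.congr_fun this x
  induction k with
  | zero =>
    refine free_hom_ext fun w => ?_
    rw [← Fin.cons_self_tail w, ← cone_single, AddMonoidHom.comp_apply, bd_cone_succ, map_sub,
      bd_cone_zero, sub_self, AddMonoidHom.zero_apply]
  | succ k ih =>
    refine free_hom_ext fun w => ?_
    rw [← Fin.cons_self_tail w, ← cone_single, AddMonoidHom.comp_apply, bd_cone_succ, map_sub,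
      bd_cone_succ, ← AddMonoidHom.comp_apply (bd k), ih 0]
    simp

theorem map_bd (f : E → E') (k : ℕ) (x : TupleChain E (k + 1)) :
    map f k (bd k x) = bd k (map f (k + 1) x) := by
  suffices (map f k).comp (bd k) = (bd k).comp (map f (k + 1)) from DFunLike.congr_fun this x
  refine free_hom_ext fun w => ?_
  simp only [AddMonoidHom.comp_apply, bd_single, map_single, map_sum, map_zsmul]
  rfl

theorem map_cone (f : E → E') (e : E) (k : ℕ) (x : TupleChain E k) :
    map f (k + 1) (cone e k x) = cone (f e) k (map f k x) := by
  suffices (map f (k + 1)).comp (cone e k) = (cone (f e) k).comp (map f k) from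
    DFunLike.congr_fun this x
  refine free_hom_ext fun w => ?_
  simp only [AddMonoidHom.comp_apply, cone_single, map_single]
  congr 1
  funext j
  refine Fin.cases ?_ (fun j => ?_) j <;> rfl

variable (β : ∀ k, (Fin (k + 1) → E) → E)

/-- Barycentric subdivision, where `β` is the barycenter. -/
noncomputable def sd : ∀ k, TupleChain E k →+ TupleChain E k
  | 0 => AddMonoidHom.id _
  | k + 1 => freeLift fun w => cone (β k w) k (sd k (bd k (Finsupp.single w 1)))

/-- The homotopy between the identity and barycentric subdivision. -/
noncomputable def sdHomotopy : ∀ k, TupleChain E k →+ TupleChain E (k + 1)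
  | 0 => 0
  | k + 1 => freeLift fun w => cone (β k w) (k + 1)
      (Finsupp.single w 1 - sdHomotopy k (bd k (Finsupp.single w 1)))

theorem sd_single {k : ℕ} (w : Fin (k + 1) → E) : sd β (k + 1) (Finsupp.single w 1) =
    cone (β k w) k (sd β k (bd k (Finsupp.single w 1))) :=
  freeLift_single _ _

theorem sdHomotopy_single {k : ℕ} (w : Fin (k + 1) → E) :
    sdHomotopy β (k + 1) (Finsupp.single w 1) = cone (β k w) (k + 1)
      (Finsupp.single w 1 - sdHomotopy β k (bd k (Finsupp.single w 1))) :=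
  freeLift_single _ _

/-- The cone formula leaves the subdivided boundary minus the cone over its own boundary. The latter
vanishes, since by induction it is the subdivision of a double boundary. -/
theorem bd_sd (k : ℕ) (x : TupleChain E (k + 1)) :
    bd k (sd β (k + 1) x) = sd β k (bd k x) := by
  suffices (bd k).comp (sd β (k + 1)) = (sd β k).comp (bd k) from DFunLike.congr_fun this x
  induction k with
  | zero =>
    refine free_hom_ext fun w => ?_
    rw [AddMonoidHom.comp_apply, sd_single, bd_cone_zero]
    rfl
  | succ k ih =>
    refine free_hom_ext fun w => ?_
    rw [AddMonoidHom.comp_apply, sd_single, bd_cone_succ, ← AddMonoidHom.comp_apply (bd k),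
      ih 0, AddMonoidHom.comp_apply, bd_bd, map_zero, map_zero, sub_zero]
    rfl

theorem bd_sdHomotopy (k : ℕ) (x : TupleChain E (k + 1)) :
    bd (k + 1) (sdHomotopy β (k + 1) x) = x - sd β (k + 1) x - sdHomotopy β k (bd k x) := by
  suffices (bd (k + 1)).comp (sdHomotopy β (k + 1)) =
      AddMonoidHom.id _ - sd β (k + 1) - (sdHomotopy β k).comp (bd k) from
    DFunLike.congr_fun this x
  -- The hypothesis is the homotopy formula one degree lower, applied to a boundary, so that its
  -- last term is absent. On empty tuples it holds because the homotopy is zero and the subdivision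
  -- is the identity.
  have key : ∀ (k : ℕ) (w : Fin (k + 1) → E),
      bd k (sdHomotopy β k (bd k (Finsupp.single w 1))) =
        bd k (Finsupp.single w 1) - sd β k (bd k (Finsupp.single w 1)) →
      bd (k + 1) (sdHomotopy β (k + 1) (Finsupp.single w 1)) =
        Finsupp.single w 1 - sd β (k + 1) (Finsupp.single w 1) -
          sdHomotopy β k (bd k (Finsupp.single w 1)) := fun k w h => by
    rw [sdHomotopy_single, bd_cone_succ, map_sub, h, sub_sub_cancel, sd_single]
    abel
  induction k with
  | zero =>
    refine free_hom_ext fun w => key _ w ?_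
    change bd 0 0 = bd 0 _ - bd 0 _
    rw [sub_self, map_zero]
  | succ k ih =>
    refine free_hom_ext fun w => key _ w ?_
    rw [← AddMonoidHom.comp_apply (bd (k + 1)), ih 0]
    simp [bd_bd]

variable {β} {β' : ∀ k, (Fin (k + 1) → E') → E'} {f : E → E'}

/-- Applied to affine maps, which preserve barycenters, this makes subdivision compatible with
passing to the affine simplices of a singular simplex. -/
theorem map_sd (hf : ∀ k w, f (β k w) = β' k (f ∘ w)) (k : ℕ) (x : TupleChain E k) :
    map f k (sd β k x) = sd β' k (map f k x) := by
  suffices (map f k).comp (sd β k) = (sd β' k).comp (map f k) from DFunLike.congr_fun this x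
  induction k with
  | zero => rfl
  | succ k ih =>
    refine free_hom_ext fun w => ?_
    rw [AddMonoidHom.comp_apply, AddMonoidHom.comp_apply, sd_single, map_cone,
      ← AddMonoidHom.comp_apply (map f k), ih 0, AddMonoidHom.comp_apply, map_bd, map_single,
      hf, sd_single]

theorem map_sdHomotopy (hf : ∀ k w, f (β k w) = β' k (f ∘ w)) (k : ℕ) (x : TupleChain E k) :
    map f (k + 1) (sdHomotopy β k x) = sdHomotopy β' k (map f k x) := by
  suffices (map f (k + 1)).comp (sdHomotopy β k) = (sdHomotopy β' k).comp (map f k) from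
    DFunLike.congr_fun this x
  induction k with
  | zero =>
    ext1 x
    rfl
  | succ k ih =>
    refine free_hom_ext fun w => ?_
    rw [AddMonoidHom.comp_apply, AddMonoidHom.comp_apply, sdHomotopy_single, map_cone, map_sub,
      ← AddMonoidHom.comp_apply (map f (k + 1)), ih 0, AddMonoidHom.comp_apply, map_bd,
      map_single, hf, sdHomotopy_single]

end TupleChain

end

section

/-! ### Mesh of the barycentric subdivision -/

namespace TupleChain

variable {E : Type*}

/-- The chains on the tuples with a given property. -/
noncomputable def chainsOn (k : ℕ) (P : (Fin k → E) → Prop) : AddSubgroup (TupleChain E k) :=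
  AddSubgroup.closure {c | ∃ w, P w ∧ c = Finsupp.single w 1}

theorem single_mem_chainsOn {k : ℕ} {P : (Fin k → E) → Prop} {w : Fin k → E} (h : P w) :
    Finsupp.single w 1 ∈ chainsOn k P :=
  AddSubgroup.subset_closure ⟨w, h, rfl⟩

theorem map_mem_of_mem_chainsOn {k : ℕ} {P : (Fin k → E) → Prop} {M : Type*} [AddCommGroup M]
    (f : TupleChain E k →+ M) (S : AddSubgroup M) (h : ∀ w, P w → f (Finsupp.single w 1) ∈ S)
    {c : TupleChain E k} (hc : c ∈ chainsOn k P) : f c ∈ S := by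
  suffices chainsOn k P ≤ S.comap f from this hc
  rw [chainsOn, AddSubgroup.closure_le]
  rintro _ ⟨w, hw, rfl⟩
  exact h w hw

-- What is used of barycenters: they stay in every closed ball containing the vertices, and for at
-- most `N` vertices of mutual distance at most `r` they are within (1 - 1/N) r of each vertex.
variable [PseudoMetricSpace E] {β : ∀ k, (Fin (k + 1) → E) → E} {N : ℕ} (hN : 0 < N)
  (hull : ∀ k (w : Fin (k + 1) → E) x ρ, (∀ i, dist x (w i) ≤ ρ) → dist x (β k w) ≤ ρ)
  (shrink : ∀ k (w : Fin (k + 1) → E) r, k + 1 ≤ N → (∀ i j, dist (w i) (w j) ≤ r) →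
    ∀ j, dist (β k w) (w j) ≤ (1 - (N : ℝ)⁻¹) * r)

include hN hull shrink

/-- The mesh bound cannot be proved alone. The pieces of the subdivision are cones over pieces of
faces, and the distance from the new apex to their vertices is controlled by the second property,
that closed balls containing the original vertices contain the new ones. -/
theorem sd_single_mem (k : ℕ) (hk : k ≤ N) (w : Fin k → E) {r : ℝ}
    (hr : 0 ≤ r) (hw : ∀ i j, dist (w i) (w j) ≤ r) :
    sd β k (Finsupp.single w 1) ∈ chainsOn k fun w' =>
      (∀ i j, dist (w' i) (w' j) ≤ (1 - (N : ℝ)⁻¹) * r) ∧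
        ∀ x ρ, (∀ i, dist x (w i) ≤ ρ) → ∀ i, dist x (w' i) ≤ ρ := by
  have hq : 0 ≤ 1 - (N : ℝ)⁻¹ := by
    have : (1 : ℝ) ≤ N := by exact_mod_cast hN
    exact sub_nonneg.2 (inv_le_one_of_one_le₀ this)
  induction k with
  | zero => exact single_mem_chainsOn ⟨fun i => i.elim0, fun _ _ _ i => i.elim0⟩
  | succ k ih =>
    rw [sd_single, bd_single, map_sum, map_sum]
    refine AddSubgroup.sum_mem _ fun i _ => ?_
    rw [map_zsmul, map_zsmul]
    refine AddSubgroup.zsmul_mem _ ?_ _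
    refine map_mem_of_mem_chainsOn _ _ ?_
      (ih (by omega) (w ∘ i.succAbove) fun a b => hw _ _)
    rintro w' ⟨h1, h2⟩
    rw [cone_single]
    have h3 : ∀ j, dist (β k w) (w' j) ≤ (1 - (N : ℝ)⁻¹) * r :=
      h2 _ _ fun a => shrink k w r hk hw _
    refine single_mem_chainsOn ⟨fun a b => ?_, fun x ρ hx a => ?_⟩
    · refine Fin.cases ?_ (fun a => ?_) a <;> refine Fin.cases ?_ (fun b => ?_) b
      · simpa using mul_nonneg hq hr
      · simpa using h3 b
      · simpa [dist_comm] using h3 a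
      · simpa using h1 a b
    · refine Fin.cases ?_ (fun a => ?_) a
      · simpa using hull k w x ρ hx
      · simpa using h2 x ρ (fun b => hx _) a

theorem iterate_sd_single_mem (k : ℕ) (hk : k ≤ N) (w : Fin k → E) {r : ℝ} (hr : 0 ≤ r)
    (hw : ∀ i j, dist (w i) (w j) ≤ r) (m : ℕ) :
    (sd β k)^[m] (Finsupp.single w 1) ∈
      chainsOn k fun w' => ∀ i j, dist (w' i) (w' j) ≤ (1 - (N : ℝ)⁻¹) ^ m * r := by
  have hq : 0 ≤ 1 - (N : ℝ)⁻¹ := by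
    have : (1 : ℝ) ≤ N := by exact_mod_cast hN
    exact sub_nonneg.2 (inv_le_one_of_one_le₀ this)
  induction m with
  | zero =>
    refine single_mem_chainsOn fun i j => ?_
    simpa using hw i j
  | succ m ih =>
    rw [Function.iterate_succ_apply']
    refine map_mem_of_mem_chainsOn _ _ (fun w' hw' => ?_) ih
    refine AddSubgroup.closure_mono ?_ (sd_single_mem hN hull shrink k hk w'
      (mul_nonneg (pow_nonneg hq m) hr) hw')
    rintro _ ⟨v, ⟨hv, -⟩, rfl⟩
    refine ⟨v, fun i j => (hv i j).trans_eq (by ring), rfl⟩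

end TupleChain

/-! ### Affine simplices in the standard simplex -/

namespace AffineSimplex

/-- The topological standard simplex. -/
abbrev Δ (n : ℕ) : Type := stdSimplex ℝ (Fin (n + 1))

/-- The affine map between standard simplices with given values at the vertices. -/
noncomputable def aff {k n : ℕ} (w : Fin (k + 1) → Δ n) : C(Δ k, Δ n) where
  toFun t := ⟨fun a => ∑ i, t i * w i a, fun a => Finset.sum_nonneg fun i _ =>
      mul_nonneg (t.2.1 i) ((w i).2.1 a), by
    rw [Finset.sum_comm]
    simp only [← Finset.mul_sum, stdSimplex.sum_eq_one, mul_one]⟩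
  continuous_toFun := by
    refine Continuous.subtype_mk (continuous_pi fun a => continuous_finsetSum _ fun i _ => ?_) _
    exact ((continuous_apply i).comp continuous_subtype_val).mul continuous_const

theorem aff_apply {k n : ℕ} (w : Fin (k + 1) → Δ n) (t : Δ k) (a : Fin (n + 1)) :
    aff w t a = ∑ i, t i * w i a := rfl

theorem aff_aff {l k n : ℕ} (w : Fin (k + 1) → Δ n) (v : Fin (l + 1) → Δ k) (t : Δ l) :
    aff w (aff v t) = aff (fun i => aff w (v i)) t := by
  refine stdSimplex.ext (funext fun a => ?_)
  simp only [aff_apply, Finset.sum_mul, Finset.mul_sum]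
  rw [Finset.sum_comm]
  simp only [mul_assoc]

theorem aff_vertex {k n : ℕ} (w : Fin (k + 1) → Δ n) (i : Fin (k + 1)) :
    aff w (stdSimplex.vertex i) = w i := by
  refine stdSimplex.ext (funext fun a => ?_)
  rw [aff_apply]
  simp [Pi.single_apply]

theorem map_eq_aff {k n : ℕ} (f : Fin (k + 1) → Fin (n + 1)) (t : Δ k) :
    stdSimplex.map f t = aff (fun i => stdSimplex.vertex (f i)) t := by
  refine stdSimplex.ext (funext fun a => ?_)
  rw [aff_apply, stdSimplex.map_coe, FunOnFinite.linearMap_apply_apply]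
  simp [Pi.single_apply, Finset.sum_ite, eq_comm]

theorem aff_vertex_self {n : ℕ} (t : Δ n) : aff (fun i => stdSimplex.vertex i) t = t := by
  refine stdSimplex.ext (funext fun a => ?_)
  rw [aff_apply]
  simp [Pi.single_apply]

/-- Convexity of balls, checked in each coordinate since the metric is the sup metric: the
difference of coordinates is a weighted average of differences with the vertices. -/
theorem dist_aff_le {k n : ℕ} (w : Fin (k + 1) → Δ n) (t : Δ k) (x : Δ n) (ρ : ℝ)
    (h : ∀ i, dist x (w i) ≤ ρ) : dist x (aff w t) ≤ ρ := by
  have hρ : 0 ≤ ρ := dist_nonneg.trans (h 0)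
  rw [Subtype.dist_eq, dist_pi_le_iff hρ]
  intro a
  have hx : x a - aff w t a = ∑ i, t i * (x a - w i a) := by
    simp only [mul_sub, Finset.sum_sub_distrib, ← Finset.sum_mul, stdSimplex.sum_eq_one, one_mul,
      aff_apply]
  change |x a - aff w t a| ≤ ρ
  rw [hx]
  calc |∑ i, t i * (x a - w i a)| ≤ ∑ i, |t i * (x a - w i a)| := Finset.abs_sum_le_sum_abs _ _
    _ ≤ ∑ i, t i * ρ := Finset.sum_le_sum fun i _ => by
        rw [abs_mul, abs_of_nonneg (stdSimplex.zero_le t i)]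
        refine mul_le_mul_of_nonneg_left ?_ (stdSimplex.zero_le t i)
        have := h i
        rw [Subtype.dist_eq, dist_pi_le_iff hρ] at this
        exact this a
    _ = ρ := by rw [← Finset.sum_mul, stdSimplex.sum_eq_one, one_mul]

/-- The barycenter of a tuple of points. -/
noncomputable def bary (n k : ℕ) (w : Fin (k + 1) → Δ n) : Δ n := aff w stdSimplex.barycenter

theorem aff_bary {m n : ℕ} (u : Fin (m + 1) → Δ n) (k : ℕ) (w : Fin (k + 1) → Δ m) :
    aff u (bary m k w) = bary n k (aff u ∘ w) :=
  aff_aff _ _ _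

theorem bary_apply {n k : ℕ} (w : Fin (k + 1) → Δ n) (a : Fin (n + 1)) :
    bary n k w a = (k + 1 : ℝ)⁻¹ * ∑ i, w i a := by
  rw [bary, aff_apply, Finset.mul_sum]
  refine Finset.sum_congr rfl fun i _ => ?_
  congr 1
  change ((Fintype.card (Fin (k + 1)) : ℝ))⁻¹ = _
  simp

/-- The difference from `w j` is an average of k + 1 differences, of which the one with index `j`
vanishes. The others are at most `r`, so the factor is k/(k + 1) ≤ 1 - 1/N. -/
theorem dist_bary_le {n N : ℕ} (k : ℕ) (w : Fin (k + 1) → Δ n) (r : ℝ) (hk : k + 1 ≤ N)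
    (h : ∀ i j, dist (w i) (w j) ≤ r) (j : Fin (k + 1)) :
    dist (bary n k w) (w j) ≤ (1 - (N : ℝ)⁻¹) * r := by
  have hr : 0 ≤ r := dist_nonneg.trans (h 0 0)
  have hk1 : (0 : ℝ) < k + 1 := by positivity
  have hN : ((N : ℝ))⁻¹ ≤ (k + 1 : ℝ)⁻¹ := by
    have : (k + 1 : ℝ) ≤ N := by exact_mod_cast hk
    exact inv_anti₀ hk1 this
  have hN1 : (k + 1 : ℝ)⁻¹ ≤ 1 := inv_le_one_of_one_le₀ (by linarith [Nat.cast_nonneg (α := ℝ) k])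
  refine le_trans ?_ (mul_le_mul_of_nonneg_right (sub_le_sub_left hN 1) hr)
  rw [Subtype.dist_eq, dist_pi_le_iff (mul_nonneg (by linarith) hr)]
  intro a
  have hx : bary n k w a - w j a = (k + 1 : ℝ)⁻¹ * ∑ i ∈ Finset.univ.erase j, (w i a - w j a) := by
    rw [bary_apply, Finset.sum_erase _ (sub_self _), Finset.sum_sub_distrib, Finset.sum_const,
      Finset.card_univ, Fintype.card_fin, nsmul_eq_mul, mul_sub]
    push_cast
    rw [inv_mul_cancel_left₀ hk1.ne']
  change |bary n k w a - w j a| ≤ _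
  rw [hx, abs_mul, abs_of_pos (inv_pos.2 hk1)]
  have hs : |∑ i ∈ Finset.univ.erase j, (w i a - w j a)| ≤ k * r := by
    refine (Finset.abs_sum_le_sum_abs _ _).trans ?_
    refine (Finset.sum_le_card_nsmul _ _ r fun i _ => ?_).trans_eq ?_
    · have := h i j
      rw [Subtype.dist_eq, dist_pi_le_iff hr] at this
      exact this a
    · rw [Finset.card_erase_of_mem (Finset.mem_univ _), Finset.card_univ, Fintype.card_fin]
      simp
  refine (mul_le_mul_of_nonneg_left hs (inv_pos.2 hk1).le).trans_eq ?_
  field_simp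
  ring

end AffineSimplex

end

section

open Opposite AffineSimplex TopCat

/-! ### Subdivision of singular chains -/

namespace SingularChain

variable {T : TopCat.{u}}

/-- The chain given by a singular simplex. -/
noncomputable def sing {n : ℕ} (σ : C(Δ n, T)) : (singChains.obj T).X n :=
  simplexChain ((T.toSSetObjEquiv (op (.mk n))).symm σ)

/-- The additive map on singular chains extending a map on the singular simplices. -/
noncomputable def lift {n : ℕ} {M : Type*} [AddCommGroup M] (f : C(Δ n, T) → M) :
    (singChains.obj T).X n →+ M :=
  freeLift (α := (TopCat.toSSet.obj T).obj (op (.mk n))) fun x => f (T.toSSetObjEquiv _ x)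

theorem lift_sing {n : ℕ} {M : Type*} [AddCommGroup M] (f : C(Δ n, T) → M) (σ : C(Δ n, T)) :
    lift f (sing σ) = f σ :=
  (freeLift_single _ _).trans (congrArg f (Equiv.apply_symm_apply _ _))

theorem hom_ext {n : ℕ} {A : Type v} [AddCommGroup A] {f g : (singChains.obj T).X n →+ A}
    (h : ∀ σ : C(Δ n, T), f (sing σ) = g (sing σ)) : f = g :=
  chains_hom_ext fun x => by
    have := h (T.toSSetObjEquiv _ x)
    rwa [sing, Equiv.symm_apply_apply] at this

theorem d_sing {n : ℕ} (σ : C(Δ (n + 1), T)) :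
    ((singChains.obj T).d (n + 1) n).hom (sing σ) = ∑ i : Fin (n + 2), (-1 : ℤ) ^ (i : ℕ) •
      sing (σ.comp (aff fun j => stdSimplex.vertex (i.succAbove j))) := by
  refine (chains_d_simplexChain _).trans (Finset.sum_congr rfl fun i _ => ?_)
  congr 1
  refine congrArg simplexChain ((toSSetObjEquiv_symm_naturality _ _).trans ?_)
  refine congrArg _ (ContinuousMap.ext fun t => congrArg σ ?_)
  exact map_eq_aff _ _

theorem map_sing {T' : TopCat.{u}} (f : T ⟶ T') {n : ℕ} (σ : C(Δ n, T)) :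
    ((singChains.map f).f n).hom (sing σ) = sing (f.hom.comp σ) :=
  chains_map_simplexChain _ _

/-- The singular chain associated with a chain of affine simplices in a singular simplex. -/
noncomputable def push {n : ℕ} (σ : C(Δ n, T)) (k : ℕ) :
    TupleChain (Δ n) (k + 1) →+ (singChains.obj T).X k :=
  freeLift fun w => sing (σ.comp (aff w))

theorem push_single {n : ℕ} (σ : C(Δ n, T)) {k : ℕ} (w : Fin (k + 1) → Δ n) :
    push σ k (Finsupp.single w 1) = sing (σ.comp (aff w)) :=
  freeLift_single _ _

theorem d_push {n : ℕ} (σ : C(Δ n, T)) (k : ℕ) (x : TupleChain (Δ n) (k + 2)) :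
    ((singChains.obj T).d (k + 1) k).hom (push σ (k + 1) x) =
      push σ k (TupleChain.bd (k + 1) x) := by
  suffices ((singChains.obj T).d (k + 1) k).hom.comp (push σ (k + 1)) =
      (push σ k).comp (TupleChain.bd (k + 1)) from DFunLike.congr_fun this x
  refine free_hom_ext fun w => ?_
  rw [AddMonoidHom.comp_apply, AddMonoidHom.comp_apply, push_single, d_sing,
    TupleChain.bd_single, map_sum]
  refine Finset.sum_congr rfl fun i _ => ?_
  rw [map_zsmul, push_single]
  congr 2
  refine ContinuousMap.ext fun t => congrArg σ ?_
  refine (aff_aff _ _ _).trans ?_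
  simp only [aff_vertex]
  rfl

theorem push_comp_aff {m n : ℕ} (σ : C(Δ n, T)) (u : Fin (m + 1) → Δ n) (k : ℕ)
    (x : TupleChain (Δ m) (k + 1)) :
    push (σ.comp (aff u)) k x = push σ k (TupleChain.map (aff u) (k + 1) x) := by
  suffices push (σ.comp (aff u)) k = (push σ k).comp (TupleChain.map (aff u) (k + 1)) from
    DFunLike.congr_fun this x
  refine free_hom_ext fun w => ?_
  rw [AddMonoidHom.comp_apply, TupleChain.map_single, push_single, push_single]
  exact congrArg sing (ContinuousMap.ext fun t => congrArg σ (aff_aff _ _ _))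

/-- The tautological simplex of the standard simplex. -/
noncomputable def iota (n : ℕ) : TupleChain (Δ n) (n + 1) :=
  Finsupp.single (fun i => stdSimplex.vertex i) 1

theorem push_iota {n : ℕ} (σ : C(Δ n, T)) : push σ n (iota n) = sing σ := by
  rw [iota, push_single]
  exact congrArg sing (ContinuousMap.ext fun t => congrArg σ (aff_vertex_self t))

theorem map_iota {m n : ℕ} (u : Fin (m + 1) → Δ n) :
    TupleChain.map (aff u) (m + 1) (iota m) = Finsupp.single u 1 := by
  rw [iota, TupleChain.map_single]
  congr 1
  exact funext fun i => aff_vertex _ _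

/-- Barycentric subdivision. -/
noncomputable def sd (n : ℕ) : (singChains.obj T).X n →+ (singChains.obj T).X n :=
  lift fun σ => push σ n (TupleChain.sd (bary n) (n + 1) (iota n))

/-- The homotopy between the identity and barycentric subdivision. -/
noncomputable def sdHomotopy (n : ℕ) : (singChains.obj T).X n →+ (singChains.obj T).X (n + 1) :=
  lift fun σ => push σ (n + 1) (TupleChain.sdHomotopy (bary n) (n + 1) (iota n))

/-- Singular subdivision is defined through the tautological simplex; naturality under affine maps
extends the formula to all affine chains. Identities for tuple chains thereby become identities for
singular chains. -/
theorem sd_push {n : ℕ} (σ : C(Δ n, T)) (k : ℕ) (x : TupleChain (Δ n) (k + 1)) :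
    sd k (push σ k x) = push σ k (TupleChain.sd (bary n) (k + 1) x) := by
  suffices (sd k).comp (push σ k) = (push σ k).comp (TupleChain.sd (bary n) (k + 1)) from
    DFunLike.congr_fun this x
  refine free_hom_ext fun w => ?_
  rw [AddMonoidHom.comp_apply, AddMonoidHom.comp_apply, push_single, sd, lift_sing,
    push_comp_aff, TupleChain.map_sd (aff_bary w), map_iota]

theorem sdHomotopy_push {n : ℕ} (σ : C(Δ n, T)) (k : ℕ) (x : TupleChain (Δ n) (k + 1)) :
    sdHomotopy k (push σ k x) = push σ (k + 1) (TupleChain.sdHomotopy (bary n) (k + 1) x) := by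
  suffices (sdHomotopy k).comp (push σ k) =
      (push σ (k + 1)).comp (TupleChain.sdHomotopy (bary n) (k + 1)) from
    DFunLike.congr_fun this x
  refine free_hom_ext fun w => ?_
  rw [AddMonoidHom.comp_apply, AddMonoidHom.comp_apply, push_single, sdHomotopy, lift_sing,
    push_comp_aff, TupleChain.map_sdHomotopy (aff_bary w), map_iota]

theorem d_sdHomotopy_zero (x : (singChains.obj T).X 0) :
    ((singChains.obj T).d 1 0).hom (sdHomotopy 0 x) = x - sd 0 x := by
  suffices ((singChains.obj T).d 1 0).hom.comp (sdHomotopy 0) = AddMonoidHom.id _ - sd 0 from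
    DFunLike.congr_fun this x
  refine hom_ext fun σ => ?_
  rw [← push_iota σ, AddMonoidHom.comp_apply, sdHomotopy_push, d_push, TupleChain.bd_sdHomotopy,
    AddMonoidHom.sub_apply, AddMonoidHom.id_apply, sd_push, map_sub, map_sub]
  -- The remaining term contains the homotopy on empty tuples, which is zero by definition.
  exact sub_eq_self.2 (map_zero _)

theorem d_sdHomotopy_succ (n : ℕ) (x : (singChains.obj T).X (n + 1)) :
    ((singChains.obj T).d (n + 2) (n + 1)).hom (sdHomotopy (n + 1) x) =
      x - sd (n + 1) x - sdHomotopy n (((singChains.obj T).d (n + 1) n).hom x) := by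
  suffices ((singChains.obj T).d (n + 2) (n + 1)).hom.comp (sdHomotopy (n + 1)) =
      AddMonoidHom.id _ - sd (n + 1) - (sdHomotopy n).comp ((singChains.obj T).d (n + 1) n).hom from
    DFunLike.congr_fun this x
  refine hom_ext fun σ => ?_
  rw [← push_iota σ]
  simp only [AddMonoidHom.comp_apply, AddMonoidHom.sub_apply, AddMonoidHom.id_apply]
  rw [sdHomotopy_push, d_push, TupleChain.bd_sdHomotopy, sd_push, d_push, sdHomotopy_push,
    map_sub, map_sub]

/-- The chains of simplices lying in a subset. -/
noncomputable def carried (U : Set T) (n : ℕ) : AddSubgroup ((singChains.obj T).X n) :=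
  (Finsupp.supported ℤ ℤ {x : (TopCat.toSSet.obj T).obj (op (.mk n)) |
    Set.range (T.toSSetObjEquiv _ x) ⊆ U}).toAddSubgroup

theorem sing_mem_carried {U : Set T} {n : ℕ} {σ : C(Δ n, T)} (h : ∀ t, σ t ∈ U) :
    sing σ ∈ carried U n := by
  refine Finsupp.single_mem_supported ℤ 1 ?_
  rintro _ ⟨t, rfl⟩
  rw [Equiv.apply_symm_apply]
  exact h t

theorem carried_inf (U V : Set T) (n : ℕ) : carried U n ⊓ carried V n = carried (U ∩ V) n := by
  ext x
  have h : {x : (TopCat.toSSet.obj T).obj (op (.mk n)) | Set.range (T.toSSetObjEquiv _ x) ⊆ U ∩ V} =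
      {x | Set.range (T.toSSetObjEquiv _ x) ⊆ U} ∩ {x | Set.range (T.toSSetObjEquiv _ x) ⊆ V} := by
    ext
    exact Set.subset_inter_iff
  rw [carried, carried, carried, h, Finsupp.supported_inter]
  rfl

theorem carried_le {U : Set T} {n : ℕ} {S : AddSubgroup ((singChains.obj T).X n)}
    (h : ∀ σ : C(Δ n, T), (∀ t, σ t ∈ U) → sing σ ∈ S) : carried U n ≤ S := by
  intro c hc
  change c ∈ Finsupp.supported ℤ ℤ _ at hc
  rw [Finsupp.supported_eq_span_single] at hc
  refine Submodule.span_induction (p := fun c _ => c ∈ S) ?_ S.zero_mem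
    (fun _ _ _ _ => S.add_mem) (fun k x _ hx => ?_) hc
  · rintro _ ⟨x, hx, rfl⟩
    have := h (T.toSSetObjEquiv _ x) fun t => hx ⟨t, rfl⟩
    rwa [sing, Equiv.symm_apply_apply] at this
  · exact S.zsmul_mem hx k

theorem map_mem_of_mem_carried {U : Set T} {n : ℕ} {M : Type*} [AddCommGroup M]
    (f : (singChains.obj T).X n →+ M) (S : AddSubgroup M)
    (h : ∀ σ : C(Δ n, T), (∀ t, σ t ∈ U) → f (sing σ) ∈ S)
    {c : (singChains.obj T).X n} (hc : c ∈ carried U n) : f c ∈ S :=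
  (carried_le (S := S.comap f) h) hc

theorem push_mem_carried {U : Set T} {n : ℕ} {σ : C(Δ n, T)} (h : ∀ t, σ t ∈ U) (k : ℕ)
    (x : TupleChain (Δ n) (k + 1)) : push σ k x ∈ carried U k := by
  induction x using Finsupp.induction_linear with
  | zero => rw [map_zero]; exact zero_mem _
  | add x y hx hy => rw [map_add]; exact add_mem hx hy
  | single w a =>
    have : Finsupp.single w a = a • Finsupp.single w (1 : ℤ) := by simp
    rw [this, map_zsmul, push_single]
    exact zsmul_mem (sing_mem_carried (σ := σ.comp (aff w)) fun t => h _) a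

variable {U V : Set T}

theorem sd_mem_carried {n : ℕ} {c : (singChains.obj T).X n} (hc : c ∈ carried U n) :
    sd n c ∈ carried U n :=
  map_mem_of_mem_carried _ _ (fun σ h => by
    rw [← push_iota σ, sd_push]; exact push_mem_carried h _ _) hc

theorem sdHomotopy_mem_carried {n : ℕ} {c : (singChains.obj T).X n} (hc : c ∈ carried U n) :
    sdHomotopy n c ∈ carried U (n + 1) :=
  map_mem_of_mem_carried _ _ (fun σ h => by
    rw [← push_iota σ, sdHomotopy_push]; exact push_mem_carried h _ _) hc

theorem d_mem_carried {i j : ℕ} {c : (singChains.obj T).X i} (hc : c ∈ carried U i) :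
    ((singChains.obj T).d i j).hom c ∈ carried U j := by
  by_cases hij : j + 1 = i
  · subst hij
    refine map_mem_of_mem_carried _ _ (fun σ h => ?_) hc
    rw [← push_iota σ, d_push]
    exact push_mem_carried h _ _
  · rw [(singChains.obj T).shape _ _ hij]
    exact zero_mem _

theorem iterate_sd_mem {n : ℕ} {S : AddSubgroup ((singChains.obj T).X n)}
    (h : ∀ c ∈ S, sd n c ∈ S) (m : ℕ) {c} (hc : c ∈ S) : (sd n)^[m] c ∈ S := by
  induction m with
  | zero => exact hc
  | succ m ih => rw [Function.iterate_succ_apply']; exact h _ ih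

theorem iterate_sd_push {n : ℕ} (σ : C(Δ n, T)) (m : ℕ) (k : ℕ) (x : TupleChain (Δ n) (k + 1)) :
    (sd k)^[m] (push σ k x) = push σ k ((TupleChain.sd (bary n) (k + 1))^[m] x) := by
  induction m with
  | zero => rfl
  | succ m ih => rw [Function.iterate_succ_apply', ih, sd_push, Function.iterate_succ_apply']

/-- Iterated subdivision makes the affine pieces smaller than a Lebesgue number of the cover pulled
back to the standard simplex. -/
theorem exists_iterate_sd_sing (hU : IsOpen U) (hV : IsOpen V) (hUV : U ∪ V = Set.univ) {n : ℕ}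
    (σ : C(Δ n, T)) : ∃ m, (sd n)^[m] (sing σ) ∈ carried U n ⊔ carried V n := by
  obtain ⟨δ, hδ, H⟩ := lebesgue_number_lemma_of_metric (s := (Set.univ : Set (Δ n)))
    (c := fun b : Bool => cond b (σ ⁻¹' U) (σ ⁻¹' V)) isCompact_univ
    (fun b => by cases b; exacts [hV.preimage σ.continuous, hU.preimage σ.continuous])
    (fun t _ => by
      have : σ t ∈ U ∪ V := hUV ▸ Set.mem_univ _
      rcases this with h | h
      exacts [Set.mem_iUnion.2 ⟨true, h⟩, Set.mem_iUnion.2 ⟨false, h⟩])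
  set r := Metric.diam (Set.univ : Set (Δ n))
  have hr : 0 ≤ r := Metric.diam_nonneg
  have hd : ∀ x y : Δ n, dist x y ≤ r := fun x y =>
    Metric.dist_le_diam_of_mem isCompact_univ.isBounded trivial trivial
  have hN : ((n + 1 : ℕ) : ℝ)⁻¹ ≤ 1 := inv_le_one_of_one_le₀ (by simp)
  have hN' : 0 < ((n + 1 : ℕ) : ℝ)⁻¹ := by positivity
  -- Dividing by `r + 1` rather than `r` avoids the case of diameter zero.
  obtain ⟨m, hm⟩ := exists_pow_lt_of_lt_one (show 0 < δ / (r + 1) by positivity)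
    (show 1 - ((n + 1 : ℕ) : ℝ)⁻¹ < 1 by linarith)
  have hm' : (1 - ((n + 1 : ℕ) : ℝ)⁻¹) ^ m * r < δ := by
    rw [lt_div_iff₀ (by positivity)] at hm
    refine lt_of_le_of_lt ?_ hm
    exact mul_le_mul_of_nonneg_left (by linarith) (pow_nonneg (by linarith) m)
  refine ⟨m, ?_⟩
  rw [← push_iota σ, iterate_sd_push]
  refine TupleChain.map_mem_of_mem_chainsOn _ _ (fun w hw => ?_)
    (TupleChain.iterate_sd_single_mem (N := n + 1) n.succ_pos (fun k w x ρ => dist_aff_le w _ x ρ)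
      (fun k w r => dist_bary_le k w r) (n + 1) le_rfl _ hr (fun i j => hd _ _) m)
  rw [push_single]
  -- The vertices of a piece lie within the mesh of `w 0`, so by convexity the whole piece lies in
  -- the ball about `w 0`, which maps into one member of the cover.
  obtain ⟨b, hb⟩ := H (w 0) trivial
  have hball : ∀ t, aff w t ∈ Metric.ball (w 0) δ := fun t => by
    rw [Metric.mem_ball']
    exact (dist_aff_le w t _ _ fun i => hw _ _).trans_lt hm'
  cases b
  · exact AddSubgroup.mem_sup_right (sing_mem_carried fun t => hb (hball t))
  · exact AddSubgroup.mem_sup_left (sing_mem_carried fun t => hb (hball t))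

theorem exists_iterate_sd (hU : IsOpen U) (hV : IsOpen V) (hUV : U ∪ V = Set.univ) {n : ℕ}
    (c : (singChains.obj T).X n) : ∃ m, (sd n)^[m] c ∈ carried U n ⊔ carried V n := by
  have hS : ∀ c ∈ carried U n ⊔ carried V n, sd n c ∈ carried U n ⊔ carried V n := by
    intro c hc
    obtain ⟨a, ha, b, hb, rfl⟩ := AddSubgroup.mem_sup.1 hc
    rw [map_add]
    exact add_mem (AddSubgroup.mem_sup_left (sd_mem_carried ha))
      (AddSubgroup.mem_sup_right (sd_mem_carried hb))
  refine chains_induction (P := fun c => ∃ m, (sd n)^[m] c ∈ carried U n ⊔ carried V n)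
    ⟨0, zero_mem _⟩ ?_ ?_ ?_ c
  · rintro a b ⟨m, hm⟩ ⟨m', hm'⟩
    -- Chains that are already small stay small under further subdivision, so the numbers of
    -- subdivisions may be added.
    refine ⟨m + m', ?_⟩
    rw [iterate_map_add]
    refine add_mem ?_ ?_
    · rw [add_comm, Function.iterate_add_apply]; exact iterate_sd_mem hS _ hm
    · rw [Function.iterate_add_apply]; exact iterate_sd_mem hS _ hm'
  · rintro a ⟨m, hm⟩
    exact ⟨m, by rw [iterate_map_neg]; exact neg_mem hm⟩
  · intro x
    have := exists_iterate_sd_sing hU hV hUV (T.toSSetObjEquiv _ x)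
    rwa [sing, Equiv.symm_apply_apply] at this

/-- The homotopy between the identity and an iterated subdivision. -/
noncomputable def iterHomotopy (m n : ℕ) (c : (singChains.obj T).X n) :
    (singChains.obj T).X (n + 1) :=
  ∑ i ∈ Finset.range m, sdHomotopy n ((sd n)^[i] c)

theorem iterHomotopy_mem_carried (m : ℕ) {n : ℕ} {c : (singChains.obj T).X n}
    (hc : c ∈ carried U n) : iterHomotopy m n c ∈ carried U (n + 1) :=
  sum_mem fun _ _ => sdHomotopy_mem_carried (iterate_sd_mem (fun _ => sd_mem_carried) _ hc)

theorem d_sd (n : ℕ) (c : (singChains.obj T).X (n + 1)) :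
    ((singChains.obj T).d (n + 1) n).hom (sd (n + 1) c) =
      sd n (((singChains.obj T).d (n + 1) n).hom c) := by
  suffices ((singChains.obj T).d (n + 1) n).hom.comp (sd (n + 1)) =
      (sd n).comp ((singChains.obj T).d (n + 1) n).hom from DFunLike.congr_fun this c
  refine hom_ext fun σ => ?_
  rw [← push_iota σ, AddMonoidHom.comp_apply, AddMonoidHom.comp_apply, sd_push, d_push, d_push,
    sd_push, TupleChain.bd_sd]

theorem d_iterate_sd (m n : ℕ) (c : (singChains.obj T).X (n + 1)) :
    ((singChains.obj T).d (n + 1) n).hom ((sd (n + 1))^[m] c) =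
      (sd n)^[m] (((singChains.obj T).d (n + 1) n).hom c) := by
  induction m with
  | zero => rfl
  | succ m ih => rw [Function.iterate_succ_apply', d_sd, ih, Function.iterate_succ_apply']

theorem d_iterHomotopy_zero (m : ℕ) (c : (singChains.obj T).X 0) :
    ((singChains.obj T).d 1 0).hom (iterHomotopy m 0 c) = c - (sd 0)^[m] c := by
  rw [iterHomotopy, map_sum]
  simp only [d_sdHomotopy_zero, ← Function.iterate_succ_apply' (sd 0)]
  exact Finset.sum_range_sub' (fun i => (sd 0)^[i] c) m

theorem d_iterHomotopy_succ (m n : ℕ) (c : (singChains.obj T).X (n + 1)) :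
    ((singChains.obj T).d (n + 2) (n + 1)).hom (iterHomotopy m (n + 1) c) =
      c - (sd (n + 1))^[m] c - iterHomotopy m n (((singChains.obj T).d (n + 1) n).hom c) := by
  rw [iterHomotopy, map_sum, iterHomotopy]
  simp only [d_sdHomotopy_succ, ← Function.iterate_succ_apply' (sd (n + 1)), d_iterate_sd]
  rw [Finset.sum_sub_distrib, Finset.sum_range_sub' (fun i => (sd (n + 1))^[i] c) m]
  rfl

/-- A simplex with image in the range of `j` factors through `j` set-theoretically, and continuously
because `j` is an embedding. -/
theorem range_map_of_isEmbedding {A : TopCat.{u}} (j : A ⟶ T) (hj : Topology.IsEmbedding j)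
    {n : ℕ} (c : (singChains.obj T).X n) :
    (∃ a, ((singChains.map j).f n).hom a = c) ↔ c ∈ carried (Set.range j) n := by
  constructor
  · rintro ⟨a, rfl⟩
    have : a ∈ carried (Set.univ : Set A) n := by
      refine chains_induction (P := fun a => a ∈ carried (Set.univ : Set A) n) (zero_mem _)
        (fun _ _ => add_mem) (fun _ => neg_mem) (fun x => ?_) a
      have := sing_mem_carried (U := Set.univ) (σ := A.toSSetObjEquiv _ x) fun t => trivial
      rwa [sing, Equiv.symm_apply_apply] at this
    refine map_mem_of_mem_carried _ _ (fun σ h => ?_) this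
    rw [map_sing]
    exact sing_mem_carried fun t => ⟨_, rfl⟩
  · refine fun h => carried_le (S := ((singChains.map j).f n).hom.range) (fun σ hσ => ?_) h
    choose f hf using hσ
    have hfc : Continuous f := hj.isInducing.continuous_iff.2 (by
      have : j ∘ f = σ := funext hf
      rw [this]
      exact σ.continuous)
    refine ⟨sing ⟨f, hfc⟩, ?_⟩
    rw [map_sing]
    exact congrArg sing (ContinuousMap.ext hf)

theorem mono_map_of_injective {A : TopCat.{u}} (j : A ⟶ T) (hj : Function.Injective j) :
    Mono (singChains.map j) := by
  refine mono_chains_map _ fun n x y h => ?_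
  apply (A.toSSetObjEquiv _).injective
  have h' := congrArg (T.toSSetObjEquiv _) h
  exact ContinuousMap.ext fun t => hj (DFunLike.congr_fun h' t)

/-- Excision. -/
theorem excision {A B C : TopCat.{u}} {i : A ⟶ B} {p : A ⟶ C} {q : B ⟶ T} {j : C ⟶ T}
    (w : i ≫ q = p ≫ j) (hq : Topology.IsOpenEmbedding q) (hj : Topology.IsOpenEmbedding j)
    (hi : Topology.IsEmbedding i) (hcover : Set.range q ∪ Set.range j = Set.univ)
    (hA : Set.range (i ≫ q) = Set.range q ∩ Set.range j) :
    QuasiIso (Limits.cokernel.map (singChains.map i) (singChains.map j) (singChains.map p)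
      (singChains.map q) (by rw [← Functor.map_comp, w, Functor.map_comp])) := by
  have mem_q {n : ℕ} (c) := range_map_of_isEmbedding (n := n) q hq.isEmbedding c
  have mem_j {n : ℕ} (c) := range_map_of_isEmbedding (n := n) j hj.isEmbedding c
  have hiq : Topology.IsEmbedding (i ≫ q) := hq.isEmbedding.comp hi
  have inj_q (n : ℕ) : Function.Injective ((singChains.map q).f n).hom :=
    have := mono_map_of_injective q hq.injective
    ChainComplex.f_injective _ n
  -- A chain lying both in `B` and in `C` is carried by the intersection, which is the image of `A`.
  have mem_i {n : ℕ} (b) (hb : ((singChains.map q).f n).hom b ∈ carried (Set.range j) n) :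
      ∃ a, ((singChains.map i).f n).hom a = b := by
    have h1 : ((singChains.map q).f n).hom b ∈ carried (Set.range (i ≫ q)) n := by
      rw [hA, ← carried_inf]
      exact ⟨(mem_q _).1 ⟨b, rfl⟩, hb⟩
    obtain ⟨a, ha⟩ := (range_map_of_isEmbedding _ hiq _).2 h1
    refine ⟨a, inj_q n ?_⟩
    rw [← ha, Functor.map_comp]
    rfl
  have i_mem {n : ℕ} (a) : ((singChains.map q).f n).hom (((singChains.map i).f n).hom a) ∈
      carried (Set.range j) n := by
    have h1 : ((singChains.map (i ≫ q)).f n).hom a ∈ carried (Set.range (i ≫ q)) n :=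
      (range_map_of_isEmbedding _ hiq _).1 ⟨a, rfl⟩
    rw [hA, ← carried_inf, Functor.map_comp] at h1
    exact h1.2
  rw [ChainComplex.quasiIso_cokernelMap_iff]
  -- A relative cycle differs from its subdivision by a boundary and a chain in the range of `j`:
  -- the homotopy applied to the boundary of `y` stays where that boundary lies.
  have hd {n : ℕ} (y : (singChains.obj T).X n)
      (hy : ∀ k, ((singChains.obj T).d n k).hom y ∈ carried (Set.range j) k) (m : ℕ) :
      ∃ e ∈ carried (Set.range j) n,
        ((singChains.obj T).d (n + 1) n).hom (iterHomotopy m n y) = y - (sd n)^[m] y - e := by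
    cases n with
    | zero => exact ⟨0, zero_mem _, by rw [d_iterHomotopy_zero, sub_zero]⟩
    | succ n => exact ⟨_, iterHomotopy_mem_carried m (hy n), d_iterHomotopy_succ m n y⟩
  refine fun n => ⟨fun y hy => ?_, fun x hx => ?_⟩
  · replace hy : ∀ k, ((singChains.obj T).d n k).hom y ∈ carried (Set.range j) k := fun k => by
      obtain ⟨c, hc⟩ := hy k
      exact (mem_j _).1 ⟨c, hc.symm⟩
    -- After enough subdivisions `y` splits as `a + b` with `a` in the range of `q` and `b` in that
    -- of `j`; `a` is the required lift.
    obtain ⟨m, hm⟩ := exists_iterate_sd hq.isOpen_range hj.isOpen_range hcover y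
    obtain ⟨a, ha, b, hb, hab⟩ := AddSubgroup.mem_sup.1 hm
    obtain ⟨e, he, hde⟩ := hd y hy m
    obtain ⟨x, rfl⟩ := (mem_q _).2 ha
    obtain ⟨k, hk⟩ := (mem_j _).2 (add_mem he hb)
    have hyx : y = ((singChains.map q).f n).hom x +
        ((singChains.obj T).d (n + 1) n).hom (iterHomotopy m n y) +
          ((singChains.map j).f n).hom k := by
      rw [hk, hde, ← hab]
      abel
    refine ⟨x, fun l => ?_, _, _, hyx⟩
    obtain ⟨a, ha⟩ := mem_i (((singChains.obj B).d n l).hom x) (by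
      rw [ChainComplex.f_d_apply, eq_sub_of_add_eq (eq_sub_of_add_eq hyx.symm), map_sub, map_sub,
        ChainComplex.d_d_apply, sub_zero, hk]
      exact sub_mem (hy l) (d_mem_carried (add_mem he hb)))
    exact ⟨a, ha.symm⟩
  · rintro ⟨v, k, hv⟩
    obtain ⟨m, hm⟩ := exists_iterate_sd hq.isOpen_range hj.isOpen_range hcover v
    obtain ⟨a, ha, b, hb, hab⟩ := AddSubgroup.mem_sup.1 hm
    -- The bounding chain in `B` is `a`, the part of the subdivided `v` in the range of `q`, plus
    -- the subdivision homotopy of `q x`. What remains of `x` is expressed by `b`, `k` and the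
    -- homotopy of `k`, all in the range of `j`, and so lies in `A`.
    have hx' := iterHomotopy_mem_carried m ((mem_q _).1 ⟨x, rfl⟩)
    obtain ⟨a', ha'⟩ := (mem_q _).2 (add_mem ha hx')
    have hk : ((singChains.map j).f n).hom k ∈ carried (Set.range j) n := (mem_j _).1 ⟨k, rfl⟩
    have hk' := iterHomotopy_mem_carried m hk
    have hdv : ((singChains.obj T).d (n + 1) n).hom v =
        ((singChains.map q).f n).hom x - ((singChains.map j).f n).hom k := by
      rw [hv, add_sub_cancel_right]
    have hdd := congrArg ((singChains.obj T).d (n + 1) n).hom (d_iterHomotopy_succ m n v)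
    have hadd : iterHomotopy m n (((singChains.map q).f n).hom x - ((singChains.map j).f n).hom k) =
        iterHomotopy m n (((singChains.map q).f n).hom x) -
          iterHomotopy m n (((singChains.map j).f n).hom k) := by
      simp only [iterHomotopy, iterate_map_sub, map_sub, Finset.sum_sub_distrib]
    rw [ChainComplex.d_d_apply, map_sub, map_sub, hdv, hadd, map_sub, ← hab, map_add] at hdd
    have hkey : ((singChains.map q).f n).hom (x - ((singChains.obj B).d (n + 1) n).hom a') =
        ((singChains.obj T).d (n + 1) n).hom b -
          ((singChains.obj T).d (n + 1) n).hom
            (iterHomotopy m n (((singChains.map j).f n).hom k)) +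
          ((singChains.map j).f n).hom k := by
      rw [map_sub, ChainComplex.f_d_apply, ha', map_add, ← sub_eq_zero]
      refine Eq.trans ?_ hdd.symm
      abel
    obtain ⟨k', hk'⟩ := mem_i _ (by
      rw [hkey]
      exact add_mem (sub_mem (d_mem_carried hb) (d_mem_carried hk')) hk)
    exact ⟨a', k', by rw [hk']; abel⟩

end SingularChain

end

section

open Limits Topology

/-! ### Collars and pushouts of topological spaces -/

namespace TopCat

section Pushout

variable {A B X Y : TopCat.{u}} {t : A ⟶ X} {f : A ⟶ B} {g : X ⟶ Y} {b : B ⟶ Y}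

theorem exists_desc_of_isPushout (sq : IsPushout t f g b) {Z : Type u} [TopologicalSpace Z]
    (p : C(X, Z)) (q : C(B, Z)) (h : ∀ a, p (t a) = q (f a)) :
    ∃ d : C(Y, Z), (∀ x, d (g x) = p x) ∧ ∀ x, d (b x) = q x := by
  have w : t ≫ ofHom p = f ≫ ofHom q := by
    ext a
    exact h a
  exact ⟨(sq.desc (ofHom p) (ofHom q) w).hom,
    fun x => ConcreteCategory.congr_hom (sq.inl_desc (ofHom p) (ofHom q) w) x,
    fun x => ConcreteCategory.congr_hom (sq.inr_desc (ofHom p) (ofHom q) w) x⟩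

theorem eq_or_eq_of_isPushout (sq : IsPushout t f g b) (y : Y) :
    (∃ x, g x = y) ∨ ∃ x, b x = y ∧ x ∉ Set.range f :=
  Types.eq_or_eq_of_isPushout' (sq.map (forget TopCat)) y

theorem injective_of_isPushout (sq : IsPushout t f g b) (hf : Function.Injective f) :
    Function.Injective g :=
  Types.pushoutCocone_inr_injective_of_isColimit (sq.flip.map (forget TopCat)).isColimit hf

theorem eq_iff_of_isPushout (sq : IsPushout t f g b) (hf : Function.Injective f) (x : X) (y : B) :
    b y = g x ↔ ∃ a, f a = y ∧ t a = x :=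
  Types.pushoutCocone_inl_eq_inr_iff_of_isColimit (sq.flip.map (forget TopCat)).isColimit hf y x

/-- The predicate "equal to x" on `B` and the constant `False` on `X` agree on `A`. Into an
indiscrete space every function is continuous, so they glue to a predicate on `Y` that separates `b
x` from the other values of `b`. -/
theorem eq_of_isPushout (sq : IsPushout t f g b) {x y : B} (hx : x ∉ Set.range f)
    (h : b x = b y) : x = y := by
  let : TopologicalSpace (ULift.{u} Prop) := ⊤
  obtain ⟨d, -, hd⟩ := exists_desc_of_isPushout sq (Z := ULift.{u} Prop)
    ⟨fun _ => ⟨False⟩, continuous_top⟩ ⟨fun y => ⟨x = y⟩, continuous_top⟩ (fun a => by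
      have : x ≠ f a := fun h => hx ⟨a, h.symm⟩
      simpa using this)
  have h1 := hd x
  rw [h, hd y] at h1
  have h2 := congrArg ULift.down h1
  simpa using h2

theorem isClosed_iff_of_isPushout (sq : IsPushout t f g b) (S : Set Y) :
    IsClosed S ↔ IsClosed (g ⁻¹' S) ∧ IsClosed (b ⁻¹' S) := by
  refine ⟨fun h => ⟨h.preimage g.hom.continuous, h.preimage b.hom.continuous⟩, fun h => ?_⟩
  refine (isClosed_iff_of_isColimit _ sq.isColimit S).2 ?_
  rintro (_ | _ | _)
  · exact (h.1.preimage t.hom.continuous)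
  · exact h.1
  · exact h.2

theorem isOpen_iff_of_isPushout (sq : IsPushout t f g b) (S : Set Y) :
    IsOpen S ↔ IsOpen (g ⁻¹' S) ∧ IsOpen (b ⁻¹' S) := by
  simp only [← isClosed_compl_iff, isClosed_iff_of_isPushout sq, Set.preimage_compl]

/-- For `C` closed in `X`, the preimage of its image in `B` is `f '' (t ⁻¹' C)`, closed because `f`
is a closed map. -/
theorem isClosedEmbedding_of_isPushout (sq : IsPushout t f g b) (hf : IsClosedEmbedding f) :
    IsClosedEmbedding g := by
  have hg := injective_of_isPushout sq hf.injective
  refine IsClosedEmbedding.of_continuous_injective_isClosedMap g.hom.continuous hg fun C hC => ?_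
  rw [isClosed_iff_of_isPushout sq]
  refine ⟨by rwa [Set.preimage_image_eq _ hg], ?_⟩
  have : b ⁻¹' (g '' C) = f '' (t ⁻¹' C) := by
    ext y
    constructor
    · rintro ⟨x, hx, h⟩
      obtain ⟨a, rfl, rfl⟩ := (eq_iff_of_isPushout sq hf.injective _ _).1 h.symm
      exact ⟨a, hx, rfl⟩
    · rintro ⟨a, ha, rfl⟩
      exact ⟨t a, ha, ((eq_iff_of_isPushout sq hf.injective _ _).2 ⟨a, rfl, rfl⟩).symm⟩
  rw [this]
  exact hf.isClosedMap _ (hC.preimage t.hom.continuous)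

end Pushout

/-- A collar of a closed embedding: a function `ρ` vanishing precisely on the subspace, and a
homotopy relative to the subspace, not increasing `ρ`, which eventually retracts the open set where
`ρ < 1 / 2` to the subspace. -/
structure Collar {A B : TopCat.{u}} (f : A ⟶ B) where
  isClosedEmbedding : IsClosedEmbedding f
  ρ : C(B, ℝ)
  ρ_nonneg : ∀ x, 0 ≤ ρ x
  ρ_eq_zero_iff : ∀ x, ρ x = 0 ↔ x ∈ Set.range f
  h : C(unitInterval × B, B)
  h_zero : ∀ x, h (0, x) = x
  h_apply : ∀ s a, h (s, f a) = f a
  ρ_h_le : ∀ s x, ρ (h (s, x)) ≤ ρ x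
  h_one : ∀ x, ρ x < 1 / 2 → h (1, x) ∈ Set.range f

namespace Collar

section Pushout

variable {A B X Y : TopCat.{u}} {t : A ⟶ X} {f : A ⟶ B} {g : X ⟶ Y} {b : B ⟶ Y}

/-- Extend `ρ` by zero and the homotopy by the constant homotopy on `X`; both agree on `A` and
descend to the pushout. -/
theorem exists_of_isPushout (c : Collar f) (sq : IsPushout t f g b) :
    ∃ c' : Collar g, ∀ x, c'.ρ (b x) = c.ρ x := by
  obtain ⟨r, hr₁, hr₂⟩ := exists_desc_of_isPushout sq (Z := ULift.{u} ℝ)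
    ⟨fun _ => ⟨0⟩, continuous_const⟩ ⟨fun x => ⟨c.ρ x⟩, continuous_uliftUp.comp c.ρ.continuous⟩
    (fun a => congrArg ULift.up ((c.ρ_eq_zero_iff _).2 ⟨a, rfl⟩).symm)
  -- The homotopy is descended as a map to the space of paths in `Y`. In this curried form the
  -- universal property applies directly, without taking the product of the pushout with the
  -- interval.
  obtain ⟨k, hk₁, hk₂⟩ := exists_desc_of_isPushout sq (Z := C(unitInterval, Y))
    (ContinuousMap.curry ⟨fun p : X × unitInterval => g p.1,
      g.hom.continuous.comp continuous_fst⟩)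
    (ContinuousMap.curry ⟨fun p : B × unitInterval => b (c.h (p.2, p.1)),
      b.hom.continuous.comp (c.h.continuous.comp continuous_swap)⟩)
    (fun a => by
      ext s
      change g (t a) = b (c.h (s, f a))
      rw [c.h_apply]
      exact ConcreteCategory.congr_hom sq.w a)
  have hρ₁ : ∀ x, (r (g x)).down = 0 := fun x => congrArg ULift.down (hr₁ x)
  have hρ₂ : ∀ x, (r (b x)).down = c.ρ x := fun x => congrArg ULift.down (hr₂ x)
  have hh₁ : ∀ s x, k (g x) s = g x := fun s x => DFunLike.congr_fun (hk₁ x) s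
  have hh₂ : ∀ s x, k (b x) s = b (c.h (s, x)) := fun s x => DFunLike.congr_fun (hk₂ x) s
  have hfg : ∀ a, b (f a) = g (t a) := fun a => (ConcreteCategory.congr_hom sq.w a).symm
  refine ⟨⟨isClosedEmbedding_of_isPushout sq c.isClosedEmbedding,
    ⟨fun y => (r y).down, continuous_uliftDown.comp r.continuous⟩, fun y => ?_, fun y => ?_,
    ⟨fun p => k p.2 p.1, by fun_prop⟩, fun y => ?_, fun s x => hh₁ s x, fun s y => ?_,
    fun y hy => ?_⟩, hρ₂⟩
  · rcases eq_or_eq_of_isPushout sq y with ⟨x, rfl⟩ | ⟨x, rfl, hx⟩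
    · exact (hρ₁ x).ge
    · exact (c.ρ_nonneg x).trans_eq (hρ₂ x).symm
  · refine ⟨fun hy => ?_, ?_⟩
    · rcases eq_or_eq_of_isPushout sq y with ⟨x, rfl⟩ | ⟨x, rfl, hx⟩
      · exact ⟨x, rfl⟩
      · exact absurd ((c.ρ_eq_zero_iff x).1 ((hρ₂ x).symm.trans hy)) hx
    · rintro ⟨x, rfl⟩
      exact hρ₁ x
  · rcases eq_or_eq_of_isPushout sq y with ⟨x, rfl⟩ | ⟨x, rfl, hx⟩
    · exact hh₁ _ _
    · exact (hh₂ _ _).trans (congrArg b (c.h_zero x))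
  · rcases eq_or_eq_of_isPushout sq y with ⟨x, rfl⟩ | ⟨x, rfl, hx⟩
    · change (r (k _ _)).down ≤ _
      rw [hh₁]
      exact le_rfl
    · change (r (k _ _)).down ≤ (r _).down
      rw [hh₂, hρ₂, hρ₂]
      exact c.ρ_h_le s x
  · rcases eq_or_eq_of_isPushout sq y with ⟨x, rfl⟩ | ⟨x, rfl, hx⟩
    · exact ⟨x, (hh₁ _ _).symm⟩
    · obtain ⟨a, ha⟩ := c.h_one x ((hρ₂ x).symm.trans_lt hy)
      refine ⟨t a, ?_⟩
      change _ = k (b x) 1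
      rw [hh₂, ← ha, hfg]

end Pushout

/-- The restriction of a continuous map to subspaces. -/
def restrict {B Y : TopCat.{u}} (b : B ⟶ Y) (S : Set B) (S' : Set Y) (h : ∀ x ∈ S, b x ∈ S') :
    TopCat.of S ⟶ TopCat.of S' :=
  ofHom ⟨fun x => ⟨b x, h x x.2⟩, by fun_prop⟩

/-- The inclusion of a subspace. -/
def incl {B : TopCat.{u}} (S : Set B) : TopCat.of S ⟶ B :=
  ofHom ⟨Subtype.val, continuous_subtype_val⟩

variable {A B : TopCat.{u}} {f : A ⟶ B} (c : Collar f)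

/-- The open neighbourhood of the subspace given by a collar. -/
def nhd : Set B := {x | c.ρ x < 1 / 2}

/-- The complement of the subspace. -/
def away : Set B := {x | 0 < c.ρ x}

theorem isOpen_nhd : IsOpen c.nhd := isOpen_lt c.ρ.continuous continuous_const

theorem isOpen_away : IsOpen c.away := isOpen_lt continuous_const c.ρ.continuous

theorem nhd_union_away : c.nhd ∪ c.away = Set.univ := by
  refine Set.eq_univ_of_forall fun x => ?_
  by_cases hx : 0 < c.ρ x
  · exact Or.inr hx
  · exact Or.inl (show c.ρ x < 1 / 2 by linarith)

theorem notMem_range_of_mem_away {x : B} (hx : x ∈ c.away) : x ∉ Set.range f :=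
  fun h => hx.ne' ((c.ρ_eq_zero_iff x).2 h)

theorem apply_mem_nhd (a : A) : f a ∈ c.nhd := by
  change c.ρ (f a) < 1 / 2
  rw [(c.ρ_eq_zero_iff _).2 ⟨a, rfl⟩]
  norm_num

/-- The map from the subspace to its neighbourhood. -/
def toNhd : A ⟶ TopCat.of c.nhd :=
  ofHom ⟨fun a => ⟨f a, c.apply_mem_nhd a⟩, by fun_prop⟩

theorem toNhd_incl : c.toNhd ≫ incl c.nhd = f := rfl

/-- The collar homotopy does not increase `ρ`, so it stays in the neighbourhood and deforms it into
the subspace. The end map takes values in the range of the embedding `f`, hence gives a continuous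
retraction. -/
theorem quasiIso_toNhd : QuasiIso (singChains.map c.toNhd) := by
  choose r hr using fun x : c.nhd => c.h_one x.1 x.2
  have hrc : Continuous r := c.isClosedEmbedding.isInducing.continuous_iff.2 (by
    have : f ∘ r = fun x : c.nhd => c.h (1, x.1) := funext hr
    rw [this]
    fun_prop)
  let r' : TopCat.of c.nhd ⟶ A := ofHom ⟨r, hrc⟩
  have h₁ : c.toNhd ≫ r' = 𝟙 A := by
    ext a
    refine c.isClosedEmbedding.injective ?_
    exact (hr _).trans (c.h_apply _ _)
  refine quasiIso_singChains_of_homotopy c.toNhd r' ?_ ?_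
  · rw [h₁]
    exact ContinuousMap.Homotopy.refl _
  · refine ContinuousMap.Homotopy.symm
      ⟨⟨fun p => ⟨c.h (p.1, p.2.1), (c.ρ_h_le _ _).trans_lt p.2.2⟩, by fun_prop⟩, ?_, ?_⟩
    · intro x
      exact Subtype.ext (c.h_zero _)
    · intro x
      exact Subtype.ext (hr x).symm

theorem mono_singChains_incl (S : Set B) : Mono (singChains.map (incl S)) :=
  SingularChain.mono_map_of_injective _ Subtype.val_injective

/-- The inclusion of a subspace into a larger subspace. -/
def inclusion {B : TopCat.{u}} (S S' : Set B) (h : S ⊆ S') : TopCat.of S ⟶ TopCat.of S' :=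
  ofHom ⟨Set.inclusion h, continuous_inclusion h⟩

theorem mono_singChains_inclusion {B : TopCat.{u}} (S S' : Set B) (h : S ⊆ S') :
    Mono (singChains.map (inclusion S S' h)) :=
  SingularChain.mono_map_of_injective _ (Set.inclusion_injective h)

end Collar

end TopCat

/-- The map on the relative singular chains induced by a commutative square. -/
noncomputable abbrev relChainsMap {A B X Y : TopCat.{u}} {i : A ⟶ B} {j : X ⟶ Y} {p : A ⟶ X}
    {q : B ⟶ Y} (w : i ≫ q = p ≫ j) :
    cokernel (singChains.map i) ⟶ cokernel (singChains.map j) :=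
  cokernel.map _ _ (singChains.map p) (singChains.map q)
    (by rw [← Functor.map_comp, w, Functor.map_comp])

theorem relChainsMap_comp {A B X Y Z W : TopCat.{u}} {i : A ⟶ B} {j : X ⟶ Y} {k : Z ⟶ W}
    {p : A ⟶ X} {q : B ⟶ Y} {p' : X ⟶ Z} {q' : Y ⟶ W} (w : i ≫ q = p ≫ j)
    (w' : j ≫ q' = p' ≫ k) (w'' : i ≫ q ≫ q' = (p ≫ p') ≫ k) :
    relChainsMap w ≫ relChainsMap w' = relChainsMap w'' := by
  refine (cancel_epi (cokernel.π (singChains.map i))).1 ?_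
  dsimp only [relChainsMap]
  rw [cokernel.π_desc_assoc, Category.assoc, cokernel.π_desc, cokernel.π_desc, Functor.map_comp,
    Category.assoc]

/-- In a commutative square of maps of pairs with two opposite sides inducing quasi-isomorphisms,
the third side induces a quasi-isomorphism if the fourth does. -/
theorem quasiIso_relChainsMap_iff {A B A₁ B₁ A₂ B₂ A₃ B₃ : TopCat.{u}} {i : A ⟶ B} {i₁ : A₁ ⟶ B₁}
    {i₂ : A₂ ⟶ B₂} {i₃ : A₃ ⟶ B₃} {p : A ⟶ A₁} {q : B ⟶ B₁} {p' : A₂ ⟶ A₃} {q' : B₂ ⟶ B₃}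
    {r : A ⟶ A₂} {s : B ⟶ B₂} {r' : A₁ ⟶ A₃} {s' : B₁ ⟶ B₃} (w : i ≫ q = p ≫ i₁)
    (w' : i₂ ≫ q' = p' ≫ i₃) (v : i ≫ s = r ≫ i₂) (v' : i₁ ≫ s' = r' ≫ i₃)
    (h₁ : p ≫ r' = r ≫ p') (h₂ : q ≫ s' = s ≫ q') (hw : QuasiIso (relChainsMap w))
    (hw' : QuasiIso (relChainsMap w')) :
    QuasiIso (relChainsMap v) ↔ QuasiIso (relChainsMap v') := by
  have e₁ : i ≫ q ≫ s' = (p ≫ r') ≫ i₃ := by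
    rw [reassoc_of% w, v', Category.assoc]
  have e₂ : i ≫ s ≫ q' = (r ≫ p') ≫ i₃ := by
    rw [reassoc_of% v, w', Category.assoc]
  have e : relChainsMap w ≫ relChainsMap v' = relChainsMap v ≫ relChainsMap w' := by
    rw [relChainsMap_comp w v' e₁, relChainsMap_comp v w' e₂]
    congr 2
  rw [← quasiIso_iff_comp_left (relChainsMap w) (relChainsMap v'), e, quasiIso_iff_comp_right]

theorem quasiIso_relChainsMap_of_isIso {A B X Y : TopCat.{u}} {i : A ⟶ B} {j : X ⟶ Y} {p : A ⟶ X}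
    {q : B ⟶ Y} (w : i ≫ q = p ≫ j) [Mono (singChains.map i)] [Mono (singChains.map j)]
    [IsIso p] [IsIso q] : QuasiIso (relChainsMap w) :=
  ChainComplex.quasiIso_cokernelMap _ inferInstance inferInstance

namespace TopCat.Collar

variable {A B : TopCat.{u}} {f : A ⟶ B} (c : Collar f)

/-- Replaces the subspace by its neighbourhood in the pair, by the five lemma. -/
theorem quasiIso_nhd : QuasiIso (relChainsMap (i := f) (j := incl c.nhd) (p := c.toNhd)
    (q := 𝟙 B) (by rw [c.toNhd_incl, Category.comp_id])) := by
  have := SingularChain.mono_map_of_injective f c.isClosedEmbedding.injective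
  have := mono_singChains_incl c.nhd
  refine ChainComplex.quasiIso_cokernelMap _ c.quasiIso_toNhd ?_
  rw [CategoryTheory.Functor.map_id]
  infer_instance

/-- The part of the neighbourhood away from the subspace. -/
def rim : Set B := c.nhd ∩ c.away

/-- Excises the subspace itself: it is closed with complement `away`, and it lies in the open set
`nhd`. -/
theorem quasiIso_excision : QuasiIso (relChainsMap
    (i := inclusion c.rim c.away Set.inter_subset_right) (j := incl c.nhd)
    (p := inclusion c.rim c.nhd Set.inter_subset_left) (q := incl c.away) rfl) := by
  have h := SingularChain.excision (i := inclusion c.rim c.away Set.inter_subset_right)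
    (j := incl c.nhd) (p := inclusion c.rim c.nhd Set.inter_subset_left) (q := incl c.away) rfl
    c.isOpen_away.isOpenEmbedding_subtypeVal c.isOpen_nhd.isOpenEmbedding_subtypeVal
    (IsEmbedding.inclusion (t := c.away) Set.inter_subset_right)
  refine h ?_ ?_
  · change Set.range Subtype.val ∪ Set.range Subtype.val = _
    rw [Subtype.range_val, Subtype.range_val, Set.union_comm]
    exact c.nhd_union_away
  · change Set.range Subtype.val = Set.range Subtype.val ∩ Set.range Subtype.val
    rw [Subtype.range_val, Subtype.range_val, Subtype.range_val, Set.inter_comm]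
    rfl

variable {X Y : TopCat.{u}} {t : A ⟶ X} {g : X ⟶ Y} {b : B ⟶ Y}

/-- Off the subspace nothing is identified and nothing comes from `X`. An open set there has open
image, since its preimage under `b` is itself and its preimage under `g` is empty. -/
theorem isIso_restrict (c : Collar f) (sq : IsPushout t f g b) (S : Set B) (hS : IsOpen S)
    (hS' : S ⊆ c.away) (S' : Set Y) (h : ∀ x ∈ S, b x ∈ S')
    (h' : ∀ y ∈ S', ∃ x ∈ S, b x = y) : IsIso (restrict b S S' h) := by
  have hcont : Continuous (restrict b S S' h) := (restrict b S S' h).hom.continuous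
  refine (TopCat.isIso_iff_isHomeomorph _).2 ⟨hcont, ?_, ?_, ?_⟩
  · intro W hW
    obtain ⟨W', hW', rfl⟩ := isOpen_induced_iff.1 hW
    have hb : IsOpen (b '' (W' ∩ S)) := by
      rw [isOpen_iff_of_isPushout sq]
      have h1 : b ⁻¹' (b '' (W' ∩ S)) = W' ∩ S := by
        refine subset_antisymm ?_ (Set.subset_preimage_image _ _)
        rintro y ⟨x, hx, hxy⟩
        rwa [← eq_of_isPushout sq (c.notMem_range_of_mem_away (hS' hx.2)) hxy]
      have h2 : g ⁻¹' (b '' (W' ∩ S)) = ∅ := by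
        refine Set.eq_empty_of_forall_notMem ?_
        rintro y ⟨x, hx, hxy⟩
        obtain ⟨a, ha, -⟩ := (eq_iff_of_isPushout sq c.isClosedEmbedding.injective _ _).1 hxy
        exact c.notMem_range_of_mem_away (hS' hx.2) ⟨a, ha⟩
      rw [h1, h2]
      exact ⟨isOpen_empty, hW'.inter hS⟩
    refine isOpen_induced_iff.2 ⟨_, hb, ?_⟩
    ext ⟨y, hy⟩
    constructor
    · rintro ⟨x, hx, hxy⟩
      exact ⟨⟨x, hx.2⟩, hx.1, Subtype.ext hxy⟩
    · rintro ⟨x, hx, hxy⟩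
      exact ⟨x, ⟨hx, x.2⟩, congrArg Subtype.val hxy⟩
  · intro x y hxy
    exact Subtype.ext (eq_of_isPushout sq (c.notMem_range_of_mem_away (hS' x.2))
      (congrArg Subtype.val hxy))
  · rintro ⟨y, hy⟩
    obtain ⟨x, hx, rfl⟩ := h' y hy
    exact ⟨⟨x, hx⟩, rfl⟩

/-- The pairs are joined by (B, A) → (B, nhd) ← (away, rim), and likewise for (Y, X) with the collar
induced on the pushout. The outer pairs (away, rim) are homeomorphic, and every arrow induces a
quasi-isomorphism on relative chains. -/
theorem quasiIso_of_isPushout (c : Collar f) (sq : IsPushout t f g b) :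
    QuasiIso (relChainsMap sq.w.symm) := by
  obtain ⟨c', hc'⟩ := c.exists_of_isPushout sq
  have hn : ∀ x ∈ c.nhd, b x ∈ c'.nhd := fun x hx => (hc' x).trans_lt hx
  have ha : ∀ x ∈ c.away, b x ∈ c'.away := fun x hx => hx.trans_eq (hc' x).symm
  have ha' : ∀ y ∈ c'.away, ∃ x ∈ c.away, b x = y := fun y hy => by
    rcases eq_or_eq_of_isPushout sq y with ⟨x, rfl⟩ | ⟨x, rfl, hx⟩
    · exact absurd ⟨x, rfl⟩ (c'.notMem_range_of_mem_away hy)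
    · exact ⟨x, hy.trans_eq (hc' x), rfl⟩
  have i₁ : IsIso (restrict b c.away c'.away ha) :=
    c.isIso_restrict sq _ c.isOpen_away le_rfl _ _ ha'
  have hr : ∀ x ∈ c.rim, b x ∈ c'.rim := fun x hx => ⟨hn x hx.1, ha x hx.2⟩
  have i₂ : IsIso (restrict b c.rim c'.rim hr) := by
    refine c.isIso_restrict sq _ (c.isOpen_nhd.inter c.isOpen_away) Set.inter_subset_right _ _ ?_
    rintro y ⟨hy₁, hy₂⟩
    obtain ⟨x, hx, rfl⟩ := ha' y hy₂
    exact ⟨x, ⟨(hc' x).symm.trans_lt hy₁, hx⟩, rfl⟩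
  have m₁ := mono_singChains_inclusion c.rim c.away Set.inter_subset_right
  have m₂ := mono_singChains_inclusion c'.rim c'.away Set.inter_subset_right
  have q₁ : QuasiIso (relChainsMap (i := inclusion c.rim c.away Set.inter_subset_right)
      (j := inclusion c'.rim c'.away Set.inter_subset_right)
      (p := restrict b _ _ hr) (q := restrict b _ _ ha) rfl) :=
    quasiIso_relChainsMap_of_isIso _
  have q₂ : QuasiIso (relChainsMap (i := incl c.nhd) (j := incl c'.nhd)
      (p := restrict b _ _ hn) (q := b) rfl) := by
    refine (quasiIso_relChainsMap_iff _ _ _ _ ?_ ?_ c.quasiIso_excision c'.quasiIso_excision).1 q₁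
    · rfl
    · rfl
  refine (quasiIso_relChainsMap_iff _ _ _ _ ?_ ?_ c.quasiIso_nhd c'.quasiIso_nhd).2 q₂
  swap
  · rw [Category.id_comp, Category.comp_id]
  refine TopCat.hom_ext (ContinuousMap.ext fun a => Subtype.ext ?_)
  exact (ConcreteCategory.congr_hom sq.w a).symm

end TopCat.Collar

end

section

open Simplicial Opposite AffineSimplex Topology

/-! ### Points of the geometric realization -/

namespace SSet

variable {X Y : SSet.{u}}

/-- The point of the realization given by a simplex and a point of the standard simplex. -/
noncomputable def point {n : ℕ} (x : X _⦋n⦌) (p : Δ n) : SSet.toTop.obj X :=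
  SSet.toTop.map (yonedaEquiv.symm x) ((SimplexCategory.toTopHomeo ⦋n⦌).symm p)

theorem continuous_point {n : ℕ} (x : X _⦋n⦌) : Continuous (point x) :=
  (SSet.toTop.map (yonedaEquiv.symm x)).hom.continuous.comp
    (SimplexCategory.toTopHomeo ⦋n⦌).symm.continuous

theorem map_point (f : X ⟶ Y) {n : ℕ} (x : X _⦋n⦌) (p : Δ n) :
    SSet.toTop.map f (point x p) = point (f.app _ x) p := by
  rw [point, point, ← yonedaEquiv_symm_comp, Functor.map_comp]
  rfl

theorem point_map {m n : ℕ} (x : X _⦋n⦌) (φ : ⦋m⦌ ⟶ ⦋n⦌) (p : Δ m) :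
    point (X.map φ.op x) p = point x (stdSimplex.map φ p) := by
  rw [point, ← yonedaEquiv_symm_naturality_left, Functor.map_comp]
  exact congrArg (SSet.toTop.map (yonedaEquiv.symm x))
    (SimplexCategory.toTopHomeo_symm_naturality_apply φ p).symm

/-- The predicate of being such a point and the constant `True` are maps to an indiscrete space. By
the adjunction they are equal once they agree on each simplex, where this is clear. -/
theorem exists_point (q : SSet.toTop.obj X) : ∃ (n : ℕ) (x : X _⦋n⦌) (p : Δ n), q = point x p := by
  let : TopologicalSpace (ULift.{u} Prop) := ⊤
  let F : SSet.toTop.obj X ⟶ TopCat.of (ULift.{u} Prop) :=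
    TopCat.ofHom ⟨fun _ => ⟨True⟩, continuous_top⟩
  let F' : SSet.toTop.obj X ⟶ TopCat.of (ULift.{u} Prop) :=
    TopCat.ofHom ⟨fun q => ⟨∃ (n : ℕ) (x : X _⦋n⦌) (p : Δ n), q = point x p⟩, continuous_top⟩
  suffices F = F' by
    have h := congrArg ULift.down (ConcreteCategory.congr_hom this q)
    exact h.mp trivial
  refine (sSetTopAdj.homEquiv _ _).injective (NatTrans.ext (funext fun ⟨n⟩ => ?_))
  induction n using SimplexCategory.rec with | _ n
  refine ConcreteCategory.hom_ext _ _ fun x => ?_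
  refine yonedaEquiv.symm.injective ?_
  refine (yonedaEquiv_symm_comp _ _).symm.trans (Eq.trans ?_ (yonedaEquiv_symm_comp _ _))
  rw [← Adjunction.homEquiv_naturality_left, ← Adjunction.homEquiv_naturality_left]
  congr 1
  refine TopCat.hom_ext (ContinuousMap.ext fun p => congrArg ULift.up ?_)
  refine (eq_true ⟨n, x, SimplexCategory.toTopHomeo ⦋n⦌ p, ?_⟩).symm
  rw [point]
  exact congrArg _ (Homeomorph.symm_apply_apply _ _).symm

/-- Descent on dimension: a vanishing coordinate allows passing to a face, a degenerate simplex to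
one of lower dimension. In dimension 0 the only coordinate is 1. -/
theorem exists_point_nonDegenerate (q : SSet.toTop.obj X) :
    ∃ (n : ℕ) (x : X _⦋n⦌) (p : Δ n), x ∈ X.nonDegenerate n ∧ (∀ i, 0 < p i) ∧ q = point x p := by
  obtain ⟨n, x, p, rfl⟩ := exists_point q
  induction n using Nat.strong_induction_on with
  | _ n ih =>
    by_cases hx : x ∈ X.nonDegenerate n
    · by_cases hp : ∀ i, 0 < p i
      · exact ⟨n, x, p, hx, hp, rfl⟩
      · push Not at hp
        obtain ⟨i, hi⟩ := hp
        replace hi : p i = 0 := le_antisymm hi (stdSimplex.zero_le p i)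
        cases n with
        | zero =>
          have h := stdSimplex.sum_eq_one p
          rw [Fin.sum_univ_one, ← Fin.eq_zero i, hi] at h
          exact absurd h zero_ne_one
        | succ n =>
          let p' : Δ n := ⟨fun j => p (i.succAbove j), fun j => stdSimplex.zero_le p _, by
            have h := stdSimplex.sum_eq_one p
            rwa [Fin.sum_univ_succAbove _ i, hi, zero_add] at h⟩
          have hp' : stdSimplex.map i.succAbove p' = p := by
            rw [map_eq_aff]
            refine _root_.stdSimplex.ext (funext fun a => ?_)
            rw [aff_apply]
            induction a using Fin.succAboveCases i with
            | x => simp [hi]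
            | p j =>
              simp only [stdSimplex.vertex_coe, Pi.single_apply, Fin.succAbove_right_inj,
                mul_ite, mul_one, mul_zero, Finset.sum_ite_eq, Finset.mem_univ, if_true]
              rfl
          obtain ⟨m, y, v, hy, hv, h⟩ := ih n n.lt_succ_self (X.map (SimplexCategory.δ i).op x) p'
          refine ⟨m, y, v, hy, hv, ?_⟩
          rw [← h, point_map]
          exact congrArg _ hp'.symm
    · rw [← mem_degenerate_iff_notMem_nonDegenerate, mem_degenerate_iff] at hx
      obtain ⟨m, hm, φ, -, y, rfl⟩ := hx
      rw [point_map]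
      exact ih m hm y _

theorem compactSpace_toTop [X.Finite] : CompactSpace (SSet.toTop.obj X) := by
  have h : (Set.univ : Set (SSet.toTop.obj X)) = ⋃ s : X.N, Set.range (point s.simplex) := by
    refine (Set.eq_univ_of_forall fun q => ?_).symm
    obtain ⟨n, x, p, hx, -, rfl⟩ := exists_point_nonDegenerate q
    exact Set.mem_iUnion.2 ⟨N.mk x hx, p, rfl⟩
  refine ⟨?_⟩
  rw [h]
  exact isCompact_iUnion fun s => isCompact_range (continuous_point _)

theorem toTopHomeo_point {n k : ℕ} (s : (Δ[n] : SSet.{u}) _⦋k⦌) (p : Δ k) :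
    SimplexCategory.toTopHomeo ⦋n⦌ (point s p) = stdSimplex.map s p := by
  refine (SimplexCategory.toTopHomeo_naturality_apply (stdSimplex.objEquiv s) _).trans ?_
  exact congrArg _ (Homeomorph.apply_symm_apply _ _)

theorem map_apply_of_injective {k n : ℕ} {f : Fin (k + 1) → Fin (n + 1)}
    (hf : Function.Injective f) (p : Δ k) (i : Fin (k + 1)) :
    stdSimplex.map f p (f i) = p i := by
  rw [map_eq_aff, aff_apply, Finset.sum_eq_single i]
  · simp
  · intro j _ hj
    simp [hf.ne hj.symm]
  · simp

theorem map_apply_of_notMem {k n : ℕ} {f : Fin (k + 1) → Fin (n + 1)} (p : Δ k) {a : Fin (n + 1)}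
    (ha : a ∉ Set.range f) : stdSimplex.map f p a = 0 := by
  rw [map_eq_aff, aff_apply]
  refine Finset.sum_eq_zero fun j _ => ?_
  have : a ≠ f j := fun h => ha ⟨j, h.symm⟩
  simp [this]

/-- A nondegenerate simplex of Δ[n] is a strictly increasing map, and its range is the support of
the barycentric coordinates of any interior point of it. Hence simplex and interior point are both
recovered from the image in the standard simplex. -/
theorem injective_toTop_map_subcomplex {n : ℕ} (A : (Δ[n] : SSet.{u}).Subcomplex) :
    Function.Injective (SSet.toTop.map A.ι) := by
  intro q q' h
  obtain ⟨k, x, p, hx, hp, rfl⟩ := exists_point_nonDegenerate q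
  obtain ⟨k', x', p', hx', hp', rfl⟩ := exists_point_nonDegenerate q'
  obtain ⟨s, hs⟩ := x
  obtain ⟨s', hs'⟩ := x'
  replace hx := (stdSimplex.mem_nonDegenerate_iff_strictMono s).1
    ((Subcomplex.mem_nonDegenerate_iff A _).1 hx)
  replace hx' := (stdSimplex.mem_nonDegenerate_iff_strictMono s').1
    ((Subcomplex.mem_nonDegenerate_iff A _).1 hx')
  replace h : point s p = point s' p' :=
    ((map_point A.ι _ p).symm.trans h).trans (map_point A.ι _ p')
  replace h : stdSimplex.map s p = stdSimplex.map s' p' := by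
    rw [← toTopHomeo_point, h, toTopHomeo_point]
  have hr : Set.range s = Set.range s' := by
    refine subset_antisymm ?_ ?_
    · rintro _ ⟨i, rfl⟩
      by_contra hi
      have h1 := map_apply_of_injective hx.injective p i
      rw [h, map_apply_of_notMem _ hi] at h1
      exact (hp i).ne h1
    · rintro _ ⟨i, rfl⟩
      by_contra hi
      have h1 := map_apply_of_injective hx'.injective p' i
      rw [← h, map_apply_of_notMem _ hi] at h1
      exact (hp' i).ne h1
  obtain rfl : k = k' := by
    have h1 := congrArg Set.ncard hr
    rw [← Set.image_univ, ← Set.image_univ, Set.ncard_image_of_injective _ hx.injective,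
      Set.ncard_image_of_injective _ hx'.injective] at h1
    simpa using h1
  have hss : (s : Fin (k + 1) → Fin (n + 1)) = s' := hx.range_inj hx' |>.1 hr
  obtain rfl : s = s' := stdSimplex.ext _ _ (fun i => congrFun hss i)
  congr 1
  refine _root_.stdSimplex.ext (funext fun i => ?_)
  rw [← map_apply_of_injective hx.injective p i, h, map_apply_of_injective hx.injective p' i]

/-- A continuous injection from a compact space to a Hausdorff space. -/
theorem isClosedEmbedding_toTop_map_subcomplex {n : ℕ} (A : (Δ[n] : SSet.{u}).Subcomplex) :
    IsClosedEmbedding (SSet.toTop.map A.ι) := by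
  have : CompactSpace (SSet.toTop.obj (A : SSet.{u})) := compactSpace_toTop
  have : T2Space (SSet.toTop.obj (Δ[n] : SSet.{u})) :=
    (SimplexCategory.toTopHomeo ⦋n⦌).isEmbedding.t2Space
  exact (SSet.toTop.map A.ι).hom.continuous.isClosedEmbedding (injective_toTop_map_subcomplex A)

theorem mem_range_toTop_map_boundary_iff {n : ℕ} (q : SSet.toTop.obj (Δ[n] : SSet.{u})) :
    q ∈ Set.range (SSet.toTop.map (boundary.{u} n).ι) ↔
      ∃ i, SimplexCategory.toTopHomeo ⦋n⦌ q i = 0 := by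
  constructor
  · rintro ⟨q, rfl⟩
    obtain ⟨k, ⟨s, hs⟩, p, rfl⟩ := exists_point q
    obtain ⟨j, hj⟩ := (mem_boundary_iff_notMem_range s).1 hs
    have h : SSet.toTop.map (boundary.{u} n).ι (point _ p) = point s p :=
      map_point (boundary.{u} n).ι ⟨s, hs⟩ p
    refine ⟨j, ?_⟩
    rw [h, toTopHomeo_point]
    exact map_apply_of_notMem p hj
  · rintro ⟨i, hi⟩
    obtain ⟨k, s, p, hs, hp, rfl⟩ := exists_point_nonDegenerate q
    rw [stdSimplex.mem_nonDegenerate_iff_strictMono] at hs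
    have h : s ∈ (boundary.{u} n).obj (op ⦋k⦌) := by
      rw [mem_boundary_iff_notMem_range]
      refine ⟨i, ?_⟩
      rintro ⟨j, rfl⟩
      rw [toTopHomeo_point, map_apply_of_injective hs.injective] at hi
      exact (hp j).ne' hi
    refine ⟨point (X := (boundary.{u} n : SSet.{u})) ⟨s, h⟩ p, ?_⟩
    exact map_point (boundary.{u} n).ι ⟨s, h⟩ p

end SSet

end

section

open Limits Simplicial AffineSimplex Topology

/-! ### The collar of the boundary of a simplex -/

namespace AffineSimplex

variable {n : ℕ}

/-- The smallest barycentric coordinate. -/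
noncomputable def minCoord (p : Δ n) : ℝ :=
  Finset.univ.inf' Finset.univ_nonempty fun i => p i

theorem continuous_coord (i : Fin (n + 1)) : Continuous fun p : Δ n => p i :=
  (continuous_apply i).comp continuous_subtype_val

theorem continuous_minCoord : Continuous (minCoord (n := n)) :=
  Continuous.finset_inf'_apply _ fun i _ => continuous_coord i

theorem minCoord_le (p : Δ n) (i : Fin (n + 1)) : minCoord p ≤ p i :=
  Finset.inf'_le _ (Finset.mem_univ i)

theorem exists_minCoord (p : Δ n) : ∃ i, minCoord p = p i := by
  obtain ⟨i, -, hi⟩ := Finset.exists_mem_eq_inf' Finset.univ_nonempty fun i => p i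
  exact ⟨i, hi⟩

theorem minCoord_nonneg (p : Δ n) : 0 ≤ minCoord p := by
  obtain ⟨i, hi⟩ := exists_minCoord p
  exact hi ▸ stdSimplex.zero_le p i

theorem minCoord_eq_zero_iff (p : Δ n) : minCoord p = 0 ↔ ∃ i, p i = 0 := by
  refine ⟨fun h => ?_, ?_⟩
  · obtain ⟨i, hi⟩ := exists_minCoord p
    exact ⟨i, hi ▸ h⟩
  · rintro ⟨i, hi⟩
    exact le_antisymm (hi ▸ minCoord_le p i) (minCoord_nonneg p)

theorem mul_minCoord_le_one (p : Δ n) : (n + 1 : ℝ) * minCoord p ≤ 1 := by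
  rw [← stdSimplex.sum_eq_one p]
  refine le_trans (le_of_eq ?_) (Finset.card_nsmul_le_sum _ _ _ fun i _ => minCoord_le p i)
  simp

/-- The amount subtracted from all the coordinates in the deformation towards the boundary. -/
noncomputable def shrinkage (s : unitInterval) (p : Δ n) : ℝ :=
  s * min (minCoord p) (1 / (2 * (n + 1)))

theorem shrinkage_nonneg (s : unitInterval) (p : Δ n) : 0 ≤ shrinkage s p :=
  mul_nonneg s.2.1 (le_min (minCoord_nonneg p) (by positivity))

theorem shrinkage_le (s : unitInterval) (p : Δ n) : shrinkage s p ≤ minCoord p :=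
  (mul_le_of_le_one_left (le_min (minCoord_nonneg p) (by positivity)) s.2.2).trans (min_le_left _ _)

/-- This is the purpose of the cap 1/(2(n + 1)): the normalising denominator of `deform` stays at
least 1/2, whereas without the cap it would vanish at the barycenter for s = 1. -/
theorem mul_shrinkage_le (s : unitInterval) (p : Δ n) : (n + 1 : ℝ) * shrinkage s p ≤ 1 / 2 := by
  have h : shrinkage s p ≤ 1 / (2 * (n + 1)) :=
    (mul_le_of_le_one_left (le_min (minCoord_nonneg p) (by positivity)) s.2.2).trans
      (min_le_right _ _)
  refine (mul_le_mul_of_nonneg_left h (by positivity)).trans_eq ?_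
  field_simp

theorem denom_pos (s : unitInterval) (p : Δ n) : 0 < 1 - (n + 1 : ℝ) * shrinkage s p := by
  linarith [mul_shrinkage_le s p]

/-- The deformation of the simplex towards its boundary. -/
noncomputable def deform (s : unitInterval) (p : Δ n) : Δ n :=
  ⟨fun i => (p i - shrinkage s p) / (1 - (n + 1 : ℝ) * shrinkage s p), fun i =>
    div_nonneg (sub_nonneg.2 ((shrinkage_le s p).trans (minCoord_le p i))) (denom_pos s p).le, by
    rw [← Finset.sum_div, Finset.sum_sub_distrib, stdSimplex.sum_eq_one, Finset.sum_const,
      Finset.card_univ, Fintype.card_fin, nsmul_eq_mul, Nat.cast_add_one]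
    exact div_self (denom_pos s p).ne'⟩

theorem deform_apply (s : unitInterval) (p : Δ n) (i : Fin (n + 1)) :
    deform s p i = (p i - shrinkage s p) / (1 - (n + 1 : ℝ) * shrinkage s p) := rfl

theorem continuous_deform : Continuous fun q : unitInterval × Δ n => deform q.1 q.2 := by
  have h : Continuous fun q : unitInterval × Δ n => shrinkage q.1 q.2 :=
    (continuous_subtype_val.comp continuous_fst).mul
      ((continuous_minCoord.comp continuous_snd).min continuous_const)
  refine Continuous.subtype_mk (continuous_pi fun i => ?_) _
  exact (((continuous_coord i).comp continuous_snd).sub h).div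
    (continuous_const.sub (continuous_const.mul h)) fun q => (denom_pos _ _).ne'

theorem deform_of_shrinkage_eq_zero {s : unitInterval} {p : Δ n} (h : shrinkage s p = 0) :
    deform s p = p := by
  refine stdSimplex.ext (funext fun i => ?_)
  rw [deform_apply, h, mul_zero, sub_zero, sub_zero, div_one]

theorem deform_zero (p : Δ n) : deform 0 p = p :=
  deform_of_shrinkage_eq_zero (by simp [shrinkage])

theorem deform_of_minCoord_eq_zero (s : unitInterval) {p : Δ n} (h : minCoord p = 0) :
    deform s p = p :=
  deform_of_shrinkage_eq_zero (le_antisymm (h ▸ shrinkage_le s p) (shrinkage_nonneg s p))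

/-- For m the smallest coordinate and σ the shrinkage, (m - σ)/(1 - (n + 1)σ) ≤ m amounts to (n +
1)mσ ≤ σ, which holds as (n + 1)m ≤ 1. -/
theorem minCoord_deform_le (s : unitInterval) (p : Δ n) : minCoord (deform s p) ≤ minCoord p := by
  obtain ⟨i, hi⟩ := exists_minCoord p
  refine (minCoord_le _ i).trans ?_
  rw [deform_apply, ← hi, div_le_iff₀ (denom_pos s p)]
  nlinarith [mul_le_mul_of_nonneg_right (mul_minCoord_le_one p) (shrinkage_nonneg s p)]

/-- In this range the cap is not reached, so at time 1 the smallest coordinate is subtracted in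
full. -/
theorem minCoord_deform_one {p : Δ n} (h : (n + 1 : ℝ) * minCoord p < 1 / 2) :
    minCoord (deform 1 p) = 0 := by
  have h1 : minCoord p ≤ 1 / (2 * (n + 1)) := by
    rw [le_div_iff₀ (by positivity)]
    linarith
  obtain ⟨i, hi⟩ := exists_minCoord p
  refine (minCoord_eq_zero_iff _).2 ⟨i, ?_⟩
  rw [deform_apply, shrinkage, min_eq_left h1, ← hi, Set.Icc.coe_one, one_mul, sub_self, zero_div]

end AffineSimplex

namespace TopCat.Collar

/-- The collar of the boundary of a simplex. -/
noncomputable def boundary (n : ℕ) : Collar (SSet.toTop.map (SSet.boundary.{u} n).ι) where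
  isClosedEmbedding := SSet.isClosedEmbedding_toTop_map_subcomplex _
  ρ := ⟨fun q => (n + 1) * minCoord (SimplexCategory.toTopHomeo ⦋n⦌ q),
    continuous_const.mul (continuous_minCoord.comp (SimplexCategory.toTopHomeo ⦋n⦌).continuous)⟩
  ρ_nonneg q := mul_nonneg (by positivity) (minCoord_nonneg _)
  ρ_eq_zero_iff q := by
    refine Iff.trans ?_ (SSet.mem_range_toTop_map_boundary_iff q).symm
    refine Iff.trans ?_ (minCoord_eq_zero_iff (SimplexCategory.toTopHomeo ⦋n⦌ q))
    exact mul_eq_zero_iff_left (by positivity)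
  h := ⟨fun q => (SimplexCategory.toTopHomeo ⦋n⦌).symm
      (deform q.1 (SimplexCategory.toTopHomeo ⦋n⦌ q.2)),
    (SimplexCategory.toTopHomeo ⦋n⦌).symm.continuous.comp (continuous_deform.comp
      (continuous_fst.prodMk
        ((SimplexCategory.toTopHomeo ⦋n⦌).continuous.comp continuous_snd)))⟩
  h_zero q := (congrArg _ (deform_zero _)).trans (Homeomorph.symm_apply_apply _ _)
  h_apply s a := (congrArg _ (deform_of_minCoord_eq_zero s ((minCoord_eq_zero_iff _).2
    ((SSet.mem_range_toTop_map_boundary_iff _).1 ⟨a, rfl⟩)))).trans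
      (Homeomorph.symm_apply_apply _ _)
  ρ_h_le s q := by
    refine mul_le_mul_of_nonneg_left ?_ (by positivity)
    refine (congrArg minCoord (Homeomorph.apply_symm_apply _ _)).trans_le ?_
    exact minCoord_deform_le _ _
  h_one q hq := by
    refine (SSet.mem_range_toTop_map_boundary_iff _).2 ((minCoord_eq_zero_iff _).1 ?_)
    exact (congrArg minCoord (Homeomorph.apply_symm_apply _ _)).trans (minCoord_deform_one hq)

end TopCat.Collar

/-! ### Coproducts -/

namespace TopCat

/-- A coproduct of topological spaces is homeomorphic to the disjoint union. -/
noncomputable def homeoOfCofan {S : Type u} {α : S → TopCat.{u}} {T : TopCat.{u}}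
    {inc : ∀ s, α s ⟶ T} (h : IsColimit (Cofan.mk T inc)) : (Σ s, α s) ≃ₜ T :=
  homeoOfIso ((sigmaCofanIsColimit α).coconePointUniqueUpToIso h)

theorem homeoOfCofan_apply {S : Type u} {α : S → TopCat.{u}} {T : TopCat.{u}}
    {inc : ∀ s, α s ⟶ T} (h : IsColimit (Cofan.mk T inc)) (s : S) (x : α s) :
    homeoOfCofan h ⟨s, x⟩ = inc s x :=
  ConcreteCategory.congr_hom
    ((sigmaCofanIsColimit α).comp_coconePointUniqueUpToIso_hom h ⟨s⟩) x

/-- The collar is transported to each summand of a disjoint union. The homotopy is again a map to a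
path space, so its continuity is checked summand by summand. -/
theorem Collar.nonempty_sigma {S : Type u} {A B A' B' : TopCat.{u}} {f : A ⟶ B} (c : Collar f)
    {i : S → (A ⟶ A')} {j : S → (B ⟶ B')} (hi : IsColimit (Cofan.mk A' i))
    (hj : IsColimit (Cofan.mk B' j)) {f' : A' ⟶ B'} (w : ∀ s, i s ≫ f' = f ≫ j s) :
    Nonempty (Collar f') := by
  let e := homeoOfCofan hi
  let e' := homeoOfCofan hj
  have hw : ∀ s a, f' (e ⟨s, a⟩) = e' ⟨s, f a⟩ := fun s a => by
    rw [homeoOfCofan_apply, homeoOfCofan_apply]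
    exact ConcreteCategory.congr_hom (w s) a
  have hr : ∀ s b, e' ⟨s, b⟩ ∈ Set.range f' ↔ b ∈ Set.range f := fun s b => by
    constructor
    · rintro ⟨a, ha⟩
      obtain ⟨⟨s', a⟩, rfl⟩ := e.surjective a
      rw [hw] at ha
      obtain ⟨rfl, h⟩ := Sigma.mk.inj_iff.1 (e'.injective ha)
      exact ⟨a, eq_of_heq h⟩
    · rintro ⟨a, rfl⟩
      exact ⟨_, hw s a⟩
  have hf : (f' : A' → B') = e' ∘ Sigma.map id (fun _ => f) ∘ e.symm := by
    funext a
    obtain ⟨⟨s, a⟩, rfl⟩ := e.surjective a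
    rw [hw, Function.comp_apply, Function.comp_apply, Homeomorph.symm_apply_apply]
    rfl
  let ρ : C(Σ _ : S, B, ℝ) := ⟨fun x => c.ρ x.2, continuous_sigma fun s => c.ρ.continuous⟩
  let k : C(Σ _ : S, B, C(unitInterval, Σ _ : S, B)) :=
    ⟨fun x => ⟨fun t => ⟨x.1, c.h (t, x.2)⟩, continuous_sigmaMk.comp (by fun_prop)⟩, continuous_sigma fun s =>
      (ContinuousMap.curry ⟨fun p : B × unitInterval => (⟨s, c.h (p.2, p.1)⟩ : Σ _ : S, B),
        continuous_sigmaMk.comp (by fun_prop)⟩).continuous⟩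
  have hk : ∀ s b t, k ⟨s, b⟩ t = ⟨s, c.h (t, b)⟩ := fun s b t => rfl
  have hρ : ∀ s b, ρ ⟨s, b⟩ = c.ρ b := fun s b => rfl
  refine ⟨⟨?_, ρ.comp e'.symm, fun y => ?_, fun y => ?_,
    ⟨fun p => e' (k (e'.symm p.2) p.1), ?_⟩, fun y => ?_, fun t x => ?_, fun t y => ?_,
    fun y hy => ?_⟩⟩
  · rw [hf]
    refine e'.isClosedEmbedding.comp (IsClosedEmbedding.comp ⟨?_, ?_⟩ e.symm.isClosedEmbedding)
    · exact (isEmbedding_sigmaMap Function.injective_id).2 fun _ => c.isClosedEmbedding.isEmbedding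
    · rw [isClosed_sigma_iff]
      intro s
      have : Sigma.mk (β := fun _ : S => B) s ⁻¹' Set.range (Sigma.map id fun _ : S => (f : A → B)) =
          Set.range f := by
        ext b
        constructor
        · rintro ⟨⟨s', a⟩, ha⟩
          obtain ⟨h₁, h⟩ := Sigma.mk.inj_iff.1 ha
          exact ⟨a, eq_of_heq h⟩
        · rintro ⟨a, rfl⟩
          exact ⟨⟨s, a⟩, rfl⟩
      rw [this]
      exact c.isClosedEmbedding.isClosed_range
  · exact c.ρ_nonneg _
  · obtain ⟨⟨s, b⟩, rfl⟩ := e'.surjective y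
    rw [hr, ← c.ρ_eq_zero_iff]
    change ρ (e'.symm (e' ⟨s, b⟩)) = 0 ↔ _
    rw [Homeomorph.symm_apply_apply, hρ]
  · have : Continuous fun p : unitInterval × B' => k (e'.symm p.2) p.1 := by fun_prop
    exact e'.continuous.comp this
  · obtain ⟨⟨s, b⟩, rfl⟩ := e'.surjective y
    change e' (k (e'.symm (e' ⟨s, b⟩)) 0) = _
    rw [Homeomorph.symm_apply_apply, hk, c.h_zero]
  · obtain ⟨⟨s, a⟩, rfl⟩ := e.surjective x
    rw [hw]
    change e' (k (e'.symm (e' ⟨s, f a⟩)) t) = _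
    rw [Homeomorph.symm_apply_apply, hk, c.h_apply]
  · obtain ⟨⟨s, b⟩, rfl⟩ := e'.surjective y
    change ρ (e'.symm (e' (k (e'.symm (e' ⟨s, b⟩)) t))) ≤ ρ (e'.symm (e' ⟨s, b⟩))
    rw [Homeomorph.symm_apply_apply, Homeomorph.symm_apply_apply, hk]
    exact c.ρ_h_le _ _
  · obtain ⟨⟨s, b⟩, rfl⟩ := e'.surjective y
    change ρ (e'.symm (e' ⟨s, b⟩)) < _ at hy
    rw [Homeomorph.symm_apply_apply] at hy
    change e' (k (e'.symm (e' ⟨s, b⟩)) 1) ∈ _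
    rw [Homeomorph.symm_apply_apply, hk, hr]
    exact c.h_one _ hy

end TopCat

end

section

open Limits Simplicial Opposite AffineSimplex Topology

/-! ### Simplicial chains and singular chains of the realization -/

namespace SSet

/-- The map from a simplicial set to the singular simplicial set of its realization induces a
quasi-isomorphism on chains. -/
def ChainsEquivSingular (X : SSet.{u}) : Prop :=
  QuasiIso (chains.map (sSetTopAdj.unit.app X))

/-- The map from simplicial chains to singular chains of the realization. -/
noncomputable abbrev chainsToSing (X : SSet.{u}) :
    chains.obj X ⟶ singChains.obj (SSet.toTop.obj X) :=
  chains.map (sSetTopAdj.unit.app X)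

theorem chainsToSing_naturality {X Y : SSet.{u}} (f : X ⟶ Y) :
    chains.map f ≫ chainsToSing Y = chainsToSing X ≫ singChains.map (SSet.toTop.map f) := by
  have h := congrArg chains.map (sSetTopAdj.unit.naturality f)
  rw [chains.map_comp, chains.map_comp] at h
  exact h

theorem chainsEquivSingular_iff_of_quasiIso {X Y : SSet.{u}} (f : X ⟶ Y)
    (h : QuasiIso (chains.map f)) (h' : QuasiIso (singChains.map (SSet.toTop.map f))) :
    X.ChainsEquivSingular ↔ Y.ChainsEquivSingular := by
  change QuasiIso (chainsToSing X) ↔ QuasiIso (chainsToSing Y)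
  rw [← quasiIso_iff_comp_left (chains.map f) (chainsToSing Y), chainsToSing_naturality,
    quasiIso_iff_comp_right]

theorem chainsEquivSingular_iff_of_iso {X Y : SSet.{u}} (e : X ≅ Y) :
    X.ChainsEquivSingular ↔ Y.ChainsEquivSingular :=
  chainsEquivSingular_iff_of_quasiIso e.hom inferInstance inferInstance

theorem chainsEquivSingular_of_isIso (X : SSet.{u}) (h : IsIso (sSetTopAdj.unit.app X)) :
    X.ChainsEquivSingular := by
  have : IsIso (chains.map (sSetTopAdj.unit.app X)) := inferInstance
  exact (inferInstance : QuasiIso (chains.map (sSetTopAdj.unit.app X)))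

section Pushout

variable {A B X Y : SSet.{u}} {t : A ⟶ X} {l : A ⟶ B} {r : X ⟶ Y} {b : B ⟶ Y}

theorem exists_chains_eq_add (sq : IsPushout t l r b) {n : ℕ} (y : (chains.obj Y).X n) :
    ∃ x k, y = ((chains.map b).f n).hom x + ((chains.map r).f n).hom k := by
  refine chains_induction (P := fun y => ∃ x k, y = ((chains.map b).f n).hom x +
    ((chains.map r).f n).hom k) ⟨0, 0, by simp⟩ ?_ ?_ (fun y => ?_) y
  · rintro _ _ ⟨x, k, rfl⟩ ⟨x', k', rfl⟩
    exact ⟨x + x', k + k', by rw [map_add, map_add]; abel⟩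
  · rintro _ ⟨x, k, rfl⟩
    exact ⟨-x, -k, by rw [map_neg, map_neg]; abel⟩
  · rcases Types.eq_or_eq_of_isPushout (sq.map ((evaluation _ _).obj (op ⦋n⦌))) y with
      ⟨x, rfl⟩ | ⟨x, rfl⟩
    · exact ⟨0, simplexChain x, by rw [map_zero, zero_add]; exact (chains_map_simplexChain r x).symm⟩
    · exact ⟨simplexChain x, 0, by rw [map_zero, add_zero]; exact (chains_map_simplexChain b x).symm⟩

/-- Simplices of `B` modulo chains from `A`, together with zero on `X`, glue to a function on the
simplices of the pushout. Its linear extension kills the chains from `X` and is the quotient map on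
chains from `B`. -/
theorem exists_chains_of_eq (sq : IsPushout t l r b) {n : ℕ} (x : (chains.obj B).X n)
    (hx : ∃ k, ((chains.map b).f n).hom x = ((chains.map r).f n).hom k) :
    ∃ k, x = ((chains.map l).f n).hom k := by
  let Q := (chains.obj B).X n ⧸ ((chains.map l).f n).hom.range
  let q : (chains.obj B).X n →+ Q := QuotientAddGroup.mk' _
  let sq' := sq.map ((evaluation _ _).obj (op ⦋n⦌))
  let p : B.obj (op ⦋n⦌) ⟶ Q := ↾fun y => q (simplexChain y)
  let z : X.obj (op ⦋n⦌) ⟶ Q := ↾fun _ => 0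
  have w : ((evaluation _ _).obj (op ⦋n⦌)).map t ≫ z = ((evaluation _ _).obj (op ⦋n⦌)).map l ≫ p :=
    ConcreteCategory.hom_ext _ _ fun a => by
      refine Eq.symm ((QuotientAddGroup.eq_zero_iff _).2 ?_)
      exact ⟨simplexChain a, chains_map_simplexChain l a⟩
  let ψ : (chains.obj Y).X n →+ Q := freeLift (α := Y.obj (op ⦋n⦌)) (sq'.desc z p w)
  have h₁ : ∀ k, ψ (((chains.map r).f n).hom k) = 0 := by
    suffices ψ.comp ((chains.map r).f n).hom = 0 from fun k => DFunLike.congr_fun this k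
    refine chains_hom_ext fun y => ?_
    refine (congrArg ψ (chains_map_simplexChain r y)).trans ?_
    refine (freeLift_single _ _).trans ?_
    exact ConcreteCategory.congr_hom (sq'.inl_desc z p w) y
  have h₂ : ∀ k, ψ (((chains.map b).f n).hom k) = q k := by
    suffices ψ.comp ((chains.map b).f n).hom = q from fun k => DFunLike.congr_fun this k
    refine chains_hom_ext fun y => ?_
    refine (congrArg ψ (chains_map_simplexChain b y)).trans ?_
    refine (freeLift_single _ _).trans ?_
    exact ConcreteCategory.congr_hom (sq'.inr_desc z p w) y
  obtain ⟨k, hk⟩ := hx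
  have h : q x = 0 := by rw [← h₂, hk, h₁]
  obtain ⟨k, hk⟩ := (QuotientAddGroup.eq_zero_iff _).1 h
  exact ⟨k, hk.symm⟩

/-- Excision for simplicial chains holds without subdivision: each simplex of `Y` comes from `B` or
from `X`, and a chain of `B` that comes from `X` already comes from `A`. -/
theorem quasiIso_relative_chains (sq : IsPushout t l r b) :
    QuasiIso (cokernel.map (chains.map l) (chains.map r) (chains.map t) (chains.map b)
      (by rw [← chains.map_comp, ← sq.w, chains.map_comp])) := by
  have w : ∀ {n : ℕ} k, ((chains.map b).f n).hom (((chains.map l).f n).hom k) =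
      ((chains.map r).f n).hom (((chains.map t).f n).hom k) := fun {n} k => by
    have h := congrArg (fun f => (HomologicalComplex.Hom.f (chains.map f) n).hom k) sq.w.symm
    simp only [chains.map_comp] at h
    exact h
  rw [ChainComplex.quasiIso_cokernelMap_iff]
  refine fun n => ⟨fun y hy => ?_, fun x hx => ?_⟩
  · obtain ⟨x, k, rfl⟩ := exists_chains_eq_add sq y
    refine ⟨x, fun j => exists_chains_of_eq sq _ ?_, 0, k, by rw [map_zero, add_zero]⟩
    obtain ⟨k', hk'⟩ := hy j
    refine ⟨k' - ((chains.obj X).d n j).hom k, ?_⟩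
    rw [map_sub, ← hk', map_add, ChainComplex.f_d_apply, ChainComplex.f_d_apply,
      add_sub_cancel_right]
  · rintro ⟨v, k, h⟩
    obtain ⟨v', k', rfl⟩ := exists_chains_eq_add sq v
    obtain ⟨k'', hk''⟩ := exists_chains_of_eq sq (x - ((chains.obj B).d (n + 1) n).hom v')
      ⟨((chains.obj X).d (n + 1) n).hom k' + k, by
        rw [map_sub, h, map_add, map_add, ChainComplex.f_d_apply, ChainComplex.f_d_apply]
        abel⟩
    exact ⟨v', k'', by rw [← hk'']; abel⟩

/-- The five lemma gives the relative comparison for (B, A). It agrees with that for (Y, X) under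
simplicial and singular excision, and the five lemma for the middle term passes from `X` to `Y`. -/
theorem chainsEquivSingular_of_isPushout (sq : IsPushout t l r b) [Mono l] [Mono r]
    (c : TopCat.Collar (SSet.toTop.map l)) (hA : A.ChainsEquivSingular)
    (hB : B.ChainsEquivSingular) (hX : X.ChainsEquivSingular) : Y.ChainsEquivSingular := by
  have sq' := sq.map SSet.toTop
  have inj : ∀ {Z Z' : SSet.{u}} (f : Z ⟶ Z') [Mono f] (n : ℕ),
      Function.Injective (f.app (op ⦋n⦌)) := fun f _ n =>
    (mono_iff_injective (f.app (op ⦋n⦌))).1 inferInstance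
  have m₁ : Mono (chains.map l) := mono_chains_map l (inj l)
  have m₂ : Mono (chains.map r) := mono_chains_map r (inj r)
  have m₃ : Mono (singChains.map (SSet.toTop.map l)) :=
    SingularChain.mono_map_of_injective _ c.isClosedEmbedding.injective
  have m₄ : Mono (singChains.map (SSet.toTop.map r)) :=
    SingularChain.mono_map_of_injective _
      (TopCat.isClosedEmbedding_of_isPushout sq' c.isClosedEmbedding).injective
  have q₁ := quasiIso_relative_chains sq
  have q₂ := c.quasiIso_of_isPushout sq'
  have q₃ := ChainComplex.quasiIso_cokernelMap (chainsToSing_naturality l) hA hB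
  refine ChainComplex.quasiIso_of_quasiIso_cokernelMap (chainsToSing_naturality r) hX ?_
  rw [← quasiIso_iff_comp_left (cokernel.map (chains.map l) (chains.map r) (chains.map t)
    (chains.map b) _)]
  have := quasiIso_comp (cokernel.map _ _ _ _ (chainsToSing_naturality l))
    (relChainsMap sq'.w.symm)
  convert this using 1
  refine (cancel_epi (cokernel.π (chains.map l))).1 ?_
  dsimp only [relChainsMap]
  rw [cokernel.π_desc_assoc, Category.assoc, cokernel.π_desc, cokernel.π_desc_assoc,
    Category.assoc, cokernel.π_desc, reassoc_of% (chainsToSing_naturality b)]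
  rfl

end Pushout

/-! ### Disjoint unions of simplices -/

/-- The functor taking the product with a fixed type. -/
def copiesFunctor (S : Type u) : Type u ⥤ Type u where
  obj Z := S × Z
  map f := ↾fun p => (p.1, f p.2)

/-- The disjoint union of copies of a simplicial set. -/
def copies (S : Type u) : SSet.{u} ⥤ SSet.{u} :=
  (SimplicialObject.whiskering _ _).obj (copiesFunctor S)

/-- The inclusion of a copy. -/
def copiesι {S : Type u} (s : S) (Z : SSet.{u}) : Z ⟶ (copies S).obj Z where
  app _ := ↾fun z => (s, z)

theorem copiesι_naturality {S : Type u} (s : S) {Z Z' : SSet.{u}} (f : Z ⟶ Z') :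
    copiesι s Z ≫ (copies S).map f = f ≫ copiesι s Z' := rfl

/-- A disjoint union of copies is a coproduct. -/
def copiesIsColimit (S : Type u) (Z : SSet.{u}) :
    IsColimit (Cofan.mk ((copies S).obj Z) fun s : S => copiesι s Z) :=
  Cofan.IsColimit.mk _
    (fun c => { app := fun n => ↾fun p => (c.inj p.1).app n p.2
                naturality := fun _ _ f => ConcreteCategory.hom_ext _ _ fun p =>
                  ConcreteCategory.congr_hom ((c.inj p.1).naturality f) p.2 })
    (fun _ _ => rfl)
    (fun _ _ h => NatTrans.ext (funext fun n => ConcreteCategory.hom_ext _ _ fun p =>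
      ConcreteCategory.congr_hom (NatTrans.congr_app (h p.1) n) p.2))

/-- The realization of a disjoint union of copies. -/
noncomputable def copiesHomeo (S : Type u) (Z : SSet.{u}) :
    (Σ _ : S, SSet.toTop.obj Z) ≃ₜ SSet.toTop.obj ((copies S).obj Z) :=
  TopCat.homeoOfCofan (isColimitCofanMkObjOfIsColimit SSet.toTop _ _ (copiesIsColimit S Z))

theorem copiesHomeo_apply {S : Type u} {Z : SSet.{u}} (s : S) (z : SSet.toTop.obj Z) :
    copiesHomeo S Z ⟨s, z⟩ = SSet.toTop.map (copiesι s Z) z :=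
  TopCat.homeoOfCofan_apply _ _ _

theorem map_copiesHomeo {S : Type u} {Z Z' : SSet.{u}} (f : Z ⟶ Z') (s : S)
    (z : SSet.toTop.obj Z) :
    SSet.toTop.map ((copies S).map f) (copiesHomeo S Z ⟨s, z⟩) =
      copiesHomeo S Z' ⟨s, SSet.toTop.map f z⟩ := by
  rw [copiesHomeo_apply, copiesHomeo_apply, ← TopCat.comp_app, ← TopCat.comp_app,
    ← Functor.map_comp, ← Functor.map_comp, copiesι_naturality]

/-- An extra degeneracy makes each augmentation a homotopy equivalence, so two out of three applies
to the naturality square of the augmentation. -/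
theorem quasiIso_of_augmented {X Y : SimplicialObject.Augmented AddCommGrpCat.{u}} (f : X ⟶ Y)
    (hX : SimplicialObject.Augmented.ExtraDegeneracy X)
    (hY : SimplicialObject.Augmented.ExtraDegeneracy Y) [IsIso f.right] :
    QuasiIso ((AlgebraicTopology.alternatingFaceMapComplex AddCommGrpCat.{u}).map f.left) := by
  have h := AlgebraicTopology.AlternatingFaceMapComplex.ε.naturality f
  have hX' : QuasiIso (AlgebraicTopology.AlternatingFaceMapComplex.ε.app X) :=
    hX.homotopyEquiv.quasiIso_hom
  have hY' : QuasiIso (AlgebraicTopology.AlternatingFaceMapComplex.ε.app Y) :=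
    hY.homotopyEquiv.quasiIso_hom
  have h₃ : IsIso ((SimplicialObject.Augmented.point ⋙
      ChainComplex.single₀ AddCommGrpCat.{u}).map f) :=
    inferInstanceAs (IsIso ((ChainComplex.single₀ AddCommGrpCat.{u}).map f.right))
  have h₄ := quasiIso_comp (AlgebraicTopology.AlternatingFaceMapComplex.ε.app X)
    ((SimplicialObject.Augmented.point ⋙ ChainComplex.single₀ _).map f)
  rw [← h] at h₄
  exact (quasiIso_iff_comp_right _ (AlgebraicTopology.AlternatingFaceMapComplex.ε.app Y)).1 h₄

theorem quasiIso_chains_copies (S : Type u) {m n : ℕ} (φ : ⦋m⦌ ⟶ ⦋n⦌) :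
    QuasiIso (chains.map ((copies S).map (stdSimplex.{u}.map φ))) := by
  let F : Type u ⥤ AddCommGrpCat.{u} := copiesFunctor S ⋙ freeAb
  let W := (SimplicialObject.Augmented.whiskering (Type u) AddCommGrpCat.{u}).obj F
  let f := W.map (SSet.Augmented.stdSimplex.{u}.map φ)
  have : IsIso f.right := by
    change IsIso (F.map (terminal.from (⊤_ (Type u))))
    rw [terminal.hom_ext (terminal.from (⊤_ (Type u))) (𝟙 _)]
    infer_instance
  exact quasiIso_of_augmented f ((SSet.Augmented.StandardSimplex.extraDegeneracy.{u} ⦋m⦌).map F)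
    ((SSet.Augmented.StandardSimplex.extraDegeneracy.{u} ⦋n⦌).map F)

end SSet

end

/-! ### Realizations of disjoint unions of simplices, and skeletal induction. -/

section

open Limits Simplicial Opposite AffineSimplex Topology

namespace AffineSimplex

/-- The segment between two points of a simplex. -/
noncomputable def segment {n : ℕ} (s : unitInterval) (p q : Δ n) : Δ n :=
  ⟨fun i => (1 - s : ℝ) * p i + s * q i, fun i => add_nonneg
    (mul_nonneg (sub_nonneg.2 s.2.2) (stdSimplex.zero_le p i))
    (mul_nonneg s.2.1 (stdSimplex.zero_le q i)), by
    rw [Finset.sum_add_distrib, ← Finset.mul_sum, ← Finset.mul_sum, stdSimplex.sum_eq_one,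
      stdSimplex.sum_eq_one, mul_one, mul_one, sub_add_cancel]⟩

theorem segment_zero {n : ℕ} (p q : Δ n) : segment 0 p q = p :=
  stdSimplex.ext (funext fun i => by
    change (1 - (0 : ℝ)) * p i + 0 * q i = p i
    ring)

theorem segment_one {n : ℕ} (p q : Δ n) : segment 1 p q = q :=
  stdSimplex.ext (funext fun i => by
    change (1 - (1 : ℝ)) * p i + 1 * q i = q i
    ring)

theorem continuous_segment {n : ℕ} {X : Type*} [TopologicalSpace X] {s : X → unitInterval}
    {p q : X → Δ n} (hs : Continuous s) (hp : Continuous p) (hq : Continuous q) :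
    Continuous fun x => segment (s x) (p x) (q x) := by
  refine Continuous.subtype_mk (continuous_pi fun i => ?_) _
  have h₀ : Continuous fun x => (s x : ℝ) := continuous_subtype_val.comp hs
  exact ((continuous_const.sub h₀).mul ((continuous_coord i).comp hp)).add
    (h₀.mul ((continuous_coord i).comp hq))

end AffineSimplex

namespace SSet

/-- The realization of an endomorphism of a simplex is homotopic to the identity. -/
noncomputable def simplexHomotopy {n : ℕ} (φ : ⦋n⦌ ⟶ ⦋n⦌) :
    TopCat.Homotopy (SSet.toTop.map (stdSimplex.{u}.map φ)) (𝟙 _) where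
  toFun x := (SimplexCategory.toTopHomeo ⦋n⦌).symm (segment x.1
    (stdSimplex.map φ (SimplexCategory.toTopHomeo ⦋n⦌ x.2)) (SimplexCategory.toTopHomeo ⦋n⦌ x.2))
  continuous_toFun := by
    have h := (SimplexCategory.toTopHomeo.{u} ⦋n⦌).continuous
    exact (SimplexCategory.toTopHomeo ⦋n⦌).symm.continuous.comp (continuous_segment continuous_fst
      (((_root_.stdSimplex.continuous_map _).comp h).comp continuous_snd)
      (h.comp continuous_snd))
  map_zero_left z := by
    refine (congrArg _ (segment_zero _ _)).trans ?_
    rw [Homeomorph.symm_apply_eq]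
    exact (SimplexCategory.toTopHomeo_naturality_apply φ z).symm
  map_one_left z := (congrArg _ (segment_one _ _)).trans (Homeomorph.symm_apply_apply _ z)

/-- A homotopy on the realization of a simplicial set induces one on disjoint unions of copies. -/
noncomputable def copiesHomotopy (S : Type u) {Z : SSet.{u}} {f : Z ⟶ Z}
    (H : TopCat.Homotopy (SSet.toTop.map f) (𝟙 _)) :
    TopCat.Homotopy (SSet.toTop.map ((copies S).map f)) (𝟙 _) :=
  let e := copiesHomeo S Z
  let k : C(Σ _ : S, SSet.toTop.obj Z, C(unitInterval, Σ _ : S, SSet.toTop.obj Z)) :=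
    ⟨fun x => ⟨fun t => ⟨x.1, H (t, x.2)⟩, continuous_sigmaMk.comp (by fun_prop)⟩,
      continuous_sigma fun s => (ContinuousMap.curry
        ⟨fun p : SSet.toTop.obj Z × unitInterval => (⟨s, H (p.2, p.1)⟩ : Σ _ : S, SSet.toTop.obj Z),
          continuous_sigmaMk.comp (by fun_prop)⟩).continuous⟩
  { toFun := fun x => e (k (e.symm x.2) x.1)
    continuous_toFun := by
      have : Continuous fun p : unitInterval × SSet.toTop.obj ((copies S).obj Z) =>
        k (e.symm p.2) p.1 := by fun_prop
      exact e.continuous.comp this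
    map_zero_left := fun y => by
      obtain ⟨⟨s, z⟩, rfl⟩ := e.surjective y
      rw [Homeomorph.symm_apply_apply]
      refine Eq.trans ?_ (map_copiesHomeo f s z).symm
      exact congrArg e (Sigma.ext rfl (heq_of_eq (H.map_zero_left z)))
    map_one_left := fun y => by
      obtain ⟨⟨s, z⟩, rfl⟩ := e.surjective y
      rw [Homeomorph.symm_apply_apply]
      exact congrArg e (Sigma.ext rfl (heq_of_eq (H.map_one_left z))) }

theorem copies_toTop_comp (S : Type u) {a b c : SimplexCategory} (f : a ⟶ b) (g : b ⟶ c) :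
    SSet.toTop.map ((copies S).map (stdSimplex.{u}.map f)) ≫
      SSet.toTop.map ((copies S).map (stdSimplex.{u}.map g)) =
        SSet.toTop.map ((copies S).map (stdSimplex.{u}.map (f ≫ g))) :=
  ((stdSimplex.{u} ⋙ copies S ⋙ SSet.toTop).map_comp f g).symm

/-- The inverse up to homotopy includes vertex 0. Both composites are realizations of endomorphisms
of a simplex, joined to the identity by straight lines. -/
theorem quasiIso_singChains_copies (S : Type u) (n : ℕ) :
    QuasiIso (singChains.map (SSet.toTop.map ((copies S).map
      (stdSimplex.{u}.map (SimplexCategory.const ⦋n⦌ ⦋0⦌ 0))))) := by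
  refine quasiIso_singChains_of_homotopy _ (SSet.toTop.map ((copies S).map
      (stdSimplex.{u}.map (SimplexCategory.const ⦋0⦌ ⦋n⦌ 0)))) ?_ ?_
  · exact Eq.mpr (congrArg (fun f => TopCat.Homotopy f _) (copies_toTop_comp S _ _))
      (copiesHomotopy S (simplexHomotopy _))
  · exact Eq.mpr (congrArg (fun f => TopCat.Homotopy f _) (copies_toTop_comp S _ _))
      (copiesHomotopy S (simplexHomotopy _))

theorem unit_apply {X : SSet.{u}} {n : ℕ} (x : X _⦋n⦌) (p : Δ n) :
    TopCat.toSSetObjEquiv _ _ ((sSetTopAdj.unit.app X).app (op ⦋n⦌) x) p = point x p := by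
  exact congrArg (fun f : SimplexCategory.toTop.obj ⦋n⦌ ⟶ SSet.toTop.obj X => f.hom ⟨p⟩)
    (sSetTopAdj_unit_app_app_down _ _ x)

theorem isIso_unit_of_bijective (X : SSet.{u})
    (h : ∀ n : ℕ, Function.Bijective fun x : X _⦋n⦌ =>
      (⟨point x, continuous_point x⟩ : C(Δ n, SSet.toTop.obj X))) :
    IsIso (sSetTopAdj.unit.app X) := by
  rw [NatTrans.isIso_iff_isIso_app]
  rintro ⟨n⟩
  induction n using SimplexCategory.rec with | _ n
  rw [isIso_iff_bijective]
  have e : (fun x : X _⦋n⦌ => (⟨point x, continuous_point x⟩ : C(Δ n, SSet.toTop.obj X))) =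
      TopCat.toSSetObjEquiv _ _ ∘ (sSetTopAdj.unit.app X).app (op ⦋n⦌) :=
    funext fun x => ContinuousMap.ext fun p => (unit_apply x p).symm
  have h' := h n
  rw [e] at h'
  exact ((TopCat.toSSetObjEquiv _ _).bijective.of_comp_iff' _).1 h'

/-- The realization is a discrete union of points. It is totally disconnected, so all singular
simplices are constant and the unit of the adjunction is already an isomorphism. -/
theorem chainsEquivSingular_copies_zero (S : Type u) :
    ((copies S).obj (Δ[0] : SSet.{u})).ChainsEquivSingular := by
  refine chainsEquivSingular_of_isIso _ (isIso_unit_of_bijective _ fun n => ?_)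
  have hp : ∀ (s : S) (z : (Δ[0] : SSet.{u}) _⦋n⦌) (p : Δ n),
      point (X := (copies S).obj (Δ[0] : SSet.{u})) (s, z) p =
        copiesHomeo S Δ[0] ⟨s, default⟩ := fun s z p => by
    rw [copiesHomeo_apply, ← Subsingleton.elim (point z p) default, map_point]
    rfl
  constructor
  · rintro ⟨s, z⟩ ⟨s', z'⟩ h
    have h' := DFunLike.congr_fun h stdSimplex.barycenter
    change point _ _ = point _ _ at h'
    rw [hp, hp] at h'
    have hs : s = s' := congrArg Sigma.fst ((copiesHomeo S Δ[0]).injective h')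
    have hz : z = z' := stdSimplex.ext _ _ fun i => Subsingleton.elim (α := Fin 1) _ _
    rw [hs, hz]
  · intro σ
    have hd : TotallyDisconnectedSpace (SSet.toTop.obj ((copies S).obj (Δ[0] : SSet.{u}))) := by
      have : TotallyDisconnectedSpace (SSet.toTop.obj (Δ[0] : SSet.{u})) := inferInstance
      exact (copiesHomeo S Δ[0]).symm.isEmbedding.isTotallyDisconnected_range.1
        (isTotallyDisconnected_of_totallyDisconnectedSpace _)
    obtain ⟨⟨s, z⟩, h⟩ := (copiesHomeo S Δ[0]).surjective (σ stdSimplex.barycenter)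
    refine ⟨(s, stdSimplex.const 0 0 _), ContinuousMap.ext fun p => ?_⟩
    refine (hp s _ p).trans ?_
    rw [Subsingleton.elim default z, h]
    exact (isPreconnected_range σ.continuous).subsingleton ⟨_, rfl⟩ ⟨_, rfl⟩

theorem chainsEquivSingular_copies (S : Type u) (n : ℕ) :
    ((copies S).obj (Δ[n] : SSet.{u})).ChainsEquivSingular :=
  (chainsEquivSingular_iff_of_quasiIso _ (quasiIso_chains_copies S _)
    (quasiIso_singChains_copies S n)).2 (chainsEquivSingular_copies_zero S)

theorem chainsEquivSingular_sigma (S : Type u) (n : ℕ) :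
    (∐ fun _ : S => (Δ[n] : SSet.{u})).ChainsEquivSingular :=
  (chainsEquivSingular_iff_of_iso
    ((coproductIsCoproduct _).coconePointUniqueUpToIso (copiesIsColimit S Δ[n]))).2
      (chainsEquivSingular_copies S n)

/-! ### Induction on skeleta -/

theorem chainsEquivSingular_of_isEmpty (X : SSet.{u}) (h : ∀ n : ℕ, IsEmpty (X _⦋n⦌)) :
    X.ChainsEquivSingular := by
  refine chainsEquivSingular_of_isIso _ (isIso_unit_of_bijective _ fun n =>
    ⟨fun x => (h n).elim x, fun σ => ?_⟩)
  obtain ⟨m, x, -⟩ := exists_point (σ stdSimplex.barycenter)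
  exact (h m).elim x

open relativeCellComplexOfMono

variable (X : SSet.{u})

/-- The inclusion of the empty subcomplex. -/
abbrev fromEmpty : ((⊥ : X.Subcomplex) : SSet.{u}) ⟶ X := (⊥ : X.Subcomplex).ι

/-- The filtration by skeleta. -/
abbrev skel (d : ℕ) : X.Subcomplex := skeletonOfMono (fromEmpty X) d

theorem skel_eq (d : ℕ) : skel X d = X.skeleton d := by
  change Subcomplex.range _ ⊔ _ = _
  simp

theorem hasDimensionLT_skel (d : ℕ) : HasDimensionLT (skel X d : SSet.{u}) d where
  degenerate_eq_top n hn := by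
    rw [skel_eq]
    refine Set.eq_univ_of_forall fun x => ?_
    by_contra h
    have h' : (⟨x, x.2⟩ : (X.skeleton d).obj _) ∈
      (X.skeleton d : SSet.{u}).nonDegenerate n := h
    have := (X.mem_skeleton_obj_iff_of_nonDegenerate
      ⟨x.1, (Subcomplex.mem_nonDegenerate_iff _ _).1 h'⟩ d).1 x.2
    omega

theorem hasDimensionLT_sigmaBoundary (d : ℕ) :
    HasDimensionLT (sigmaBoundary (fromEmpty X) d) d where
  degenerate_eq_top n hn := by
    refine Set.eq_univ_of_forall fun a => ?_
    obtain ⟨c, x, rfl⟩ := Cofan.inj_jointly_surjective_of_isColimit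
      (isColimitCofanMkObjOfIsColimit ((CategoryTheory.evaluation _ _).obj (op ⦋n⦌)) _ _
        (coproductIsCoproduct fun _ : Cell (fromEmpty X) d => (∂Δ[d] : SSet.{u}))) a
    refine degenerate_app_apply ?_ (Sigma.ι (fun _ : Cell (fromEmpty X) d => (∂Δ[d] : SSet.{u})) c)
    rw [degenerate_eq_univ_of_hasDimensionLT _ d n hn]
    trivial

theorem nonempty_collar (d : ℕ) :
    Nonempty (TopCat.Collar (SSet.toTop.map (l (fromEmpty X) d))) :=
  (TopCat.Collar.boundary d).nonempty_sigma
    (isColimitCofanMkObjOfIsColimit SSet.toTop _ _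
      (coproductIsCoproduct fun _ : Cell (fromEmpty X) d => (∂Δ[d] : SSet.{u})))
    (isColimitCofanMkObjOfIsColimit SSet.toTop _ _
      (coproductIsCoproduct fun _ : Cell (fromEmpty X) d => (Δ[d] : SSet.{u})))
    (fun c => by
      rw [← Functor.map_comp, ← Functor.map_comp]
      exact congrArg _ (Cell.ι_l c))

/-- The hypothesis is used twice, for the previous skeleton and for the disjoint union of the
boundaries of the attached cells; hence it is required of all simplicial sets of dimension below
`d`. -/
theorem chainsEquivSingular_skel_succ {d : ℕ}
    (h : ∀ Y : SSet.{u}, HasDimensionLT Y d → Y.ChainsEquivSingular) :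
    (skel X (d + 1) : SSet.{u}).ChainsEquivSingular := by
  obtain ⟨c⟩ := nonempty_collar X d
  have : Mono (l (fromEmpty X) d) := inferInstance
  exact chainsEquivSingular_of_isPushout (isPushout (fromEmpty X) d) c
    (h _ (hasDimensionLT_sigmaBoundary X d)) (chainsEquivSingular_sigma _ d)
    (h _ (hasDimensionLT_skel X d))

theorem chainsEquivSingular_of_hasDimensionLT (d : ℕ) :
    ∀ X : SSet.{u}, HasDimensionLT X d → X.ChainsEquivSingular := by
  induction d with
  | zero =>
    intro X hX
    refine chainsEquivSingular_of_isEmpty X fun n => ⟨fun x => ?_⟩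
    obtain ⟨m, -, -, y, -⟩ := X.exists_nonDegenerate x
    exact absurd (X.dim_lt_of_nonDegenerate y 0) (by omega)
  | succ d ih =>
    intro X hX
    have h := chainsEquivSingular_skel_succ X ih
    have e : skel X (d + 1) = ⊤ := by
      rw [Subcomplex.eq_top_iff_of_hasDimensionLT _ (d + 1)]
      intro i hi x hx
      rw [skel_eq]
      exact X.mem_skeleton x hi
    rw [e] at h
    exact (chainsEquivSingular_iff_of_iso (Subcomplex.topIso X)).1 h

theorem chainsEquivSingular_skel (d : ℕ) : (skel X d : SSet.{u}).ChainsEquivSingular :=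
  chainsEquivSingular_of_hasDimensionLT d _ (hasDimensionLT_skel X d)

end SSet

end

/-! ### From the skeleta to an arbitrary simplicial set, by compactness. -/

section

open Limits Simplicial Opposite AffineSimplex Topology

namespace ChainComplex

/-- A cycle and a chain bounding its image live at a common stage, where the comparison is known.
This is why the hypothesis treats one chain of each complex simultaneously, in unrelated degrees. -/
theorem quasiIso_of_exhaustion {K L : ChainComplex AddCommGrpCat.{u} ℕ} (f : K ⟶ L) {ι : Type*}
    {K' L' : ι → ChainComplex AddCommGrpCat.{u} ℕ} (f' : ∀ i, K' i ⟶ L' i) (a : ∀ i, K' i ⟶ K)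
    (b : ∀ i, L' i ⟶ L) (w : ∀ i, a i ≫ f = f' i ≫ b i) (hf : ∀ i, QuasiIso (f' i))
    (ha : ∀ i, Mono (a i)) (hb : ∀ i, Mono (b i))
    (h : ∀ m n (x : K.X m) (y : L.X n), ∃ i x' y', ((a i).f m).hom x' = x ∧
      ((b i).f n).hom y' = y) : QuasiIso f := by
  have w' : ∀ i n (x : (K' i).X n), (f.f n).hom (((a i).f n).hom x) =
      ((b i).f n).hom (((f' i).f n).hom x) := fun i n x =>
    congrArg (fun g => (g.f n).hom x) (w i)
  rw [quasiIso_iff_elements]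
  refine fun n => ⟨fun y hy => ?_, ?_⟩
  · obtain ⟨i, -, y, -, rfl⟩ := h n n 0 y
    have hy' : IsCycle (L' i) n y := fun j => f_injective (b i) j (by
      rw [f_d_apply, hy, map_zero])
    obtain ⟨x, hx, v, rfl⟩ := ((quasiIso_iff_elements _).1 (hf i) n).1 y hy'
    refine ⟨_, hx.map (a i), ((b i).f (n + 1)).hom v, ?_⟩
    rw [map_add, w', f_d_apply]
  · rintro x hx ⟨v, hv⟩
    obtain ⟨i, x, v, rfl, rfl⟩ := h n (n + 1) x v
    have hx' : IsCycle (K' i) n x := fun j => f_injective (a i) j (by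
      rw [f_d_apply, hx, map_zero])
    obtain ⟨v', rfl⟩ := ((quasiIso_iff_elements _).1 (hf i) n).2 x hx'
      ⟨v, f_injective (b i) n (by rw [← w', hv, f_d_apply])⟩
    exact ⟨((a i).f (n + 1)).hom v', by rw [f_d_apply]⟩

end ChainComplex

namespace TopCat

/-- Needed for skeleta: the compactness argument uses that finite subsets of each stage are closed.
-/
theorem t1Space_of_isPushout {A B X Y : TopCat.{u}} {t : A ⟶ X} {f : A ⟶ B} {g : X ⟶ Y}
    {b : B ⟶ Y} (sq : IsPushout t f g b) (hf : IsClosedEmbedding f) [T1Space X] [T1Space B] :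
    T1Space Y where
  t1 y := by
    have hg := injective_of_isPushout sq hf.injective
    rw [isClosed_iff_of_isPushout sq]
    refine ⟨Set.Subsingleton.isClosed fun x hx x' hx' => hg (hx.trans hx'.symm), ?_⟩
    rcases eq_or_eq_of_isPushout sq y with ⟨x, rfl⟩ | ⟨z, rfl, hz⟩
    · have : b ⁻¹' {g x} = f '' (t ⁻¹' {x}) := Set.ext fun z =>
        (eq_iff_of_isPushout sq hf.injective x z).trans
          ⟨fun ⟨a, h, h'⟩ => ⟨a, h', h⟩, fun ⟨a, h, h'⟩ => ⟨a, h', h⟩⟩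
      rw [this]
      exact hf.isClosedMap _ (isClosed_singleton.preimage t.hom.continuous)
    · exact Set.Subsingleton.isClosed fun x hx x' hx' =>
        (eq_of_isPushout sq hz hx.symm).symm.trans (eq_of_isPushout sq hz hx'.symm)

section Sequential

variable {F : ℕ ⥤ TopCat.{u}} (hF : ∀ n : ℕ, IsClosedEmbedding (F.map (homOfLE (Nat.le_succ n))))

include hF

theorem isClosedEmbedding_map_of_succ {m n : ℕ} (h : m ≤ n) :
    IsClosedEmbedding (F.map (homOfLE h)) := by
  induction n, h using Nat.le_induction with
  | base =>
    rw [Subsingleton.elim (homOfLE le_rfl) (𝟙 m), F.map_id]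
    exact IsClosedEmbedding.id
  | succ n h ih =>
    rw [Subsingleton.elim (homOfLE (h.trans n.le_succ)) (homOfLE h ≫ homOfLE (Nat.le_succ n)),
      F.map_comp]
    exact (hF n).comp ih

variable {c : Cocone F} (hc : IsColimit c)

include hc

theorem injective_ι_of_succ (n : ℕ) : Function.Injective (c.ι.app n) := fun x y h => by
  obtain ⟨j, f, hj⟩ := (Types.FilteredColimit.isColimit_eq_iff'
    (isColimitOfPreserves (forget TopCat) hc) x y).1 h
  exact (isClosedEmbedding_map_of_succ hF f.le).injective hj

theorem isClosedEmbedding_ι_of_succ (n : ℕ) : IsClosedEmbedding (c.ι.app n) := by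
  have hw : ∀ {i j : ℕ} (h : i ≤ j) (x : F.obj i),
      c.ι.app j (F.map (homOfLE h) x) = c.ι.app i x := fun h x =>
    ConcreteCategory.congr_hom (c.w (homOfLE h)) x
  refine IsClosedEmbedding.of_continuous_injective_isClosedMap (c.ι.app n).hom.continuous
    (injective_ι_of_succ hF hc n) fun C hC => ?_
  refine (isClosed_iff_of_isColimit _ hc _).2 fun j => ?_
  rcases le_total j n with h | h
  · have : c.ι.app j ⁻¹' (c.ι.app n '' C) = F.map (homOfLE h) ⁻¹' C := Set.ext fun x => by
      refine Iff.trans ?_ (Function.Injective.mem_set_image (injective_ι_of_succ hF hc n))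
      exact iff_of_eq (congrArg (· ∈ c.ι.app n '' C) (hw h x).symm)
    rw [this]
    exact hC.preimage (F.map (homOfLE h)).hom.continuous
  · have : c.ι.app j ⁻¹' (c.ι.app n '' C) = F.map (homOfLE h) '' C := Set.ext fun x =>
      ⟨fun ⟨y, hy, e⟩ => ⟨y, hy, injective_ι_of_succ hF hc j ((hw h y).trans e)⟩,
        fun ⟨y, hy, e⟩ => ⟨y, hy, (hw h y).symm.trans (congrArg _ e)⟩⟩
    rw [this]
    exact (isClosedEmbedding_map_of_succ hF h).isClosedMap _ hC

/-- A compact subset of a sequential colimit of closed embeddings of `T1` spaces is contained in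
some stage. -/
theorem exists_subset_range_ι (hT : ∀ n, T1Space (F.obj n)) {K : Set c.pt} (hK : IsCompact K) :
    ∃ n, K ⊆ Set.range (c.ι.app n) := by
  have mono : ∀ {i j : ℕ}, i ≤ j → Set.range (c.ι.app i) ⊆ Set.range (c.ι.app j) := by
    rintro i j h _ ⟨x, rfl⟩
    exact ⟨F.map (homOfLE h) x, ConcreteCategory.congr_hom (c.w (homOfLE h)) x⟩
  by_contra! hn
  have hn' : ∀ n, ∃ x ∈ K, x ∉ Set.range (c.ι.app n) := fun n => Set.not_subset.1 (hn n)
  choose p hpK hp using hn'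
  -- Tails of a sequence in `K` whose m-th point avoids stage m. Stage j contains only points with m
  -- < j, so a tail meets each stage in a finite set and is closed. A common point of all tails
  -- would lie in some stage j and equal some `p m` with m ≥ j, a contradiction.
  let C : ℕ → Set c.pt := fun n => p '' {m | n ≤ m}
  have hC : ∀ n, IsClosed (C n) := fun n => (isClosed_iff_of_isColimit _ hc _).2 fun j => by
    have : ((c.ι.app j) ⁻¹' C n).Finite := by
      refine Set.Finite.preimage (injective_ι_of_succ hF hc j).injOn ?_ |>.subset
        (s := (c.ι.app j) ⁻¹' (p '' {m | m < j})) ?_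
      · exact (Set.finite_lt_nat j).image p
      · rintro x ⟨m, -, hm⟩
        refine ⟨m, ?_, hm⟩
        by_contra hjm
        exact hp m (mono (not_lt.1 hjm) ⟨x, hm.symm⟩)
    exact this.isClosed
  obtain ⟨q, hq⟩ := IsCompact.nonempty_iInter_of_sequence_nonempty_isCompact_isClosed C
    (fun n => Set.image_mono fun m (hm : n + 1 ≤ m) => n.le_succ.trans hm)
    (fun n => ⟨p n, n, le_refl n, rfl⟩)
    (hK.of_isClosed_subset (hC 0) (Set.image_subset_iff.2 fun m _ => hpK m)) hC
  obtain ⟨j, x, hx⟩ := Types.jointly_surjective_of_isColimit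
    (isColimitOfPreserves (forget TopCat) hc) q
  obtain ⟨m, hm, rfl⟩ := Set.mem_iInter.1 hq j
  exact hp m (mono hm ⟨x, hx⟩)

end Sequential

end TopCat

namespace SSet

open relativeCellComplexOfMono

variable (X : SSet.{u})

theorem isPushout_toTop (d : ℕ) : IsPushout (SSet.toTop.map (t (fromEmpty X) d))
    (SSet.toTop.map (l (fromEmpty X) d)) (SSet.toTop.map (r (fromEmpty X) d))
    (SSet.toTop.map (b (fromEmpty X) d)) :=
  (isPushout (fromEmpty X) d).map SSet.toTop

theorem t1Space_copies (S : Type u) (n : ℕ) :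
    T1Space (SSet.toTop.obj ((copies S).obj (Δ[n] : SSet.{u}))) := by
  have : T2Space (SSet.toTop.obj (Δ[n] : SSet.{u})) :=
    (SimplexCategory.toTopHomeo ⦋n⦌).isEmbedding.t2Space
  exact (copiesHomeo S Δ[n]).symm.isEmbedding.t1Space

theorem t1Space_skel (d : ℕ) : T1Space (SSet.toTop.obj (skel X d : SSet.{u})) := by
  induction d with
  | zero =>
    refine ⟨fun q => ?_⟩
    obtain ⟨n, x, -⟩ := exists_point q
    have := hasDimensionLT_skel X 0
    obtain ⟨m, -, -, y, -⟩ := (skel X 0 : SSet.{u}).exists_nonDegenerate x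
    exact absurd ((skel X 0 : SSet.{u}).dim_lt_of_nonDegenerate y 0) (by omega)
  | succ d ih =>
    obtain ⟨c⟩ := nonempty_collar X d
    have : T1Space (SSet.toTop.obj (sigmaStdSimplex (fromEmpty X) d)) := by
      have := t1Space_copies (Cell (fromEmpty X) d) d
      let e : SSet.toTop.obj (sigmaStdSimplex (fromEmpty X) d) ≅
          SSet.toTop.obj ((copies (Cell (fromEmpty X) d)).obj (Δ[d] : SSet.{u})) := SSet.toTop.mapIso ((coproductIsCoproduct _).coconePointUniqueUpToIso
        (copiesIsColimit (Cell (fromEmpty X) d) Δ[d]))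
      exact (TopCat.homeoOfIso e).isEmbedding.t1Space
    exact TopCat.t1Space_of_isPushout (isPushout_toTop X d) c.isClosedEmbedding

/-- The filtration of a simplicial set by skeleta, as a functor. -/
noncomputable abbrev skelFunctor : ℕ ⥤ SSet.{u} :=
  (skeletonOfMono (fromEmpty X)).monotone.functor ⋙ Subcomplex.toSSetFunctor

/-- A simplicial set is the colimit of its skeleta. -/
noncomputable def skelIsColimit : IsColimit (Cocone.mk X (relativeCellComplex X).incl) :=
  (relativeCellComplex X).isColimit

theorem isClosedEmbedding_skel (d : ℕ) :
    IsClosedEmbedding (SSet.toTop.map ((skelFunctor X).map (homOfLE (Nat.le_succ d)))) := by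
  obtain ⟨c⟩ := nonempty_collar X d
  exact TopCat.isClosedEmbedding_of_isPushout (isPushout_toTop X d) c.isClosedEmbedding

theorem exists_range_le_skel {K : Set (SSet.toTop.obj X)} (hK : IsCompact K) :
    ∃ d, K ⊆ Set.range (SSet.toTop.map (skel X d).ι) :=
  TopCat.exists_subset_range_ι (F := skelFunctor X ⋙ SSet.toTop) (isClosedEmbedding_skel X)
    (isColimitOfPreserves SSet.toTop (skelIsColimit X)) (t1Space_skel X) hK

theorem isClosedEmbedding_toTop_skel (d : ℕ) :
    IsClosedEmbedding (SSet.toTop.map (skel X d).ι) :=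
  TopCat.isClosedEmbedding_ι_of_succ (F := skelFunctor X ⋙ SSet.toTop) (isClosedEmbedding_skel X)
    (isColimitOfPreserves SSet.toTop (skelIsColimit X)) d

theorem range_toTop_skel_mono {d e : ℕ} (h : d ≤ e) :
    Set.range (SSet.toTop.map (skel X d).ι) ⊆ Set.range (SSet.toTop.map (skel X e).ι) := by
  rintro _ ⟨q, rfl⟩
  refine ⟨SSet.toTop.map (Subcomplex.homOfLE ((skeletonOfMono (fromEmpty X)).monotone h)) q, ?_⟩
  exact ConcreteCategory.congr_hom (SSet.toTop.map_comp
    (Subcomplex.homOfLE ((skeletonOfMono (fromEmpty X)).monotone h)) (skel X e).ι).symm q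

theorem exists_chain_skel {n : ℕ} (x : (chains.obj X).X n) :
    ∃ d, ∀ e, d ≤ e → ∃ x', ((chains.map (skel X e).ι).f n).hom x' = x := by
  refine chains_induction (P := fun x => ∃ d, ∀ e, d ≤ e → ∃ x',
    ((chains.map (skel X e).ι).f n).hom x' = x) ⟨0, fun e _ => ⟨0, map_zero _⟩⟩ ?_ ?_ ?_ x
  · rintro a b ⟨d, hd⟩ ⟨d', hd'⟩
    refine ⟨max d d', fun e he => ?_⟩
    obtain ⟨a', rfl⟩ := hd e (le_trans (le_max_left _ _) he)
    obtain ⟨b', rfl⟩ := hd' e (le_trans (le_max_right _ _) he)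
    exact ⟨a' + b', map_add _ _ _⟩
  · rintro a ⟨d, hd⟩
    refine ⟨d, fun e he => ?_⟩
    obtain ⟨a', rfl⟩ := hd e he
    exact ⟨-a', map_neg _ _⟩
  · refine fun x => ⟨n + 1, fun e he => ?_⟩
    have hx : x ∈ (skel X e).obj (op ⦋n⦌) := by
      rw [skel_eq]
      exact X.mem_skeleton x (by omega)
    exact ⟨simplexChain (X := (skel X e : SSet.{u})) ⟨x, hx⟩, chains_map_simplexChain _ _⟩

theorem exists_singChain_skel {n : ℕ} (y : (singChains.obj (SSet.toTop.obj X)).X n) :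
    ∃ d, ∀ e, d ≤ e → ∃ y', ((singChains.map (SSet.toTop.map (skel X e).ι)).f n).hom y' = y := by
  -- Being in the image is rewritten as being carried by the stage, so for a simplex only its
  -- compact image matters.
  simp only [SingularChain.range_map_of_isEmbedding _ (isClosedEmbedding_toTop_skel X _).isEmbedding]
  refine chains_induction (P := fun y => ∃ d, ∀ e, d ≤ e →
    y ∈ SingularChain.carried (Set.range (SSet.toTop.map (skel X e).ι)) n)
    ⟨0, fun e _ => zero_mem _⟩ ?_ ?_ ?_ y
  · rintro a b ⟨d, hd⟩ ⟨d', hd'⟩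
    exact ⟨max d d', fun e he => add_mem (hd e (le_trans (le_max_left _ _) he))
      (hd' e (le_trans (le_max_right _ _) he))⟩
  · rintro a ⟨d, hd⟩
    exact ⟨d, fun e he => neg_mem (hd e he)⟩
  · intro x
    obtain ⟨d, hd⟩ := exists_range_le_skel X
      (isCompact_range (TopCat.toSSetObjEquiv _ _ x).continuous)
    exact ⟨d, fun e he => SingularChain.sing_mem_carried
      (σ := TopCat.toSSetObjEquiv _ _ x) fun t =>
        range_toTop_skel_mono X he (hd ⟨t, rfl⟩)⟩

/-- The chains on a simplicial set compute the singular homology of its realization. -/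
theorem chainsEquivSingular : X.ChainsEquivSingular := by
  refine ChainComplex.quasiIso_of_exhaustion (chainsToSing X)
    (fun d => chainsToSing (skel X d : SSet.{u})) (fun d => chains.map (skel X d).ι)
    (fun d => singChains.map (SSet.toTop.map (skel X d).ι)) (fun d => chainsToSing_naturality _)
    (fun d => chainsEquivSingular_skel X d) (fun d => ?_) (fun d => ?_) fun m n x y => ?_
  · exact mono_chains_map _ fun n => Subtype.val_injective
  · exact SingularChain.mono_map_of_injective _ (isClosedEmbedding_toTop_skel X d).injective
  · obtain ⟨d, hd⟩ := exists_chain_skel X x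
    obtain ⟨d', hd'⟩ := exists_singChain_skel X y
    obtain ⟨x', hx⟩ := hd _ (le_max_left d d')
    obtain ⟨y', hy⟩ := hd' _ (le_max_right d d')
    exact ⟨max d d', x', y', hx, hy⟩

end SSet

end

/-! ### The total complex of a bicomplex in terms of families of elements. -/

section

open Limits

namespace HomologicalComplex₂

variable {K L M : HomologicalComplex₂ AddCommGrpCat.{u} (ComplexShape.down ℕ) (ComplexShape.down ℕ)}

variable (K) in
/-- The families of elements of a bicomplex. -/
abbrev Family : Type u := ∀ p q : ℕ, (K.X p).X q

/-- The family with a single nonzero entry. -/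
def single (p q : ℕ) : (K.X p).X q →+ K.Family :=
  (AddMonoidHom.single (fun p => ∀ q, (K.X p).X q) p).comp
    (AddMonoidHom.single (fun q => (K.X p).X q) q)

theorem single_self (p q : ℕ) (a : (K.X p).X q) : single p q a p q = a := by
  simp [single]

theorem single_of_ne {p q p' q' : ℕ} (h : ¬(p' = p ∧ q' = q)) (a : (K.X p).X q) :
    single p q a p' q' = 0 := by
  simp only [single, AddMonoidHom.comp_apply, AddMonoidHom.single_apply]
  rcases eq_or_ne p' p with rfl | hp
  · rw [Pi.single_eq_same, Pi.single_eq_of_ne fun hq => h ⟨rfl, hq⟩]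
  · rw [Pi.single_eq_of_ne hp]
    rfl

/-- The horizontal differential. -/
def horD : K.Family →+ K.Family where
  toFun x := fun p q => ((K.d (p + 1) p).f q).hom (x (p + 1) q)
  map_zero' := funext fun _ => funext fun _ => map_zero _
  map_add' _ _ := funext fun _ => funext fun _ => map_add _ _ _

/-- The vertical differential, with the sign of the total complex. -/
def verD : K.Family →+ K.Family where
  toFun x := fun p q => (-1 : ℤ) ^ p • ((K.X p).d (q + 1) q).hom (x p (q + 1))
  map_zero' := funext fun p => funext fun q => by
    change _ • ((K.X p).d (q + 1) q).hom 0 = 0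
    rw [map_zero, smul_zero]
  map_add' x y := funext fun p => funext fun q => by
    change _ • ((K.X p).d (q + 1) q).hom (x p (q + 1) + y p (q + 1)) = _ + _
    rw [map_add, smul_add]

/-- The total differential. -/
def totD : K.Family →+ K.Family := horD + verD

theorem totD_apply (x : K.Family) (p q : ℕ) : totD x p q =
    ((K.d (p + 1) p).f q).hom (x (p + 1) q) +
      (-1 : ℤ) ^ p • ((K.X p).d (q + 1) q).hom (x p (q + 1)) := rfl

theorem totD_totD (x : K.Family) : totD (totD x) = 0 := by
  funext p q
  have h₁ : ((K.d (p + 1) p).f q).hom (((K.d (p + 1 + 1) (p + 1)).f q).hom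
      (x (p + 1 + 1) q)) = 0 := by
    rw [← AddCommGrpCat.comp_apply, ← HomologicalComplex.comp_f, K.d_comp_d]
    rfl
  have h₂ : ((K.X p).d (q + 1) q).hom (((K.X p).d (q + 1 + 1) (q + 1)).hom
      (x p (q + 1 + 1))) = 0 := ChainComplex.d_d_apply _ _ _ _ _
  have h₃ : ((K.d (p + 1) p).f q).hom (((K.X (p + 1)).d (q + 1) q).hom (x (p + 1) (q + 1))) =
      ((K.X p).d (q + 1) q).hom (((K.d (p + 1) p).f (q + 1)).hom (x (p + 1) (q + 1))) :=
    ChainComplex.f_d_apply _ _ _ _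
  rw [totD_apply, totD_apply, totD_apply, map_add, map_add, map_zsmul, map_zsmul, h₁, h₂, h₃,
    pow_succ]
  simp

variable (K) in
/-- The families concentrated in total degree `n`. -/
def totSubgroup (n : ℕ) : AddSubgroup K.Family where
  carrier := {x | ∀ p q, p + q ≠ n → x p q = 0}
  zero_mem' _ _ _ := rfl
  add_mem' {x y} hx hy p q h := by
    change x p q + y p q = 0
    rw [hx p q h, hy p q h, add_zero]
  neg_mem' {x} hx p q h := by
    change -x p q = 0
    rw [hx p q h, neg_zero]

theorem totD_mem {n : ℕ} {x : K.Family} (hx : x ∈ K.totSubgroup (n + 1)) :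
    totD x ∈ K.totSubgroup n := fun p q h => by
  rw [totD_apply, hx _ _ (by omega), hx _ _ (by omega), map_zero, map_zero, smul_zero, add_zero]

theorem single_mem {p q n : ℕ} (h : p + q = n) (a : (K.X p).X q) :
    single p q a ∈ K.totSubgroup n := fun p' q' h' =>
  single_of_ne (by rintro ⟨rfl, rfl⟩; exact h' h) a

open Classical in
variable (K) in
/-- The total complex of a bicomplex of abelian groups, in terms of families of elements. -/
noncomputable def tot : ChainComplex AddCommGrpCat.{u} ℕ where
  X n := AddCommGrpCat.of (K.totSubgroup n)
  d i j := if h : i = j + 1 then AddCommGrpCat.ofHom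
    ((totD.domRestrict (K.totSubgroup i)).codRestrict (K.totSubgroup j)
      fun x => totD_mem (h ▸ x.2)) else 0
  shape i j h := dif_neg fun h' => h h'.symm
  d_comp_d' := by
    rintro _ _ k rfl rfl
    rw [dif_pos rfl, dif_pos rfl]
    refine AddCommGrpCat.hom_ext (AddMonoidHom.ext fun x => Subtype.ext ?_)
    exact totD_totD x.1

theorem tot_d_apply (n : ℕ) (x : K.tot.X (n + 1)) :
    (show K.totSubgroup n from (K.tot.d (n + 1) n).hom x).1 = totD x.1 := by
  have h : K.tot.d (n + 1) n = AddCommGrpCat.ofHom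
    ((totD.domRestrict (K.totSubgroup (n + 1))).codRestrict (K.totSubgroup n)
      fun x => totD_mem x.2) := dif_pos rfl
  rw [h]
  rfl

/-- The map of families induced by a map of bicomplexes. -/
def familyMap (f : K ⟶ L) : K.Family →+ L.Family where
  toFun x := fun p q => ((f.f p).f q).hom (x p q)
  map_zero' := funext fun _ => funext fun _ => map_zero _
  map_add' _ _ := funext fun _ => funext fun _ => map_add _ _ _

theorem familyMap_mem (f : K ⟶ L) {n : ℕ} {x : K.Family} (hx : x ∈ K.totSubgroup n) :
    familyMap f x ∈ L.totSubgroup n := fun p q h => by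
  change ((f.f p).f q).hom (x p q) = 0
  rw [hx p q h, map_zero]

theorem totD_familyMap (f : K ⟶ L) (x : K.Family) : totD (familyMap f x) = familyMap f (totD x) := by
  funext p q
  have h₁ : ((L.d (p + 1) p).f q).hom (((f.f (p + 1)).f q).hom (x (p + 1) q)) =
      ((f.f p).f q).hom (((K.d (p + 1) p).f q).hom (x (p + 1) q)) := by
    rw [← AddCommGrpCat.comp_apply, ← AddCommGrpCat.comp_apply, ← HomologicalComplex.comp_f,
      ← HomologicalComplex.comp_f, f.comm]
  change ((L.d (p + 1) p).f q).hom (((f.f (p + 1)).f q).hom (x (p + 1) q)) +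
      (-1 : ℤ) ^ p • ((L.X p).d (q + 1) q).hom (((f.f p).f (q + 1)).hom (x p (q + 1))) =
    ((f.f p).f q).hom (((K.d (p + 1) p).f q).hom (x (p + 1) q) +
      (-1 : ℤ) ^ p • ((K.X p).d (q + 1) q).hom (x p (q + 1)))
  rw [h₁, map_add, map_zsmul, ChainComplex.f_d_apply]

/-- The total complex is functorial. -/
noncomputable def totFunctor :
    HomologicalComplex₂ AddCommGrpCat.{u} (ComplexShape.down ℕ) (ComplexShape.down ℕ) ⥤
      ChainComplex AddCommGrpCat.{u} ℕ where
  obj K := K.tot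
  map {K L} f :=
    { f n := AddCommGrpCat.ofHom (((familyMap f).domRestrict (K.totSubgroup n)).codRestrict
        (L.totSubgroup n) fun x => familyMap_mem f x.2)
      comm' := by
        rintro _ j rfl
        refine AddCommGrpCat.hom_ext (AddMonoidHom.ext fun x => Subtype.ext ?_)
        refine (tot_d_apply _ _).trans ((totD_familyMap f x.1).trans ?_)
        exact congrArg (familyMap f) (tot_d_apply _ x).symm }

/-! ### Comparison with the total complex -/

theorem horD_single_succ (p q : ℕ) (a : (K.X (p + 1)).X q) :
    horD (single (p + 1) q a) = single p q (((K.d (p + 1) p).f q).hom a) := by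
  funext p' q'
  change ((K.d (p' + 1) p').f q').hom (single (p + 1) q a (p' + 1) q') = _
  by_cases h : p' = p ∧ q' = q
  · obtain ⟨rfl, rfl⟩ := h
    rw [single_self, single_self]
  · rw [single_of_ne (by omega), single_of_ne h, map_zero]

theorem horD_single_zero (q : ℕ) (a : (K.X 0).X q) : horD (single 0 q a) = 0 := by
  funext p' q'
  change ((K.d (p' + 1) p').f q').hom (single 0 q a (p' + 1) q') = _
  rw [single_of_ne (by omega), map_zero]
  rfl

theorem verD_single_succ (p q : ℕ) (a : (K.X p).X (q + 1)) :
    verD (single p (q + 1) a) = (-1 : ℤ) ^ p • single p q (((K.X p).d (q + 1) q).hom a) := by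
  funext p' q'
  change (-1 : ℤ) ^ p' • ((K.X p').d (q' + 1) q').hom (single p (q + 1) a p' (q' + 1)) =
    (-1 : ℤ) ^ p • single p q (((K.X p).d (q + 1) q).hom a) p' q'
  by_cases h : p' = p ∧ q' = q
  · obtain ⟨rfl, rfl⟩ := h
    rw [single_self, single_self]
  · rw [single_of_ne (by omega), single_of_ne h, map_zero, smul_zero, smul_zero]

theorem verD_single_zero (p : ℕ) (a : (K.X p).X 0) : verD (single p 0 a) = 0 := by
  funext p' q'
  change (-1 : ℤ) ^ p' • ((K.X p').d (q' + 1) q').hom (single p 0 a p' (q' + 1)) = _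
  rw [single_of_ne (by omega), map_zero, smul_zero]
  rfl

variable (K) in
/-- The comparison map from the total complex to the complex of families. -/
noncomputable def totalToFamily (n : ℕ) : (K.total (ComplexShape.down ℕ)).X n ⟶ K.tot.X n :=
  K.totalDesc fun p q h => AddCommGrpCat.ofHom
    ((single p q).codRestrict (K.totSubgroup n) (single_mem h))

variable (K) in
/-- The family of elements given by an element of the total complex. -/
noncomputable def components (n : ℕ) : (K.total (ComplexShape.down ℕ)).X n →+ K.Family :=
  (K.totSubgroup n).subtype.comp (K.totalToFamily n).hom

theorem components_ι (p q n : ℕ) (h : p + q = n) (a : (K.X p).X q) :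
    K.components n ((K.ιTotal (ComplexShape.down ℕ) p q n h).hom a) = single p q a :=
  congrArg (fun f => (show K.totSubgroup n from f.hom a).1)
    (K.ι_totalDesc _ p q h : K.ιTotal _ p q n h ≫ K.totalToFamily n = _)

/-- The signs of the total complex are 1 horizontally and (-1)^p vertically, as in `horD` and
`verD`. In column 0 and in row 0 the respective differential vanishes on both sides. -/
theorem components_d_ι (p q n : ℕ) (h : p + q = n + 1) (a : (K.X p).X q) :
    K.components n (((K.total (ComplexShape.down ℕ)).d (n + 1) n).hom
      ((K.ιTotal (ComplexShape.down ℕ) p q (n + 1) h).hom a)) = totD (single p q a) := by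
  have e : K.ιTotal (ComplexShape.down ℕ) p q (n + 1) h ≫
      (K.total (ComplexShape.down ℕ)).d (n + 1) n =
        K.d₁ (ComplexShape.down ℕ) p q n + K.d₂ (ComplexShape.down ℕ) p q n := by
    rw [total_d, Preadditive.comp_add, ι_D₁, ι_D₂]
  have h₁ : K.components n ((K.d₁ (ComplexShape.down ℕ) p q n).hom a) = horD (single p q a) := by
    rcases p with _ | p
    · rw [d₁_eq_zero _ _ _ _ _ (Nat.succ_ne_zero _), horD_single_zero]
      exact map_zero (K.components n)
    · rw [K.d₁_eq (ComplexShape.down ℕ) (i₁' := p) rfl q n (by change p + q = n; omega),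
        horD_single_succ, ← components_ι (n := n) _ _ (by omega)]
      have : ComplexShape.ε₁ (ComplexShape.down ℕ) (ComplexShape.down ℕ) (ComplexShape.down ℕ)
        (p + 1, q) = 1 := rfl
      rw [this, one_smul]
      rfl
  have h₂ : K.components n ((K.d₂ (ComplexShape.down ℕ) p q n).hom a) = verD (single p q a) := by
    rcases q with _ | q
    · rw [d₂_eq_zero _ _ _ _ _ (Nat.succ_ne_zero _), verD_single_zero]
      exact map_zero (K.components n)
    · rw [K.d₂_eq (ComplexShape.down ℕ) p (i₂' := q) rfl n (by change p + q = n; omega),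
        verD_single_succ, ← components_ι (n := n) _ _ (by omega)]
      have : ComplexShape.ε₂ (ComplexShape.down ℕ) (ComplexShape.down ℕ) (ComplexShape.down ℕ)
        (p, q + 1) = (-1 : ℤˣ) ^ p := rfl
      rw [this]
      rcases Nat.even_or_odd p with hp | hp
      · rw [hp.neg_one_pow, hp.neg_one_pow, one_smul, one_smul]
        rfl
      · rw [hp.neg_one_pow, hp.neg_one_pow, neg_one_smul, Units.neg_smul, one_smul]
        exact map_neg (K.components n) _
  refine (congrArg (fun f => K.components n (f.hom a)) e).trans ?_
  refine (map_add (K.components n) _ _).trans ?_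
  exact congrArg₂ (· + ·) h₁ h₂

variable (K) in
/-- The inverse of the comparison map. -/
noncomputable def familyToTotal (n : ℕ) :
    K.totSubgroup n →+ (K.total (ComplexShape.down ℕ)).X n where
  toFun x := ∑ pq ∈ Finset.HasAntidiagonal.antidiagonal n,
    (K.ιTotalOrZero (ComplexShape.down ℕ) pq.1 pq.2 n).hom (x.1 pq.1 pq.2)
  map_zero' := Finset.sum_eq_zero fun pq _ => map_zero _
  map_add' x y := by
    rw [← Finset.sum_add_distrib]
    exact Finset.sum_congr rfl fun pq _ => map_add _ _ _

theorem familyToTotal_apply (n : ℕ) (x : K.totSubgroup n) :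
    K.familyToTotal n x = ∑ pq ∈ Finset.HasAntidiagonal.antidiagonal n,
      (K.ιTotalOrZero (ComplexShape.down ℕ) pq.1 pq.2 n).hom (x.1 pq.1 pq.2) := rfl

theorem isIso_totalToFamily (n : ℕ) : IsIso (K.totalToFamily n) := by
  refine ⟨AddCommGrpCat.ofHom (K.familyToTotal n), ?_, ?_⟩
  · refine total.hom_ext _ fun p q h => AddCommGrpCat.hom_ext (AddMonoidHom.ext fun a => ?_)
    change ∑ pq ∈ Finset.HasAntidiagonal.antidiagonal n, (K.ιTotalOrZero (ComplexShape.down ℕ) pq.1 pq.2 n).hom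
      (K.components n
        ((K.ιTotal (ComplexShape.down ℕ) p q n h).hom a) pq.1 pq.2) = _
    rw [components_ι]
    rw [Finset.sum_eq_single (p, q)]
    · rw [single_self, K.ιTotalOrZero_eq _ _ _ _ h]
      rfl
    · intro pq _ hne
      rw [single_of_ne fun h => hne (Prod.ext h.1 h.2), map_zero]
    · exact fun h' => absurd (Finset.HasAntidiagonal.mem_antidiagonal.2 h) h'
  · refine AddCommGrpCat.hom_ext (AddMonoidHom.ext fun x => Subtype.ext ?_)
    have : ∀ x : K.totSubgroup n, K.components n (K.familyToTotal n x) =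
        ∑ pq ∈ Finset.HasAntidiagonal.antidiagonal n, single pq.1 pq.2 (x.1 pq.1 pq.2) := fun x => by
      rw [familyToTotal_apply, map_sum]
      refine Finset.sum_congr rfl fun pq h => ?_
      rw [K.ιTotalOrZero_eq _ _ _ _ (Finset.HasAntidiagonal.mem_antidiagonal.1 h)]
      exact components_ι _ _ _ _ _
    refine (this x).trans (funext fun p => funext fun q => ?_)
    rw [Finset.sum_apply, Finset.sum_apply]
    by_cases h : p + q = n
    · rw [Finset.sum_eq_single (p, q), single_self]
      · rfl
      · exact fun pq _ hne => single_of_ne (fun h => hne (Prod.ext h.1.symm h.2.symm)) _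
      · exact fun h' => absurd (Finset.HasAntidiagonal.mem_antidiagonal.2 h) h'
    · refine (Finset.sum_eq_zero fun pq hpq => single_of_ne (fun h' => h ?_) _).trans
        (x.2 p q h).symm
      rw [h'.1, h'.2]
      exact Finset.HasAntidiagonal.mem_antidiagonal.1 hpq

variable (K) in
/-- The total complex of a bicomplex of abelian groups in terms of families of elements. -/
noncomputable def totalIsoTot : K.total (ComplexShape.down ℕ) ≅ K.tot :=
  have := fun n => K.isIso_totalToFamily n
  HomologicalComplex.Hom.isoOfComponents (fun n => asIso (K.totalToFamily n)) (by
    rintro _ n rfl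
    refine total.hom_ext _ fun p q h => AddCommGrpCat.hom_ext (AddMonoidHom.ext fun a =>
      Subtype.ext ?_)
    refine (tot_d_apply _ _).trans ?_
    refine Eq.trans ?_ (components_d_ι p q n h a).symm
    exact congrArg totD (components_ι p q (n + 1) h a))

end HomologicalComplex₂

end

/-! ### Dimension shifting for two exact functors to chain complexes. -/

section

open Limits

namespace ChainComplex

/-- Dimension shifting along a short exact sequence of complexes whose middle term is acyclic in
the relevant degree. -/
theorem nonempty_homology_iso_kernel {S : ShortComplex (ChainComplex AddCommGrpCat.{u} ℕ)}
    (hS : S.ShortExact) (n : ℕ) (h : IsZero (S.X₂.homology (n + 1))) :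
    Nonempty (S.X₃.homology (n + 1) ≅ kernel (HomologicalComplex.homologyMap S.f n)) := by
  have e := hS.homology_exact₁ (n + 1) n rfl
  have : Mono (hS.δ (n + 1) n rfl) :=
    (hS.homology_exact₃ (n + 1) n rfl).mono_g (h.eq_of_src _ _)
  exact ⟨e.fIsKernel.conePointUniqueUpToIso (limit.isLimit _)⟩

/-- Two exact functors to chain complexes with enough common acyclic objects and isomorphic
homology in degree zero have isomorphic homology. -/
theorem nonempty_homology_iso_of_resolution {D : Type*} [Category* D] [Abelian D]
    (F G : D ⥤ ChainComplex AddCommGrpCat.{u} ℕ) [F.PreservesZeroMorphisms]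
    [G.PreservesZeroMorphisms] (hF : ∀ S : ShortComplex D, S.ShortExact → (S.map F).ShortExact)
    (hG : ∀ S : ShortComplex D, S.ShortExact → (S.map G).ShortExact)
    (res : ∀ A : D, ∃ (P : D) (p : P ⟶ A), Epi p ∧ ∀ n,
      IsZero ((F.obj P).homology (n + 1)) ∧ IsZero ((G.obj P).homology (n + 1)))
    (e : F ⋙ HomologicalComplex.homologyFunctor _ _ 0 ≅
      G ⋙ HomologicalComplex.homologyFunctor _ _ 0) (n : ℕ) :
    ∀ A, Nonempty ((F.obj A).homology n ≅ (G.obj A).homology n) := by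
  induction n with
  | zero => exact fun A => ⟨e.app A⟩
  | succ n ih =>
    intro A
    obtain ⟨P, p, hp, hz⟩ := res A
    let S : ShortComplex D := ShortComplex.mk (kernel.ι p) p (kernel.condition p)
    have hS : S.ShortExact :=
      { exact := ShortComplex.exact_kernel p
        mono_f := inferInstanceAs (Mono (kernel.ι p))
        epi_g := hp }
    obtain ⟨a⟩ := nonempty_homology_iso_kernel (hF S hS) n (hz n).1
    obtain ⟨b⟩ := nonempty_homology_iso_kernel (hG S hS) n (hz n).2
    suffices Nonempty (kernel (HomologicalComplex.homologyMap (S.map F).f n) ≅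
        kernel (HomologicalComplex.homologyMap (S.map G).f n)) from
      ⟨a ≪≫ this.some ≪≫ b.symm⟩
    rcases n with _ | n
    -- Degree 1 is the only one where naturality matters: the kernel is that of a map on H₀, and `e`
    -- identifies the two maps.
    · exact ⟨kernel.mapIso _ _ (e.app S.X₁) (e.app S.X₂) (e.hom.naturality S.f)⟩
    -- Here the target is zero because `P` is acyclic in this degree, so an isomorphism of the
    -- sources without any naturality is enough.
    · obtain ⟨k⟩ := ih S.X₁
      exact ⟨kernel.mapIso _ _ k ((hz n).1.iso (hz n).2) ((hz n).2.eq_of_tgt _ _)⟩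

/-- A comparison of chain complexes in degree zero identifying the boundaries induces a map on
opcycles. -/
noncomputable def opcyclesZeroMap {K L : ChainComplex AddCommGrpCat.{u} ℕ} (e : K.X 0 ⟶ L.X 0)
    (h : ∀ x, ∃ y, e.hom ((K.d 1 0).hom x) = (L.d 1 0).hom y) : K.opcycles 0 ⟶ L.opcycles 0 :=
  K.descOpcycles (e ≫ L.pOpcycles 0) 1 (by simp) (by
    refine AddCommGrpCat.hom_ext (AddMonoidHom.ext fun x => ?_)
    obtain ⟨y, hy⟩ := h x
    refine (congrArg (L.pOpcycles 0).hom hy).trans ?_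
    exact congrArg (fun f => f.hom y) (L.d_pOpcycles 1 0))

theorem p_opcyclesZeroMap {K L : ChainComplex AddCommGrpCat.{u} ℕ} (e : K.X 0 ⟶ L.X 0)
    (h : ∀ x, ∃ y, e.hom ((K.d 1 0).hom x) = (L.d 1 0).hom y) :
    K.pOpcycles 0 ≫ opcyclesZeroMap e h = e ≫ L.pOpcycles 0 :=
  K.p_descOpcycles _ _ _ _

/-- A natural comparison of chain complexes in degree zero identifying the boundaries induces an
isomorphism of homology in degree zero. -/
noncomputable def homologyZeroIso {D : Type*} [Category* D]
    {F G : D ⥤ ChainComplex AddCommGrpCat.{u} ℕ}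
    (e : ∀ A, (F.obj A).X 0 ≅ (G.obj A).X 0)
    (he : ∀ {A B} (f : A ⟶ B), (F.map f).f 0 ≫ (e B).hom = (e A).hom ≫ (G.map f).f 0)
    (h₁ : ∀ A x, ∃ y, (e A).hom.hom (((F.obj A).d 1 0).hom x) = ((G.obj A).d 1 0).hom y)
    (h₂ : ∀ A x, ∃ y, (e A).inv.hom (((G.obj A).d 1 0).hom x) = ((F.obj A).d 1 0).hom y) :
    F ⋙ HomologicalComplex.homologyFunctor _ _ 0 ≅
      G ⋙ HomologicalComplex.homologyFunctor _ _ 0 :=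
  NatIso.ofComponents (fun A => (F.obj A).isoHomologyι₀ ≪≫
    { hom := opcyclesZeroMap (e A).hom (h₁ A)
      inv := opcyclesZeroMap (e A).inv (h₂ A)
      hom_inv_id := by
        rw [← cancel_epi ((F.obj A).pOpcycles 0), ← Category.assoc, p_opcyclesZeroMap,
          Category.assoc, p_opcyclesZeroMap, Category.comp_id, Iso.hom_inv_id_assoc]
      inv_hom_id := by
        rw [← cancel_epi ((G.obj A).pOpcycles 0), ← Category.assoc, p_opcyclesZeroMap,
          Category.assoc, p_opcyclesZeroMap, Category.comp_id, Iso.inv_hom_id_assoc] } ≪≫ (G.obj A).isoHomologyι₀.symm) (fun {A B} f => by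
    have h : opcyclesZeroMap (e A).hom (h₁ A) ≫ HomologicalComplex.opcyclesMap (G.map f) 0 =
        HomologicalComplex.opcyclesMap (F.map f) 0 ≫ opcyclesZeroMap (e B).hom (h₁ B) := by
      rw [← cancel_epi ((F.obj A).pOpcycles 0), ← Category.assoc, p_opcyclesZeroMap,
        Category.assoc, HomologicalComplex.p_opcyclesMap, HomologicalComplex.p_opcyclesMap_assoc,
        p_opcyclesZeroMap, reassoc_of% (he f)]
    have h' := ChainComplex.isoHomologyι₀_inv_naturality (G.map f)
    have h'' := HomologicalComplex.homologyι_naturality (F.map f) 0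
    change HomologicalComplex.homologyMap (F.map f) 0 ≫ (F.obj B).homologyι 0 ≫
        opcyclesZeroMap (e B).hom (h₁ B) ≫ (G.obj B).isoHomologyι₀.inv =
      ((F.obj A).homologyι 0 ≫ opcyclesZeroMap (e A).hom (h₁ A) ≫
        (G.obj A).isoHomologyι₀.inv) ≫ HomologicalComplex.homologyMap (G.map f) 0
    rw [Category.assoc, Category.assoc, h', reassoc_of% h, reassoc_of% h''])

end ChainComplex

end

/-! ### Bisimplicial abelian groups: diagonal, total complex, and their contractions. -/

section

open Limits Simplicial Opposite

/-- Bisimplicial abelian groups. -/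
abbrev BisimplicialAb : Type (u + 1) :=
  SimplexCategoryᵒᵖ ⥤ SimplexCategoryᵒᵖ ⥤ AddCommGrpCat.{u}

namespace BisimplicialAb

/-- The diagonal of a bisimplicial abelian group. -/
def diagonal : BisimplicialAb.{u} ⥤ SimplicialObject AddCommGrpCat.{u} where
  obj A :=
    { obj n := (A.obj n).obj n
      map {m n} f := (A.map f).app m ≫ (A.obj n).map f
      map_id n := by simp
      map_comp f g := by simp }
  map φ := { app n := (φ.app n).app n
             naturality := fun m n f => by
               change ((_ : (_ : AddCommGrpCat) ⟶ _) ≫ _) ≫ _ = _ ≫ (_ ≫ _)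
               rw [Category.assoc, (φ.app n).naturality, ← Category.assoc, ← Category.assoc,
                 ← NatTrans.comp_app, ← NatTrans.comp_app, φ.naturality] }

/-- The chain complex of the diagonal. -/
noncomputable def diagComplex : BisimplicialAb.{u} ⥤ ChainComplex AddCommGrpCat.{u} ℕ :=
  diagonal ⋙ AlgebraicTopology.alternatingFaceMapComplex _

/-- The bicomplex of a bisimplicial abelian group. -/
noncomputable def bicomplex : BisimplicialAb.{u} ⥤
    HomologicalComplex₂ AddCommGrpCat.{u} (ComplexShape.down ℕ) (ComplexShape.down ℕ) :=
  (Functor.whiskeringRight _ _ _).obj (AlgebraicTopology.alternatingFaceMapComplex _) ⋙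
    AlgebraicTopology.alternatingFaceMapComplex _

/-- The total complex of a bisimplicial abelian group. -/
noncomputable def totComplex : BisimplicialAb.{u} ⥤ ChainComplex AddCommGrpCat.{u} ℕ :=
  bicomplex ⋙ HomologicalComplex₂.totFunctor

variable (A : BisimplicialAb.{u})

/-- The groups of a bisimplicial abelian group. -/
abbrev cell (p q : ℕ) : AddCommGrpCat.{u} := (A.obj (op ⦋p⦌)).obj (op ⦋q⦌)

/-- The horizontal structure maps. -/
def hmap {p p' : ℕ} (f : ⦋p⦌ ⟶ ⦋p'⦌) (q : ℕ) : A.cell p' q →+ A.cell p q :=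
  ((A.map f.op).app (op ⦋q⦌)).hom

/-- The vertical structure maps. -/
def vmap (p : ℕ) {q q' : ℕ} (g : ⦋q⦌ ⟶ ⦋q'⦌) : A.cell p q' →+ A.cell p q :=
  ((A.obj (op ⦋p⦌)).map g.op).hom

theorem hmap_vmap {p p' q q' : ℕ} (f : ⦋p⦌ ⟶ ⦋p'⦌) (g : ⦋q⦌ ⟶ ⦋q'⦌) (x : A.cell p' q') :
    A.hmap f q (A.vmap p' g x) = A.vmap p g (A.hmap f q' x) :=
  congrArg (fun f => f.hom x) ((A.map f.op).naturality g.op)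

theorem hmap_hmap {p p' : ℕ} (f : ⦋p⦌ ⟶ ⦋p'⦌) (g : ⦋p'⦌ ⟶ ⦋p⦌) (h : f ≫ g = 𝟙 _) (q : ℕ)
    (x : A.cell p q) : A.hmap f q (A.hmap g q x) = x := by
  have : A.map g.op ≫ A.map f.op = 𝟙 _ := by
    rw [← A.map_comp, ← op_comp, h, op_id, A.map_id]
  exact congrArg (fun f => (f.app (op ⦋q⦌)).hom x) this

theorem vmap_vmap (p : ℕ) {q q' : ℕ} (f : ⦋q⦌ ⟶ ⦋q'⦌) (g : ⦋q'⦌ ⟶ ⦋q⦌) (h : f ≫ g = 𝟙 _)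
    (x : A.cell p q) : A.vmap p f (A.vmap p g x) = x := by
  have : (A.obj (op ⦋p⦌)).map g.op ≫ (A.obj (op ⦋p⦌)).map f.op = 𝟙 _ := by
    rw [← (A.obj _).map_comp, ← op_comp, h, op_id, (A.obj _).map_id]
  exact congrArg (fun f => f.hom x) this

theorem bicomplex_hor_apply (p q : ℕ) (x : A.cell (p + 1) q) :
    (((bicomplex.obj A).d (p + 1) p).f q).hom x =
      ∑ i : Fin (p + 2), (-1 : ℤ) ^ (i : ℕ) • A.hmap (SimplexCategory.δ i) q x := by
  refine (congrArg (fun f : (bicomplex.obj A).X (p + 1) ⟶ (bicomplex.obj A).X p =>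
    (f.f q).hom x) (AlgebraicTopology.alternatingFaceMapComplex_obj_d _ p)).trans ?_
  let F : ((bicomplex.obj A).X (p + 1) ⟶ (bicomplex.obj A).X p) →+
      ((bicomplex.obj A).X p).X q :=
    { toFun := fun f => (f.f q).hom x
      map_zero' := rfl
      map_add' := fun _ _ => rfl }
  refine (map_sum F _ _).trans (Finset.sum_congr rfl fun i _ => ?_)
  exact map_zsmul F _ _

theorem bicomplex_ver_apply (p q : ℕ) (x : A.cell p (q + 1)) :
    (((bicomplex.obj A).X p).d (q + 1) q).hom x =
      ∑ i : Fin (q + 2), (-1 : ℤ) ^ (i : ℕ) • A.vmap p (SimplexCategory.δ i) x :=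
  alternatingFaceMapComplex_d_apply (A.obj (op ⦋p⦌)) q x

theorem diagComplex_d_apply (n : ℕ) (x : A.cell (n + 1) (n + 1)) :
    ((diagComplex.obj A).d (n + 1) n).hom x =
      ∑ i : Fin (n + 2), (-1 : ℤ) ^ (i : ℕ) •
        A.vmap n (SimplexCategory.δ i) (A.hmap (SimplexCategory.δ i) (n + 1) x) :=
  alternatingFaceMapComplex_d_apply (diagonal.obj A) n x

/-! ### Exactness -/

theorem shortExact_app {S : ShortComplex BisimplicialAb.{u}} (hS : S.ShortExact)
    (m n : SimplexCategoryᵒᵖ) :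
    (S.map ((evaluation _ _).obj m ⋙ (evaluation _ _).obj n)).ShortExact :=
  hS.map_of_exact _

instance : diagComplex.{u}.PreservesZeroMorphisms where
  map_zero _ _ := by
    refine HomologicalComplex.hom_ext _ _ fun n => ?_
    rfl

instance : totComplex.{u}.PreservesZeroMorphisms where
  map_zero _ _ := by
    refine HomologicalComplex.hom_ext _ _ fun n => ?_
    rfl

theorem shortExact_diagComplex {S : ShortComplex BisimplicialAb.{u}} (hS : S.ShortExact) :
    (S.map diagComplex).ShortExact :=
  HomologicalComplex.shortExact_of_degreewise_shortExact _ fun n =>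
    shortExact_app hS (op ⦋n⦌) (op ⦋n⦌)

open HomologicalComplex₂

theorem shortExact_totComplex {S : ShortComplex BisimplicialAb.{u}} (hS : S.ShortExact) :
    (S.map totComplex).ShortExact := by
  refine HomologicalComplex.shortExact_of_degreewise_shortExact _ fun n => ?_
  have h : ∀ p q : ℕ, _ := fun p q => shortExact_app hS (op ⦋p⦌) (op ⦋q⦌)
  refine { exact := ?_, mono_f := ?_, epi_g := ?_ }
  · rw [ShortComplex.ab_exact_iff]
    intro (x : (bicomplex.obj S.X₂).totSubgroup n) hx
    have hx' : familyMap (bicomplex.map S.g) x.1 = 0 := congrArg Subtype.val hx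
    have := fun p q => (ShortComplex.ab_exact_iff _).1 (h p q).exact (x.1 p q)
      (congrFun (congrFun hx' p) q)
    choose y hy using this
    refine ⟨(⟨fun p q => y p q, fun p q hpq => ?_⟩ : (bicomplex.obj S.X₁).totSubgroup n),
      Subtype.ext (funext fun p => funext fun q => hy p q)⟩
    refine (h p q).ab_injective_f ((hy p q).trans ?_)
    exact (x.2 p q hpq).trans (map_zero _).symm
  · refine (AddCommGrpCat.mono_iff_injective _).2 fun (x : (bicomplex.obj S.X₁).totSubgroup n)
      (x' : (bicomplex.obj S.X₁).totSubgroup n) hx => Subtype.ext (funext fun p => funext fun q =>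
        (h p q).ab_injective_f ?_)
    exact congrFun (congrFun (congrArg Subtype.val hx) p) q
  · refine (AddCommGrpCat.epi_iff_surjective _).2 fun (y : (bicomplex.obj S.X₃).totSubgroup n) => ?_
    -- The preimage is chosen to be zero off the total degree, so that the chosen family belongs to
    -- the total complex.
    have : ∀ p q : ℕ, ∃ x : S.X₂.cell p q, ((S.g.app (op ⦋p⦌)).app (op ⦋q⦌)).hom x = y.1 p q ∧
        (p + q ≠ n → x = 0) := fun p q => by
      by_cases hpq : p + q = n
      · obtain ⟨x, hx⟩ := (h p q).ab_surjective_g (y.1 p q)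
        exact ⟨x, hx, fun h => absurd hpq h⟩
      · exact ⟨0, (map_zero _).trans (y.2 p q hpq).symm, fun _ => rfl⟩
    choose x hx hx' using this
    exact ⟨(⟨x, hx'⟩ : (bicomplex.obj S.X₂).totSubgroup n), Subtype.ext (funext fun p =>
      funext fun q => hx p q)⟩

/-! ### Homology in degree zero -/

/-- Both complexes agree in degree zero. -/
noncomputable def degreeZeroIso :
    (diagComplex.obj A).X 0 ≅ (totComplex.obj A).X 0 where
  hom := AddCommGrpCat.ofHom ((single (K := bicomplex.obj A) 0 0).codRestrict
    ((bicomplex.obj A).totSubgroup 0) (single_mem rfl))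
  inv := AddCommGrpCat.ofHom
    { toFun := fun x : (bicomplex.obj A).totSubgroup 0 => x.1 0 0
      map_zero' := rfl
      map_add' := fun _ _ => rfl }
  hom_inv_id := AddCommGrpCat.hom_ext (AddMonoidHom.ext fun a =>
    single_self (K := bicomplex.obj A) 0 0 a)
  inv_hom_id := AddCommGrpCat.hom_ext (AddMonoidHom.ext
    fun x : (bicomplex.obj A).totSubgroup 0 => Subtype.ext (funext fun p => funext fun q => by
      change single (K := bicomplex.obj A) 0 0 (x.1 0 0) p q = x.1 p q
      by_cases h : p = 0 ∧ q = 0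
      · obtain ⟨rfl, rfl⟩ := h
        exact single_self 0 0 _
      · rw [single_of_ne h, x.2 p q (by omega)]))

theorem totComplex_d_apply (n : ℕ)
    (x : (bicomplex.obj A).totSubgroup (n + 1)) :
    ((totComplex.obj A).d (n + 1) n).hom x =
      (⟨totD x.1, totD_mem x.2⟩ : (bicomplex.obj A).totSubgroup n) :=
  Subtype.ext (tot_d_apply n x)

theorem bicomplex_hor_one (q : ℕ) (x : A.cell 1 q) : (((bicomplex.obj A).d 1 0).f q).hom x =
    A.hmap (SimplexCategory.δ 0) q x - A.hmap (SimplexCategory.δ 1) q x := by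
  refine (A.bicomplex_hor_apply 0 q x).trans ?_
  simp [Fin.sum_univ_two, sub_eq_add_neg]
  rfl

theorem bicomplex_ver_one (p : ℕ) (x : A.cell p 1) : (((bicomplex.obj A).X p).d 1 0).hom x =
    A.vmap p (SimplexCategory.δ 0) x - A.vmap p (SimplexCategory.δ 1) x := by
  refine (A.bicomplex_ver_apply p 0 x).trans ?_
  simp [Fin.sum_univ_two, sub_eq_add_neg]
  rfl

theorem diagComplex_d_one (x : A.cell 1 1) : ((diagComplex.obj A).d 1 0).hom x =
    A.vmap 0 (SimplexCategory.δ 0) (A.hmap (SimplexCategory.δ 0) 1 x) -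
      A.vmap 0 (SimplexCategory.δ 1) (A.hmap (SimplexCategory.δ 1) 1 x) := by
  refine (A.diagComplex_d_apply 0 x).trans ?_
  simp [Fin.sum_univ_two, sub_eq_add_neg]
  rfl

/-- With h and v the horizontal and vertical faces, h₀v₀ - h₁v₁ = (h₀ - h₁)v₀ + (v₀ - v₁)h₁: the
diagonal of a square is replaced by a path along two sides. -/
theorem single_diagComplex_d_one (x : A.cell 1 1) :
    single (K := bicomplex.obj A) 0 0 (((diagComplex.obj A).d 1 0).hom x) =
      totD (single (K := bicomplex.obj A) 1 0 (A.vmap 1 (SimplexCategory.δ 0) x) +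
        single (K := bicomplex.obj A) 0 1 (A.hmap (SimplexCategory.δ 1) 1 x)) := by
  have e₁ : totD (single (K := bicomplex.obj A) 1 0 (A.vmap 1 (SimplexCategory.δ 0) x)) =
      single (K := bicomplex.obj A) 0 0 (A.hmap (SimplexCategory.δ 0) 0
        (A.vmap 1 (SimplexCategory.δ 0) x) -
          A.hmap (SimplexCategory.δ 1) 0 (A.vmap 1 (SimplexCategory.δ 0) x)) := by
    refine (congrArg₂ (· + ·) (horD_single_succ (K := bicomplex.obj A) 0 0 _)
      (verD_single_zero (K := bicomplex.obj A) 1 _)).trans ((add_zero _).trans ?_)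
    exact congrArg _ (A.bicomplex_hor_one 0 _)
  have e₂ : totD (single (K := bicomplex.obj A) 0 1 (A.hmap (SimplexCategory.δ 1) 1 x)) =
      single (K := bicomplex.obj A) 0 0 (A.vmap 0 (SimplexCategory.δ 0)
        (A.hmap (SimplexCategory.δ 1) 1 x) -
          A.vmap 0 (SimplexCategory.δ 1) (A.hmap (SimplexCategory.δ 1) 1 x)) := by
    refine (congrArg₂ (· + ·) (horD_single_zero (K := bicomplex.obj A) 1 _)
      (verD_single_succ (K := bicomplex.obj A) 0 0 _)).trans ((zero_add _).trans ?_)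
    refine (congrArg (· • _) (pow_zero (-1 : ℤ))).trans ((one_smul _ _).trans ?_)
    exact congrArg _ (A.bicomplex_ver_one 0 _)
  rw [map_add, e₁, e₂]
  refine Eq.trans (congrArg _ ((A.diagComplex_d_one x).trans ?_))
    (map_add (single (K := bicomplex.obj A) 0 0) _ _)
  rw [A.hmap_vmap, A.hmap_vmap]
  exact (sub_add_sub_cancel _ _ _).symm

/-- An edge in one direction becomes a square, degenerate in the other direction, whose diagonal is
that edge. With the previous identity, the boundaries in degree 0 coincide. -/
theorem diagComplex_d_one_degenerate (a : A.cell 1 0) (b : A.cell 0 1) :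
    A.hmap (SimplexCategory.δ 0) 0 a - A.hmap (SimplexCategory.δ 1) 0 a +
      (A.vmap 0 (SimplexCategory.δ 0) b - A.vmap 0 (SimplexCategory.δ 1) b) =
    ((diagComplex.obj A).d 1 0).hom (A.vmap 1 (SimplexCategory.σ 0) a +
      A.hmap (SimplexCategory.σ 0) 1 b) := by
  have h₀ : SimplexCategory.δ 0 ≫ SimplexCategory.σ 0 = 𝟙 ⦋0⦌ :=
    SimplexCategory.δ_comp_σ_self' (i := 0) rfl
  have h₁ : SimplexCategory.δ 1 ≫ SimplexCategory.σ 0 = 𝟙 ⦋0⦌ :=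
    SimplexCategory.δ_comp_σ_succ' (i := 0) rfl
  refine Eq.trans ?_ (A.diagComplex_d_one _).symm
  rw [map_add, map_add, map_add, map_add, A.hmap_vmap, A.hmap_vmap, A.vmap_vmap _ _ _ h₀,
    A.vmap_vmap _ _ _ h₁, A.hmap_hmap _ _ h₀, A.hmap_hmap _ _ h₁]
  exact (add_sub_add_comm _ _ _ _).symm

theorem totD_eq_diagComplex_d_one (y : (bicomplex.obj A).Family) : totD y 0 0 =
    ((diagComplex.obj A).d 1 0).hom (A.vmap 1 (SimplexCategory.σ 0) (y 1 0) +
      A.hmap (SimplexCategory.σ 0) 1 (y 0 1)) :=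
  (congrArg₂ (· + ·) (A.bicomplex_hor_one 0 (y 1 0)) ((congrArg (· • _)
    (pow_zero (-1 : ℤ))).trans ((one_smul _ _).trans (A.bicomplex_ver_one 0 (y 0 1))))).trans
      (A.diagComplex_d_one_degenerate _ _)

/-- The diagonal and the total complex have the same homology in degree zero. -/
noncomputable def diagTotHomologyZeroIso :
    diagComplex.{u} ⋙ HomologicalComplex.homologyFunctor _ _ 0 ≅
      totComplex ⋙ HomologicalComplex.homologyFunctor _ _ 0 := by
  refine ChainComplex.homologyZeroIso degreeZeroIso (fun {A B} f => ?_) (fun A x => ?_)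
    fun A y => ?_
  · refine AddCommGrpCat.hom_ext (AddMonoidHom.ext fun a => Subtype.ext (funext fun p =>
      funext fun q => ?_))
    change single (K := bicomplex.obj B) 0 0 (((bicomplex.map f).f 0).f 0 a) p q =
      ((bicomplex.map f).f p).f q (single (K := bicomplex.obj A) 0 0 a p q)
    by_cases h : p = 0 ∧ q = 0
    · obtain ⟨rfl, rfl⟩ := h
      exact (single_self _ _ _).trans (congrArg _ (single_self (K := bicomplex.obj A) _ _ a).symm)
    · refine (single_of_ne h _).trans (Eq.symm ?_)
      exact (congrArg _ (single_of_ne h _)).trans (map_zero _)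
  · have h := A.single_diagComplex_d_one x
    let y : (bicomplex.obj A).totSubgroup 1 :=
      ⟨single (K := bicomplex.obj A) 1 0 (A.vmap 1 (SimplexCategory.δ 0) x) +
        single (K := bicomplex.obj A) 0 1 (A.hmap (SimplexCategory.δ 1) 1 x),
      add_mem (single_mem (p := 1) (q := 0) rfl _) (single_mem (p := 0) (q := 1) rfl _)⟩
    have e : (⟨single (K := bicomplex.obj A) 0 0 (((diagComplex.obj A).d 1 0).hom x),
        single_mem (p := 0) (q := 0) rfl _⟩ : (bicomplex.obj A).totSubgroup 0) =
        ⟨totD y.1, totD_mem (n := 0) y.2⟩ := Subtype.ext h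
    exact ⟨y, e.trans (Subtype.ext (tot_d_apply (K := bicomplex.obj A) 0 y).symm)⟩
  · refine ⟨_, Eq.trans ?_ (A.totD_eq_diagComplex_d_one (Subtype.val
      (p := (· ∈ (bicomplex.obj A).totSubgroup 1)) y))⟩
    exact congrArg (fun z : (bicomplex.obj A).totSubgroup 0 => z.1 0 0) (A.totComplex_d_apply 0 y)

/-! ### Contractions -/

theorem isZero_homology_of_contraction {C : ChainComplex AddCommGrpCat.{u} ℕ}
    (s : ∀ n, C.X n →+ C.X (n + 1)) (hs : ∀ n x, (C.d (n + 1 + 1) (n + 1)).hom (s (n + 1) x) +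
      s n ((C.d (n + 1) n).hom x) = x) (n : ℕ) : IsZero (C.homology (n + 1)) := by
  refine ChainComplex.isZero_homology_of_elements fun x hx => ⟨s _ x, ?_⟩
  have := hs n x
  rwa [hx n, map_zero, add_zero, eq_comm] at this

/-- The columns are contracted in positive degrees by `s`, compatibly with the horizontal
differential, and the bottom row by `t`. A cycle is first moved into the bottom row and then bounded
there. -/
theorem isZero_homology_tot {K : HomologicalComplex₂ AddCommGrpCat.{u} (ComplexShape.down ℕ)
      (ComplexShape.down ℕ)}
    (s : ∀ p q, (K.X p).X q →+ (K.X p).X (q + 1)) (t : ∀ p, (K.X p).X 0 →+ (K.X (p + 1)).X 0)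
    (hs : ∀ p q x, ((K.X p).d (q + 1 + 1) (q + 1)).hom (s p (q + 1) x) +
      s p q (((K.X p).d (q + 1) q).hom x) = x)
    (hsd : ∀ p q x, ((K.d (p + 1) p).f (q + 1)).hom (s (p + 1) q x) =
      s p q (((K.d (p + 1) p).f q).hom x))
    (ht : ∀ p x, ((K.d (p + 1 + 1) (p + 1)).f 0).hom (t (p + 1) x) +
      t p (((K.d (p + 1) p).f 0).hom x) = x) (n : ℕ) : IsZero (K.tot.homology (n + 1)) := by
  refine ChainComplex.isZero_homology_of_elements fun (x : K.totSubgroup (n + 1)) hx => ?_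
  have hx' : totD x.1 = 0 := (tot_d_apply n x).symm.trans (congrArg Subtype.val (hx n))
  -- The sign cancels that of the vertical differential; `totD y` then agrees with `x` above the
  -- bottom row.
  let y : K.Family := fun p q => match q with
    | 0 => 0
    | q + 1 => (-1 : ℤ) ^ p • s p q (x.1 p q)
  have hy : y ∈ K.totSubgroup (n + 2) := by
    rintro p (_ | q) h
    · rfl
    · change (-1 : ℤ) ^ p • s p q (x.1 p q) = 0
      rw [x.2 p q (by omega), map_zero, smul_zero]
  have hz : ∀ p q, totD y p (q + 1) = x.1 p (q + 1) := fun p q => by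
    have h := congrFun (congrFun hx' p) q
    rw [totD_apply] at h ⊢
    change ((K.d (p + 1) p).f (q + 1)).hom ((-1 : ℤ) ^ (p + 1) • s (p + 1) q (x.1 (p + 1) q)) +
      (-1 : ℤ) ^ p • ((K.X p).d (q + 1 + 1) (q + 1)).hom
        ((-1 : ℤ) ^ p • s p (q + 1) (x.1 p (q + 1))) = _
    have h' : ((K.d (p + 1) p).f q).hom (x.1 (p + 1) q) =
      -((-1 : ℤ) ^ p • ((K.X p).d (q + 1) q).hom (x.1 p (q + 1))) := eq_neg_of_add_eq_zero_left h
    have e : (-1 : ℤ) ^ p * (-1) ^ p = 1 := by rw [← mul_pow]; simp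
    rw [map_zsmul, map_zsmul, smul_smul, e, one_smul, hsd, h', map_neg, map_zsmul, pow_succ,
      smul_neg, smul_smul, mul_neg_one, neg_mul, e, neg_smul, one_smul, neg_neg]
    exact (add_comm _ _).trans (hs p q _)
  let z : K.Family := x.1 - totD y
  have hzD : totD z = 0 := by
    rw [map_sub, hx', totD_totD, sub_zero]
  have hz₀ : ∀ p q, z p (q + 1) = 0 := fun p q => sub_eq_zero.2 (hz p q).symm
  have hzm : z ∈ K.totSubgroup (n + 1) := sub_mem x.2 (totD_mem hy)
  -- The cycle `z` lies in the bottom row, at the position (n + 1, 0) of positive degree, where `t`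
  -- provides a bounding chain.
  let w : K.Family := fun p q => match p, q with
    | p + 1, 0 => t p (z p 0)
    | 0, _ => 0
    | _, _ + 1 => 0
  have hw : w ∈ K.totSubgroup (n + 2) := by
    rintro (_ | p) (_ | q) h
    · rfl
    · rfl
    · change t p (z p 0) = 0
      rw [hzm p 0 (by omega), map_zero]
    · rfl
  have hw₀ : ∀ p q, w p (q + 1) = 0 := by
    rintro (_ | p) q <;> rfl
  have hwz : totD w = z := by
    funext p q
    rw [totD_apply, hw₀, map_zero, smul_zero, add_zero]
    rcases q with _ | q
    · change ((K.d (p + 1) p).f 0).hom (t p (z p 0)) = z p 0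
      rcases p with _ | p
      · rw [hzm 0 0 (by omega), map_zero, map_zero]
      · have h := congrFun (congrFun hzD p) 0
        rw [totD_apply, hz₀, map_zero, smul_zero, add_zero] at h
        have h' := ht p (z (p + 1) 0)
        rw [h] at h'
        exact ((add_zero _).symm.trans (congrArg _ (map_zero _).symm)).trans h'
    · exact (congrArg _ (hw₀ (p + 1) q)).trans ((map_zero _).trans (hz₀ p q).symm)
  refine ⟨(⟨y + w, add_mem hy hw⟩ : K.totSubgroup (n + 2)), Subtype.ext ?_⟩
  refine Eq.trans ?_ (tot_d_apply (n + 1) _).symm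
  rw [map_add, hwz]
  exact (add_sub_cancel _ _).symm

end BisimplicialAb

end

/-! ### Free resolutions by coproducts of representables, and the diagonal theorem. -/

section

open Limits Simplicial Opposite

namespace SimplexCategory

/-- Prepending the initial vertex to a map of ordinals. -/
abbrev prepend {n : ℕ} {Δ : SimplexCategory} (f : ⦋n⦌ ⟶ Δ) : ⦋n + 1⦌ ⟶ Δ :=
  SSet.Augmented.StandardSimplex.shift f

theorem δ_zero_prepend {n : ℕ} {Δ : SimplexCategory} (f : ⦋n⦌ ⟶ Δ) : δ 0 ≫ prepend f = f := by
  ext i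
  rfl

theorem δ_succ_prepend {n : ℕ} {Δ : SimplexCategory} (f : ⦋n + 1⦌ ⟶ Δ) (i : Fin (n + 2)) :
    δ i.succ ≫ prepend f = prepend (δ i ≫ f) := by
  ext j
  refine Fin.cases ?_ (fun j => ?_) j
  · change (SSet.Augmented.StandardSimplex.shiftFun f.toOrderHom (Fin.succAbove i.succ 0)).val = 0
    rw [Fin.succ_succAbove_zero]
    rfl
  · change (SSet.Augmented.StandardSimplex.shiftFun f.toOrderHom (Fin.succAbove i.succ j.succ)).val =
      (f.toOrderHom (Fin.succAbove i j)).val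
    rw [Fin.succ_succAbove_succ]
    rfl

end SimplexCategory

/-- An extra degeneracy: face 0 undoes `s`, and face i + 1 becomes face i with the opposite sign, so
all other terms cancel in pairs. -/
theorem sum_faces_contraction {n : ℕ} {L M N : Type*} [AddCommGroup L] [AddCommGroup M]
    [AddCommGroup N] (d : Fin (n + 3) → L →+ M) (d' : Fin (n + 2) → M →+ N) (s : M →+ L)
    (s' : N →+ M) (h₀ : ∀ x, d 0 (s x) = x) (h : ∀ i x, d i.succ (s x) = s' (d' i x)) (x : M) :
    ∑ i : Fin (n + 3), (-1 : ℤ) ^ (i : ℕ) • d i (s x) +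
      s' (∑ i : Fin (n + 2), (-1 : ℤ) ^ (i : ℕ) • d' i x) = x := by
  rw [Fin.sum_univ_succ, Fin.val_zero, pow_zero, one_smul, h₀, map_sum, add_assoc,
    ← Finset.sum_add_distrib]
  refine add_eq_left.2 (Finset.sum_eq_zero fun i _ => ?_)
  rw [map_zsmul, h, Fin.val_succ, pow_succ, mul_neg_one, neg_smul, neg_add_cancel]

namespace BisimplicialAb

/-- The free bisimplicial abelian group on a bisimplicial set. -/
noncomputable def free : (SimplexCategoryᵒᵖ ⥤ SSet.{u}) ⥤ BisimplicialAb.{u} :=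
  (Functor.whiskeringRight _ _ _).obj ((Functor.whiskeringRight _ _ _).obj freeAb)

section Free

variable {X : SimplexCategoryᵒᵖ ⥤ SSet.{u}}

/-- The generators of a free bisimplicial abelian group. -/
noncomputable def gen {p q : ℕ} (x : (X.obj (op ⦋p⦌)).obj (op ⦋q⦌)) : (free.obj X).cell p q :=
  Finsupp.single x 1

theorem free_hom_ext' {p q : ℕ} {M : Type*} [AddCommGroup M] {f g : (free.obj X).cell p q →+ M}
    (h : ∀ x, f (gen x) = g (gen x)) : f = g :=
  free_hom_ext h

/-- The extension of a map to a free bisimplicial abelian group. -/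
noncomputable def freeDesc {p q : ℕ} {M : Type*} [AddCommGroup M]
    (f : (X.obj (op ⦋p⦌)).obj (op ⦋q⦌) → M) : (free.obj X).cell p q →+ M :=
  freeLift f

theorem freeDesc_gen {p q : ℕ} {M : Type*} [AddCommGroup M]
    (f : (X.obj (op ⦋p⦌)).obj (op ⦋q⦌) → M) (x) : freeDesc f (gen x) = f x :=
  freeLift_single f x

theorem hmap_gen {p p' q : ℕ} (f : ⦋p⦌ ⟶ ⦋p'⦌) (x : (X.obj (op ⦋p'⦌)).obj (op ⦋q⦌)) :
    (free.obj X).hmap f q (gen x) = gen ((X.map f.op).app (op ⦋q⦌) x) :=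
  freeAb_map_single _ _ _

theorem vmap_gen {p q q' : ℕ} (g : ⦋q⦌ ⟶ ⦋q'⦌) (x : (X.obj (op ⦋p⦌)).obj (op ⦋q'⦌)) :
    (free.obj X).vmap p g (gen x) = gen ((X.obj (op ⦋p⦌)).map g.op x) :=
  freeAb_map_single _ _ _

end Free

variable (A : BisimplicialAb.{u})

/-- The generators of the free resolution: an element in some bidegree, together with maps of
simplices to that bidegree. -/
structure Gen (m n : SimplexCategory) : Type u where
  p : SimplexCategory
  q : SimplexCategory
  elem : (A.obj (op p)).obj (op q)
  f : m ⟶ p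
  g : n ⟶ q

/-- The bisimplicial set of generators of the free resolution, a coproduct of representables. -/
def generators : SimplexCategoryᵒᵖ ⥤ SSet.{u} where
  obj m :=
    { obj n := A.Gen m.unop n.unop
      map g := ↾fun x => ⟨x.p, x.q, x.elem, x.f, g.unop ≫ x.g⟩ }
  map f := { app n := ↾fun x => ⟨x.p, x.q, x.elem, f.unop ≫ x.f, x.g⟩ }

/-- A free bisimplicial abelian group mapping onto a given one. -/
noncomputable abbrev resolution : BisimplicialAb.{u} := free.obj A.generators

/-- The augmentation of the resolution. -/
noncomputable def augmentation : A.resolution ⟶ A where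
  app m :=
    { app n := AddCommGrpCat.ofHom (freeLift fun x : A.Gen m.unop n.unop =>
        ((A.map x.f.op).app n).hom (((A.obj (op x.p)).map x.g.op).hom x.elem))
      naturality := fun n n' g => AddCommGrpCat.hom_ext (free_hom_ext fun x : A.Gen _ _ => by
        refine (congrArg _ (freeAb_map_single _ _ _)).trans ((freeLift_single _ _).trans
          (Eq.symm ?_))
        refine (congrArg ((A.obj m).map g).hom (freeLift_single _ _)).trans ?_
        refine (congrArg (fun h => h.hom (((A.obj (op x.p)).map x.g.op).hom x.elem))
          ((A.map x.f.op).naturality g)).symm.trans (congrArg ((A.map x.f.op).app n').hom ?_)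
        exact congrArg (fun h => h.hom x.elem) ((A.obj (op x.p)).map_comp x.g.op g).symm) }
  naturality := fun m m' f => by
    ext n : 2
    refine free_hom_ext (α := A.Gen m.unop n.unop) fun x => ?_
    refine (congrArg _ (freeAb_map_single _ _ _)).trans ((freeLift_single _ _).trans (Eq.symm ?_))
    refine (congrArg ((A.map f).app n).hom (freeLift_single _ _)).trans ?_
    exact congrArg (fun h => (h.app n).hom (((A.obj (op x.p)).map x.g.op).hom x.elem))
      (A.map_comp x.f.op f).symm

instance : Epi A.augmentation := by
  have : ∀ m, Epi (A.augmentation.app m) := fun m => by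
    have : ∀ n, Epi ((A.augmentation.app m).app n) := fun n =>
      (AddCommGrpCat.epi_iff_surjective _).2 fun a =>
        ⟨(Finsupp.single ⟨m.unop, n.unop, a, 𝟙 _, 𝟙 _⟩ 1 : A.Gen m.unop n.unop →₀ ℤ), by
          refine (freeLift_single _ _).trans ?_
          change ((A.map (𝟙 m)).app n).hom (((A.obj m).map (𝟙 n)).hom a) = a
          rw [A.map_id, (A.obj m).map_id]
          rfl⟩
    exact NatTrans.epi_of_epi_app _
  exact NatTrans.epi_of_epi_app _

variable {A}

/-- Prepending a vertex to a generator, horizontally. -/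
def horPrependGen {p q : ℕ} (x : A.Gen ⦋p⦌ ⦋q⦌) : (A.generators.obj (op ⦋p + 1⦌)).obj (op ⦋q⦌) :=
  (⟨x.p, x.q, x.elem, SimplexCategory.prepend x.f, x.g⟩ : A.Gen ⦋p + 1⦌ ⦋q⦌)

/-- Prepending a vertex to a generator, vertically. -/
def verPrependGen {p q : ℕ} (x : A.Gen ⦋p⦌ ⦋q⦌) : (A.generators.obj (op ⦋p⦌)).obj (op ⦋q + 1⦌) :=
  (⟨x.p, x.q, x.elem, x.f, SimplexCategory.prepend x.g⟩ : A.Gen ⦋p⦌ ⦋q + 1⦌)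

variable (A)

/-- The horizontal contraction of the resolution. -/
noncomputable def horPrepend (p q : ℕ) : A.resolution.cell p q →+ A.resolution.cell (p + 1) q :=
  freeDesc fun x => gen (horPrependGen x)

/-- The vertical contraction of the resolution. -/
noncomputable def verPrepend (p q : ℕ) : A.resolution.cell p q →+ A.resolution.cell p (q + 1) :=
  freeDesc fun x => gen (verPrependGen x)

variable {A} in
theorem horPrepend_gen {p q : ℕ} (x : (A.generators.obj (op ⦋p⦌)).obj (op ⦋q⦌)) :
    A.horPrepend p q (gen x) = gen (horPrependGen x) :=
  freeDesc_gen _ _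

variable {A} in
theorem verPrepend_gen {p q : ℕ} (x : (A.generators.obj (op ⦋p⦌)).obj (op ⦋q⦌)) :
    A.verPrepend p q (gen x) = gen (verPrependGen x) :=
  freeDesc_gen _ _

theorem hmap_zero_horPrepend (p q : ℕ) (x : A.resolution.cell p q) :
    A.resolution.hmap (SimplexCategory.δ 0) q (A.horPrepend p q x) = x := by
  refine DFunLike.congr_fun (f := (A.resolution.hmap (SimplexCategory.δ 0) q).comp
    (A.horPrepend p q)) (g := AddMonoidHom.id _) (free_hom_ext' fun x => ?_) x
  rw [AddMonoidHom.comp_apply, horPrepend_gen, hmap_gen]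
  exact congrArg (fun f => gen (X := A.generators) (⟨x.p, x.q, x.elem, f, x.g⟩ : A.Gen _ _))
    (SimplexCategory.δ_zero_prepend x.f)

theorem hmap_succ_horPrepend (p q : ℕ) (i : Fin (p + 2)) (x : A.resolution.cell (p + 1) q) :
    A.resolution.hmap (SimplexCategory.δ i.succ) q (A.horPrepend (p + 1) q x) =
      A.horPrepend p q (A.resolution.hmap (SimplexCategory.δ i) q x) := by
  refine DFunLike.congr_fun (f := (A.resolution.hmap (SimplexCategory.δ i.succ) q).comp
    (A.horPrepend (p + 1) q)) (g := (A.horPrepend p q).comp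
    (A.resolution.hmap (SimplexCategory.δ i) q)) (free_hom_ext' fun x => ?_) x
  rw [AddMonoidHom.comp_apply, AddMonoidHom.comp_apply, horPrepend_gen, hmap_gen, hmap_gen,
    horPrepend_gen]
  exact congrArg (fun f => gen (X := A.generators) (⟨x.p, x.q, x.elem, f, x.g⟩ : A.Gen _ _))
    (SimplexCategory.δ_succ_prepend x.f i)

theorem vmap_horPrepend (p : ℕ) {q q' : ℕ} (g : ⦋q⦌ ⟶ ⦋q'⦌) (x : A.resolution.cell p q') :
    A.resolution.vmap (p + 1) g (A.horPrepend p q' x) =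
      A.horPrepend p q (A.resolution.vmap p g x) := by
  refine DFunLike.congr_fun (f := (A.resolution.vmap (p + 1) g).comp (A.horPrepend p q'))
    (g := (A.horPrepend p q).comp (A.resolution.vmap p g)) (free_hom_ext' fun x => ?_) x
  rw [AddMonoidHom.comp_apply, AddMonoidHom.comp_apply, horPrepend_gen, vmap_gen, vmap_gen,
    horPrepend_gen]
  rfl

theorem vmap_zero_verPrepend (p q : ℕ) (x : A.resolution.cell p q) :
    A.resolution.vmap p (SimplexCategory.δ 0) (A.verPrepend p q x) = x := by
  refine DFunLike.congr_fun (f := (A.resolution.vmap p (SimplexCategory.δ 0)).comp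
    (A.verPrepend p q)) (g := AddMonoidHom.id _) (free_hom_ext' fun x => ?_) x
  rw [AddMonoidHom.comp_apply, verPrepend_gen, vmap_gen]
  exact congrArg (fun g => gen (X := A.generators) (⟨x.p, x.q, x.elem, x.f, g⟩ : A.Gen _ _))
    (SimplexCategory.δ_zero_prepend x.g)

theorem vmap_succ_verPrepend (p q : ℕ) (i : Fin (q + 2)) (x : A.resolution.cell p (q + 1)) :
    A.resolution.vmap p (SimplexCategory.δ i.succ) (A.verPrepend p (q + 1) x) =
      A.verPrepend p q (A.resolution.vmap p (SimplexCategory.δ i) x) := by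
  refine DFunLike.congr_fun (f := (A.resolution.vmap p (SimplexCategory.δ i.succ)).comp
    (A.verPrepend p (q + 1))) (g := (A.verPrepend p q).comp
    (A.resolution.vmap p (SimplexCategory.δ i))) (free_hom_ext' fun x => ?_) x
  rw [AddMonoidHom.comp_apply, AddMonoidHom.comp_apply, verPrepend_gen, vmap_gen, vmap_gen,
    verPrepend_gen]
  exact congrArg (fun g => gen (X := A.generators) (⟨x.p, x.q, x.elem, x.f, g⟩ : A.Gen _ _))
    (SimplexCategory.δ_succ_prepend x.g i)

theorem hmap_verPrepend {p p' : ℕ} (f : ⦋p⦌ ⟶ ⦋p'⦌) (q : ℕ) (x : A.resolution.cell p' q) :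
    A.resolution.hmap f (q + 1) (A.verPrepend p' q x) =
      A.verPrepend p q (A.resolution.hmap f q x) := by
  refine DFunLike.congr_fun (f := (A.resolution.hmap f (q + 1)).comp (A.verPrepend p' q))
    (g := (A.verPrepend p q).comp (A.resolution.hmap f q)) (free_hom_ext' fun x => ?_) x
  rw [AddMonoidHom.comp_apply, AddMonoidHom.comp_apply, verPrepend_gen, hmap_gen, hmap_gen,
    verPrepend_gen]
  rfl

theorem isZero_homology_totComplex_resolution (n : ℕ) :
    IsZero ((totComplex.obj A.resolution).homology (n + 1)) := by
  refine isZero_homology_tot (K := bicomplex.obj A.resolution) A.verPrepend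
    (fun p => A.horPrepend p 0) (fun p q x => ?_) (fun p q x => ?_) (fun p x => ?_) n
  · refine (congrArg₂ (· + ·) (A.resolution.bicomplex_ver_apply p (q + 1) _) (congrArg _
      (A.resolution.bicomplex_ver_apply p q x))).trans ?_
    exact sum_faces_contraction (fun i => A.resolution.vmap p (SimplexCategory.δ i))
      (fun i => A.resolution.vmap p (SimplexCategory.δ i)) _ _ (A.vmap_zero_verPrepend p _)
      (A.vmap_succ_verPrepend p q) x
  · refine (A.resolution.bicomplex_hor_apply p (q + 1) _).trans (Eq.trans ?_
      (congrArg (A.verPrepend p q) (A.resolution.bicomplex_hor_apply p q x)).symm)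
    rw [map_sum]
    refine Finset.sum_congr rfl fun i _ => ?_
    rw [map_zsmul]
    exact congrArg (_ • ·) (A.hmap_verPrepend _ q x)
  · refine (congrArg₂ (· + ·) (A.resolution.bicomplex_hor_apply (p + 1) 0 _) (congrArg _
      (A.resolution.bicomplex_hor_apply p 0 x))).trans ?_
    exact sum_faces_contraction (fun i => A.resolution.hmap (SimplexCategory.δ i) 0)
      (fun i => A.resolution.hmap (SimplexCategory.δ i) 0) _ _ (A.hmap_zero_horPrepend _ 0)
      (A.hmap_succ_horPrepend p 0) x

/-- Prepending a vertex in both directions at once is an extra degeneracy of the diagonal. -/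
theorem isZero_homology_diagComplex_resolution (n : ℕ) :
    IsZero ((diagComplex.obj A.resolution).homology (n + 1)) := by
  refine isZero_homology_of_contraction
    (fun n => (A.verPrepend (n + 1) n).comp (A.horPrepend n n)) (fun n x => ?_) n
  refine (congrArg₂ (· + ·) (A.resolution.diagComplex_d_apply (n + 1) _) (congrArg _
    (A.resolution.diagComplex_d_apply n x))).trans ?_
  refine sum_faces_contraction (fun i => (A.resolution.vmap (n + 1) (SimplexCategory.δ i)).comp
    (A.resolution.hmap (SimplexCategory.δ i) (n + 2)))
    (fun i => (A.resolution.vmap n (SimplexCategory.δ i)).comp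
    (A.resolution.hmap (SimplexCategory.δ i) (n + 1)))
    ((A.verPrepend (n + 2) (n + 1)).comp (A.horPrepend (n + 1) (n + 1)))
    ((A.verPrepend (n + 1) n).comp (A.horPrepend n n)) (fun x => ?_) (fun i x => ?_) x
  · simp only [AddMonoidHom.comp_apply]
    rw [hmap_verPrepend, vmap_zero_verPrepend, hmap_zero_horPrepend]
  · simp only [AddMonoidHom.comp_apply]
    rw [hmap_verPrepend, vmap_succ_verPrepend, hmap_succ_horPrepend, vmap_horPrepend]

/-- The diagonal and the total complex of a bisimplicial abelian group have isomorphic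
homology. -/
theorem nonempty_homology_diagComplex_iso_totComplex (n : ℕ) :
    Nonempty ((diagComplex.obj A).homology n ≅ (totComplex.obj A).homology n) :=
  ChainComplex.nonempty_homology_iso_of_resolution diagComplex totComplex
    (fun _ => shortExact_diagComplex) (fun _ => shortExact_totComplex)
    (fun A => ⟨A.resolution, A.augmentation, inferInstance, fun n =>
      ⟨A.isZero_homology_diagComplex_resolution n, A.isZero_homology_totComplex_resolution n⟩⟩)
    diagTotHomologyZeroIso n A

end BisimplicialAb

end

section

open Simplicial Opposite TensorProduct

/-! ### The bar construction and the nerve of a group -/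

namespace BarTensor

variable {G : Type u} [Group G]

/-- The simplex of the nerve of a group given by a tuple of elements, up to left translation. -/
def nerveSimplex {n : ℕ} (f : Fin (n + 1) → G) : (nerve (SingleObj G)) _⦋n⦌ :=
  ({ obj := fun _ => SingleObj.star G
     map := fun {i j} _ => (f j)⁻¹ * f i
     map_id := fun i => inv_mul_cancel (f i)
     map_comp := fun {i j k} _ _ => by
       rw [SingleObj.comp_as_mul]
       group } : Fin (n + 1) ⥤ SingleObj G)

/-- The edges of a simplex of the nerve of a group. -/
def edge {n : ℕ} (x : (nerve (SingleObj G)) _⦋n⦌) {i j : Fin (n + 1)} (h : i ≤ j) : G :=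
  CategoryTheory.Functor.map (C := Fin (n + 1)) (D := SingleObj G) x (homOfLE h)

theorem edge_self {n : ℕ} (x : (nerve (SingleObj G)) _⦋n⦌) (i : Fin (n + 1)) :
    edge x (le_refl i) = 1 :=
  CategoryTheory.Functor.map_id (C := Fin (n + 1)) (D := SingleObj G) x i

theorem edge_mul_edge {n : ℕ} (x : (nerve (SingleObj G)) _⦋n⦌) {i j k : Fin (n + 1)} (h : i ≤ j)
    (h' : j ≤ k) : edge x h' * edge x h = edge x (h.trans h') :=
  (CategoryTheory.Functor.map_comp (C := Fin (n + 1)) (D := SingleObj G) x (homOfLE h) (homOfLE h')).symm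

theorem nerve_ext {n : ℕ} {x y : (nerve (SingleObj G)) _⦋n⦌}
    (h : ∀ {i j : Fin (n + 1)} (h : i ≤ j), edge x h = edge y h) : x = y :=
  CategoryTheory.Functor.hext (C := Fin (n + 1)) (D := SingleObj G) (fun _ => rfl)
    fun _ _ f => heq_of_eq (h (leOfHom f))

theorem nerveSimplex_mul_left {n : ℕ} (g : G) (f : Fin (n + 1) → G) :
    nerveSimplex (fun i => g * f i) = nerveSimplex f :=
  nerve_ext fun {i j} h => by
    change (g * f j)⁻¹ * (g * f i) = (f j)⁻¹ * f i
    group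

theorem nerveMap_nerveSimplex {G' : Type u} [Group G'] (φ : G →* G') {n : ℕ}
    (f : Fin (n + 1) → G) :
    (nerveMap (SingleObj.mapHom G G' φ)).app (op ⦋n⦌) (nerveSimplex f) =
      nerveSimplex fun i => φ (f i) :=
  nerve_ext fun {i j} h => by
    change φ ((f j)⁻¹ * f i) = (φ (f j))⁻¹ * φ (f i)
    rw [map_mul, map_inv]

/-- The vertices of the simplex given by the entries of a bar symbol. -/
def vertices {n : ℕ} (g : Fin (n + 1) → G) (i : Fin (n + 1)) : G :=
  Fin.partialProd g i.succ

/-- Multiplying two neighbouring entries omits one partial product, and forgetting the last entry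
omits the last one. The bar differential is therefore the alternating sum of the faces of the nerve.
-/
theorem vertices_contractNth {n : ℕ} (i : Fin (n + 2)) (g : Fin (n + 2) → G) :
    vertices (Fin.contractNth i (· * ·) g) = fun k => vertices g (i.succAbove k) := by
  funext k
  change Fin.partialProd (Fin.contractNth i (· * ·) g) k.succ = _
  rw [Fin.partialProd_contractNth, Function.comp_apply, Fin.succ_succAbove_succ]
  rfl

theorem vertices_update {n : ℕ} (c : G) (g : Fin (n + 1) → G) :
    vertices (Function.update g 0 (c * g 0)) = fun k => c * vertices g k := by
  funext k
  change Fin.partialProd _ k.succ = c * Fin.partialProd _ k.succ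
  rw [Fin.partialProd_succ', Fin.partialProd_succ', Function.update_self, mul_assoc]
  have : Fin.tail (Function.update g 0 (c * g 0)) = Fin.tail g :=
    funext fun i => Function.update_of_ne (Fin.succ_ne_zero i) _ _
  rw [this]

theorem vertices_map {G' : Type u} [Group G'] (φ : G →* G') {n : ℕ} (g : Fin (n + 1) → G) :
    vertices (fun i => φ (g i)) = fun i => φ (vertices g i) := by
  funext k
  change Fin.partialProd (fun i => φ (g i)) k.succ = φ (Fin.partialProd g k.succ)
  generalize k.succ = j
  induction j using Fin.induction with
  | zero => rw [Fin.partialProd_zero, Fin.partialProd_zero, map_one]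
  | succ j ih => rw [Fin.partialProd_succ, Fin.partialProd_succ, map_mul, ih]

theorem vertices_zero {n : ℕ} (g : Fin (n + 1) → G) : vertices g 0 = g 0 := by
  change Fin.partialProd g (Fin.succ 0) = g 0
  rw [Fin.partialProd_succ, Fin.castSucc_zero, Fin.partialProd_zero, one_mul]

theorem vertices_succ {n : ℕ} (g : Fin (n + 1) → G) (i : Fin n) :
    vertices g i.succ = vertices g i.castSucc * g i.succ :=
  Fin.partialProd_succ g i.succ

/-- The bar symbol of a simplex of the nerve of a group. -/
def symbol {n : ℕ} (x : (nerve (SingleObj G)) _⦋n⦌) : Fin (n + 1) → G :=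
  Fin.cons 1 fun k : Fin n => (edge x (Fin.castSucc_le_succ k))⁻¹

theorem vertices_symbol {n : ℕ} (x : (nerve (SingleObj G)) _⦋n⦌) (i : Fin (n + 1)) :
    vertices (symbol x) i = (edge x (Fin.zero_le i))⁻¹ := by
  induction i using Fin.induction with
  | zero => rw [vertices_zero, edge_self, inv_one]; rfl
  | succ i ih =>
    rw [vertices_succ, ih, ← edge_mul_edge x (Fin.zero_le i.castSucc) (Fin.castSucc_le_succ i),
      mul_inv_rev]
    rfl

theorem nerveSimplex_symbol {n : ℕ} (x : (nerve (SingleObj G)) _⦋n⦌) :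
    nerveSimplex (vertices (symbol x)) = x :=
  nerve_ext fun {i j} h => by
    change (vertices (symbol x) j)⁻¹ * vertices (symbol x) i = _
    rw [vertices_symbol, vertices_symbol, inv_inv, ← edge_mul_edge x (Fin.zero_le i) h,
      mul_inv_cancel_right]

/-- The simplex forgets only the leading entry, that is, the position of the tuple within its orbit
under left translation; `symbol` picks the representative that starts with 1. -/
theorem symbol_nerveSimplex {n : ℕ} (g : Fin (n + 1) → G) :
    symbol (nerveSimplex (vertices g)) = Function.update g 0 1 := by
  funext i
  refine Fin.cases ?_ (fun i => ?_) i
  · rw [Function.update_self]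
    rfl
  · rw [Function.update_of_ne (Fin.succ_ne_zero i)]
    change ((vertices g i.succ)⁻¹ * vertices g i.castSucc)⁻¹ = g i.succ
    rw [vertices_succ]
    group

variable {A : Type} [AddCommGroup A] {ρ : G →* AddMonoid.End A}

theorem hom_ext {m : ℕ} {M : Type*} [AddCommGroup M] {f g : BarTensor ρ m →+ M}
    (h : ∀ x a, f (QuotientAddGroup.mk (Finsupp.single x 1 ⊗ₜ a)) =
      g (QuotientAddGroup.mk (Finsupp.single x 1 ⊗ₜ a))) : f = g := by
  refine QuotientAddGroup.addMonoidHom_ext _ (AddMonoidHom.ext fun t => ?_)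
  induction t using TensorProduct.induction_on with
  | zero => rw [map_zero, map_zero]
  | add x y hx hy => rw [map_add, map_add, hx, hy]
  | tmul b a =>
    induction b using Finsupp.induction_linear with
    | zero => rw [zero_tmul, map_zero, map_zero]
    | add x y hx hy => rw [add_tmul, map_add, map_add, hx, hy]
    | single x k =>
      have : (Finsupp.single x k : Bar G m) ⊗ₜ[ℤ] a = Finsupp.single x 1 ⊗ₜ (k • a) := by
        rw [← smul_tmul, Finsupp.smul_single, smul_eq_mul, mul_one]
      rw [this]
      exact h x _

theorem lmapDomain_barR (m : ℕ) (g : G) (b : Bar G m) :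
    Finsupp.lmapDomain ℤ ℤ (fun g => nerveSimplex (vertices g)) (barR m g b) =
      Finsupp.lmapDomain ℤ ℤ (fun g => nerveSimplex (vertices g)) b := by
  refine (Finsupp.mapDomain_comp (v := b)).symm.trans (congrFun (congrArg _ (funext fun x => ?_)) b)
  change nerveSimplex (vertices (Function.update x 0 (g⁻¹ * x 0))) = _
  rw [vertices_update, nerveSimplex_mul_left]

/-- The map from bar symbols with coefficients in the integers to chains on the nerve. -/
noncomputable def tensorToFree (e : A ≃+ ℤ) (m : ℕ) :
    Bar G m ⊗[ℤ] A →ₗ[ℤ] (nerve (SingleObj G)) _⦋m⦌ →₀ ℤ :=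
  TensorProduct.lift (LinearMap.mk₂ ℤ
    (fun b a => e a • Finsupp.lmapDomain ℤ ℤ (fun g => nerveSimplex (vertices g)) b)
    (fun b b' a => by rw [map_add, smul_add]) (fun c b a => by rw [map_smul, smul_comm])
    (fun b a a' => by rw [map_add, add_smul])
    (fun c b a => by rw [map_zsmul, smul_assoc]))

theorem tensorToFree_tmul (e : A ≃+ ℤ) {m : ℕ} (b : Bar G m) (a : A) :
    tensorToFree e m (b ⊗ₜ a) =
      e a • Finsupp.lmapDomain ℤ ℤ (fun g => nerveSimplex (vertices g)) b :=
  rfl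

theorem barRel_le_ker (hρ : ∀ g a, ρ g a = a) (e : A ≃+ ℤ) (m : ℕ) : barRel ρ m ≤ (tensorToFree (G := G) e m).toAddMonoidHom.ker := by
  rw [barRel, AddSubgroup.closure_le]
  rintro _ ⟨b, g, a, rfl⟩
  rw [SetLike.mem_coe, AddMonoidHom.mem_ker, LinearMap.toAddMonoidHom_coe, map_sub, sub_eq_zero, hρ,
    tensorToFree_tmul, tensorToFree_tmul, lmapDomain_barR]

-- The coefficients in each simplicial degree are simplices of the nerve of (0, ℤ, 0), a group only
-- isomorphic to `ℤ`; hence the explicit identification `e`.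
variable (hρ : ∀ g a, ρ g a = a) (e : A ≃+ ℤ)

/-- The map from the bar construction with trivial integral coefficients to the chains on the
nerve. -/
noncomputable def toChains (m : ℕ) :
    BarTensor ρ m →+ (chains.obj (nerve (SingleObj G))).X m :=
  QuotientAddGroup.lift (barRel ρ m) (tensorToFree e m).toAddMonoidHom (barRel_le_ker hρ e m)

theorem toChains_mk (m : ℕ) (x : Fin (m + 1) → G) (a : A) :
    toChains hρ e m (QuotientAddGroup.mk (Finsupp.single x 1 ⊗ₜ a)) =
      e a • simplexChain (nerveSimplex (vertices x)) := by
  refine congrArg (fun c : (nerve (SingleObj G)) _⦋m⦌ →₀ ℤ => e a • c) ?_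
  exact Finsupp.mapDomain_single

variable (ρ) in
/-- The inverse of `toChains`. -/
noncomputable def ofChains (m : ℕ) :
    (chains.obj (nerve (SingleObj G))).X m →+ BarTensor ρ m :=
  freeLift fun x => QuotientAddGroup.mk (Finsupp.single (symbol x) 1 ⊗ₜ e.symm 1)

theorem ofChains_simplexChain {m : ℕ} (x : (nerve (SingleObj G)) _⦋m⦌) :
    ofChains ρ e m (simplexChain x) =
      QuotientAddGroup.mk (Finsupp.single (symbol x) 1 ⊗ₜ e.symm 1) :=
  freeLift_single _ _

theorem toChains_comp_ofChains (m : ℕ) :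
    (toChains hρ e m).comp (ofChains ρ e m) = AddMonoidHom.id _ :=
  chains_hom_ext fun x => by
    rw [AddMonoidHom.comp_apply, ofChains_simplexChain, toChains_mk, nerveSimplex_symbol,
      AddEquiv.apply_symm_apply, one_smul]
    rfl

theorem ofChains_comp_toChains (m : ℕ) :
    (ofChains ρ e m).comp (toChains hρ e m) = AddMonoidHom.id _ :=
  hom_ext fun x a => by
    rw [AddMonoidHom.comp_apply, toChains_mk, map_zsmul, ofChains_simplexChain,
      symbol_nerveSimplex, ← QuotientAddGroup.mk_zsmul, ← tmul_smul, ← map_zsmul, smul_eq_mul,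
      mul_one, AddEquiv.symm_apply_apply]
    -- The defining relation of the tensor product over the group, for the group element `x 0`,
    -- makes the leading entry equal to 1, and the trivial action leaves `a` unchanged.
    have : Function.update x 0 1 = Function.update x 0 ((x 0)⁻¹ * x 0) := by rw [inv_mul_cancel]
    refine (QuotientAddGroup.eq_iff_sub_mem).2 (AddSubgroup.subset_closure
      ⟨Finsupp.single x 1, x 0, a, ?_⟩)
    rw [hρ, this]
    refine congrArg (fun b : Bar G m => b ⊗ₜ[ℤ] a - Finsupp.single x 1 ⊗ₜ[ℤ] a) ?_
    exact (Finsupp.mapDomain_single (M := ℤ)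
      (f := fun y : Fin (m + 1) → G => Function.update y 0 ((x 0)⁻¹ * y 0))).symm

theorem barTensorD_mk (m : ℕ) (x : Fin (m + 2) → G) (a : A) :
    barTensorD ρ m (QuotientAddGroup.mk (Finsupp.single x 1 ⊗ₜ a)) =
      ∑ i : Fin (m + 2), (-1 : ℤ) ^ (i : ℕ) •
        (QuotientAddGroup.mk (Finsupp.single (Fin.contractNth i (· * ·) x) 1 ⊗ₜ a) :
          BarTensor ρ m) := by
  change QuotientAddGroup.mk' _ (LinearMap.rTensor A (barD G m) (Finsupp.single x 1 ⊗ₜ a)) = _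
  rw [LinearMap.rTensor_tmul, barD, LinearMap.sum_apply, sum_tmul, map_sum]
  refine Finset.sum_congr rfl fun i _ => ?_
  rw [LinearMap.smul_apply, ← smul_tmul', map_zsmul, Finsupp.lmapDomain_apply,
    Finsupp.mapDomain_single]
  rfl

theorem barTensorMap_mk {G' : Type u} [Group G'] {A' : Type} [AddCommGroup A']
    {ρ' : G' →* AddMonoid.End A'} (φ : G →* G') (f : A →+ A')
    (hf : ∀ g a, f (ρ g a) = ρ' (φ g) (f a)) (m : ℕ) (x : Fin (m + 1) → G) (a : A) :
    barTensorMap φ f hf m (QuotientAddGroup.mk (Finsupp.single x 1 ⊗ₜ a)) =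
      QuotientAddGroup.mk (Finsupp.single (fun i => φ (x i)) 1 ⊗ₜ f a) := by
  change QuotientAddGroup.mk (TensorProduct.map (barMap φ m) f.toIntLinearMap
    (Finsupp.single x 1 ⊗ₜ a)) = _
  rw [TensorProduct.map_tmul, barMap, Finsupp.lmapDomain_apply, Finsupp.mapDomain_single]
  rfl

theorem toChains_barTensorD (m : ℕ) (t : BarTensor ρ (m + 1)) :
    toChains hρ e m (barTensorD ρ m t) =
      ((chains.obj (nerve (SingleObj G))).d (m + 1) m).hom (toChains hρ e (m + 1) t) := by
  refine DFunLike.congr_fun (f := (toChains hρ e m).comp (barTensorD ρ m))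
    (g := ((chains.obj (nerve (SingleObj G))).d (m + 1) m).hom.comp (toChains hρ e (m + 1)))
    (hom_ext fun x a => ?_) t
  rw [AddMonoidHom.comp_apply, AddMonoidHom.comp_apply, toChains_mk, map_zsmul,
    chains_d_simplexChain, barTensorD_mk, map_sum, Finset.smul_sum]
  refine Finset.sum_congr rfl fun i _ => ?_
  rw [map_zsmul, toChains_mk, smul_comm, vertices_contractNth]
  rfl

theorem barComplex_d (m : ℕ) :
    (barComplex ρ).d (m + 1) m = AddCommGrpCat.ofHom (barTensorD ρ m) := by
  dsimp only [barComplex]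
  exact ChainComplex.of_d _ _ _

/-- The bar construction with trivial integral coefficients is the chain complex of the nerve. -/
noncomputable def barComplexIso : barComplex ρ ≅ chains.obj (nerve (SingleObj G)) :=
  HomologicalComplex.Hom.isoOfComponents (fun m =>
    { hom := AddCommGrpCat.ofHom (toChains hρ e m)
      inv := AddCommGrpCat.ofHom (ofChains ρ e m)
      hom_inv_id := AddCommGrpCat.hom_ext (ofChains_comp_toChains hρ e m)
      inv_hom_id := AddCommGrpCat.hom_ext (toChains_comp_ofChains hρ e m) }) (by
    rintro _ m rfl
    refine AddCommGrpCat.hom_ext (AddMonoidHom.ext fun t => ?_)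
    refine (toChains_barTensorD hρ e m t).symm.trans ?_
    exact congrArg (fun f : AddCommGrpCat.of (BarTensor ρ (m + 1)) ⟶
      AddCommGrpCat.of (BarTensor ρ m) => toChains hρ e m (f.hom t))
      (barComplex_d m).symm)

theorem barComplexIso_naturality {G' : Type u} [Group G'] {A' : Type} [AddCommGroup A']
    {ρ' : G' →* AddMonoid.End A'} (hρ' : ∀ g a, ρ' g a = a) (e' : A' ≃+ ℤ) (φ : G →* G')
    (f : A →+ A') (hf : ∀ g a, f (ρ g a) = ρ' (φ g) (f a)) (h : ∀ a, e' (f a) = e a) :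
    barComplexMap φ f hf ≫ (barComplexIso hρ' e').hom =
      (barComplexIso hρ e).hom ≫ chains.map (nerveMap (SingleObj.mapHom G G' φ)) := by
  refine HomologicalComplex.hom_ext _ _ fun m => AddCommGrpCat.hom_ext ?_
  change (toChains hρ' e' m).comp (barTensorMap φ f hf m) =
    ((chains.map (nerveMap (SingleObj.mapHom G G' φ))).f m).hom.comp (toChains hρ e m)
  refine hom_ext fun x a => ?_
  rw [AddMonoidHom.comp_apply, AddMonoidHom.comp_apply, toChains_mk, map_zsmul,
    chains_map_simplexChain, nerveMap_nerveSimplex, barTensorMap_mk, toChains_mk, vertices_map, h]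

end BarTensor

end

/-! ### Assembling the three comparisons for a crossed module. -/

section

open Simplicial Opposite

namespace CrossedModule

variable {H G : Type u} [Group H] [Group G] [MulDistribMulAction G H] (X : CrossedModule H G)

/-- The simplices of the nerve of `(0, ℤ, 0)` are the integers. -/
def abSimplexEquivInt (n : ℕ) :
    abSimplex (0 : PUnit.{1} →+ ℤ) (Fin (n + 1)) ≃+ ℤ where
  toFun a := a.1.1 0
  invFun k := ⟨(fun _ => k, fun _ _ => 0), fun _ _ _ => rfl, fun _ _ => (zero_add k).symm⟩
  left_inv a := Subtype.ext (Prod.ext (funext fun i => by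
    have := a.2.2 0 i
    exact this.trans (zero_add _)) rfl)
  right_inv _ := rfl
  map_add' _ _ := rfl

theorem trivial_act (n : SimplexCategoryᵒᵖ) (g : X.nerve.obj n)
    (a : (abNerve (0 : PUnit.{1} →+ ℤ)).obj n) :
    (Action.trivial X (0 : PUnit.{1} →+ ℤ)).toSimplicialAction.act n g a = a :=
  rfl

/-- The bar constructions on the nerve of a crossed module with trivial integral coefficients are
the chains on the rows of the bisimplicial nerve. -/
noncomputable def simplicialComplexIso :
    (Action.trivial X (0 : PUnit.{1} →+ ℤ)).toSimplicialAction.simplicialComplex ≅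
      X.binerve ⋙ chains :=
  NatIso.ofComponents (fun n => BarTensor.barComplexIso (X.trivial_act n) (abSimplexEquivInt _))
    fun {n m} f => BarTensor.barComplexIso_naturality (X.trivial_act n) (abSimplexEquivInt _)
      (X.trivial_act m) (abSimplexEquivInt _) _ _ _ fun a =>
        (a.2.2 (f.unop.toOrderHom 0) 0).trans (zero_add _)

/-- The bicomplex computing the integral homology of a crossed module is that of the bisimplicial
nerve. -/
noncomputable def bicomplexIso :
    (Action.trivial X (0 : PUnit.{1} →+ ℤ)).toSimplicialAction.bicomplex ≅
      BisimplicialAb.bicomplex.obj (BisimplicialAb.free.obj X.binerve) :=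
  (AlgebraicTopology.alternatingFaceMapComplex _).mapIso X.simplicialComplexIso

/-- The integral homology of a crossed module is that of the total complex of its bisimplicial
nerve. -/
noncomputable def integralHomologyIso (n : ℕ) : X.integralHomology n ≅
    (BisimplicialAb.totComplex.obj (BisimplicialAb.free.obj X.binerve)).homology n :=
  (HomologicalComplex.homologyFunctor _ _ n).mapIso
    (HomologicalComplex₂.total.mapIso X.bicomplexIso (ComplexShape.down ℕ) ≪≫
      HomologicalComplex₂.totalIsoTot _)

/-- The diagonal of the free bisimplicial abelian group on the bisimplicial nerve is the free
simplicial abelian group on the diagonal. -/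
noncomputable def diagComplexIso :
    BisimplicialAb.diagComplex.obj (BisimplicialAb.free.obj X.binerve) ≅
      chains.obj X.diagNerve :=
  (AlgebraicTopology.alternatingFaceMapComplex _).mapIso
    (NatIso.ofComponents (fun _ => Iso.refl _) fun {n m} f => by
      refine (Category.comp_id _).trans (Eq.trans ?_ (Category.id_comp _).symm)
      exact (freeAb.map_comp ((X.binerve.map f).app n) ((X.binerve.obj m).map f)).symm)

/-- The Baues–Ellis homology of a crossed module is the simplicial homology of the diagonal of its
bisimplicial nerve. -/
noncomputable def bauesEllisHomologyIso (n : ℕ) : (chains.obj X.diagNerve).homology n ≅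
    X.bauesEllisHomology n :=
  have : QuasiIso (chains.map (sSetTopAdj.unit.app X.diagNerve)) :=
    SSet.chainsEquivSingular X.diagNerve
  asIso (HomologicalComplex.homologyMap (chains.map (sSetTopAdj.unit.app X.diagNerve)) n) ≪≫
    (HomologicalComplex.homologyFunctor _ _ n).mapIso
      (chainComplexFunctorIsoChains.symm.app (TopCat.toSSet.obj X.classifyingSpace))

end CrossedModule

end

theorem mainTheorem9 {H G : Type u} [Group H] [Group G] [MulDistribMulAction G H]
    (X : CrossedModule H G) (n : ℕ) :
    Nonempty (X.integralHomology n ≃+ X.bauesEllisHomology n) := by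
  obtain ⟨e⟩ := BisimplicialAb.nonempty_homology_diagComplex_iso_totComplex
    (BisimplicialAb.free.obj X.binerve) n
  exact ⟨(X.integralHomologyIso n ≪≫ e.symm ≪≫
    (HomologicalComplex.homologyFunctor _ _ n).mapIso X.diagComplexIso ≪≫
    X.bauesEllisHomologyIso n).addCommGroupIsoToAddEquiv⟩
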